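/- Let $d\ge 1$ and let $\Omega\subset\mathbb R^d$ be a bounded domain (bounded, open, connected, nonempty). For a bounded domain $D$ and $\tau\ge 0$ let $\Gamma_1\le\Gamma_2\le\dots$ be the eigenvalues, counted with multiplicity, of the clamped plate problem with tension $$\Delta^2u-\tau\Delta u=\Gamma u \text{ on } D,\qquad u=\frac{\partial u}{\partial n}=0\text{ on }\partial D,$$ understood weakly in $H^2_0(D)$. Let $V$ denote the volume, and $I_4(D)=\int_D|x|^4\,dx$ the fourth polar moment of mass about the origin. Say that $\Omega$ admits $2$-frames if, up to constant multiples, $|x|^4$ is the only homogeneous polynomial of degree $4$ invariant under the group of all orthogonal transformations $U$ with $U(\Omega)=\Omega$. **Theorem.** Suppose $\Omega$ admits $2$-frames, let $n\in\mathbb N$, and let $T$ range over the invertible linear transformations of $\mathbb R^d$ if $\tau=0$, and over those with $|\det T|=1$ if $\tau>0$. Then $$(\Gamma_1+\dots+\Gamma_n)V^{4/d}\Big|_{\tau,T(\Omega)}\cdot\left.\frac{V^{1+4/d}}{I_4}\right|_{T^{-1}(\Omega)}$$ is maximal when $T$ is a scalar multiple of an orthogonal matrix. If $d=2$ (write $A$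 for the area), then for every invertible linear $T$ this quantity equals $$(\Gamma_1+\dots+\Gamma_n)A^2\cdot\frac{A^3}{I_4}\Big|_{\tau,T(\Omega)},$$ so, under the same assumptions on $\tau$ and $T$, the latter is maximal when $T$ is a scalar multiple of an orthogonal matrix. In particular, taking $I_4$ about the centroid, the quantity $(\Gamma_1+\dots+\Gamma_n)A^2\cdot A^3/I_4$ is maximal for equilateral triangles among all triangles if $\tau=0$, and among all triangles of the same area if $\tau>0$; and it is maximal for disks among all ellipses if $\tau=0$, and among all ellipses of the same area if $\tau>0$. -/

import Mathlib

open MeasureTheory Filter Topology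
open scoped ContDiff

/-! ### Clamped plate with tension -/

/-- `φ ∈ C_c^∞(Ω)`, real valued, extended by zero to the whole space. -/
def IsTestFunction {d : ℕ} (Ω : Set (EuclideanSpace ℝ (Fin d)))
    (φ : EuclideanSpace ℝ (Fin d) → ℝ) : Prop :=
  ContDiff ℝ ∞ φ ∧ HasCompactSupport φ ∧ tsupport φ ⊆ Ω

/-- The squared `H²` norm `∫ |φ|² + |Dφ|² + |D²φ|²` of a smooth compactly supported function. -/
noncomputable def sobolevNormSq {d : ℕ} (φ : EuclideanSpace ℝ (Fin d) → ℝ) : ℝ :=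
  ∑ j ∈ Finset.range 3, ∫ x, ‖iteratedFDeriv ℝ j φ x‖ ^ 2

/-- `u ∈ H²₀(Ω)`, the closure of `C_c^∞(Ω)` in the `H²` norm: `u ∈ L²(ℝᵈ)` (extended by zero) is
the `L²` limit of a sequence of test functions which is Cauchy in the `H²` norm. -/
def MemSobolevH20 {d : ℕ} (Ω : Set (EuclideanSpace ℝ (Fin d)))
    (u : Lp ℝ 2 (volume : Measure (EuclideanSpace ℝ (Fin d)))) : Prop :=
  ∃ φ : ℕ → EuclideanSpace ℝ (Fin d) → ℝ,
    (∀ k, IsTestFunction Ω (φ k)) ∧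
    Tendsto (fun k => ∫ x, (φ k x - u x) ^ 2) atTop (𝓝 0) ∧
    Tendsto (fun p : ℕ × ℕ => sobolevNormSq (fun x => φ p.1 x - φ p.2 x)) atTop (𝓝 0)

/-- `u` solves the clamped plate problem `Δ²u - τΔu = γu` on `Ω`, `u = ∂u/∂n = 0` on `∂Ω`, weakly:
`u ∈ H²₀(Ω)` and `∫ u (Δ²φ - τΔφ) = γ ∫ u φ` for all `φ ∈ C_c^∞(Ω)`. -/
def IsWeakPlateSolution {d : ℕ} (τ γ : ℝ) (Ω : Set (EuclideanSpace ℝ (Fin d)))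
    (u : Lp ℝ 2 (volume : Measure (EuclideanSpace ℝ (Fin d)))) : Prop :=
  MemSobolevH20 Ω u ∧
    ∀ φ : EuclideanSpace ℝ (Fin d) → ℝ, IsTestFunction Ω φ →
      ∫ x, u x * (Laplacian.laplacian (Laplacian.laplacian φ) x - τ * Laplacian.laplacian φ x)
        = γ * ∫ x, u x * φ x

/-- The number of eigenvalues `≤ t`, counted with multiplicity: the dimension of the span of all
eigenfunctions whose eigenvalue is `≤ t`. -/
noncomputable def plateCounting {d : ℕ} (τ : ℝ) (Ω : Set (EuclideanSpace ℝ (Fin d))) (t : ℝ) :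
    Cardinal :=
  Module.rank ℝ (Submodule.span ℝ {u : Lp ℝ 2 (volume : Measure (EuclideanSpace ℝ (Fin d))) |
    ∃ γ ≤ t, IsWeakPlateSolution τ γ Ω u})

/-- `Γ_k`, the `k`-th eigenvalue (`k ≥ 1`), in increasing order and counted with multiplicity: the
least `t` such that at least `k` eigenvalues are `≤ t`. -/
noncomputable def plateEigenvalue {d : ℕ} (τ : ℝ) (Ω : Set (EuclideanSpace ℝ (Fin d))) (k : ℕ) :
    ℝ :=
  sInf {t : ℝ | (k : Cardinal) ≤ plateCounting τ Ω t}

/-- `Γ₁ + … + Γ_n`. -/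
noncomputable def plateEigenvalueSum {d : ℕ} (τ : ℝ) (n : ℕ)
    (Ω : Set (EuclideanSpace ℝ (Fin d))) : ℝ :=
  ∑ k ∈ Finset.Icc 1 n, plateEigenvalue τ Ω k

/-! ### Geometry -/

/-- `∫_Ω |x - c|⁴ dx`, the fourth polar moment of mass of `Ω` about the point `c`. -/
noncomputable def fourthMoment {d : ℕ} (c : EuclideanSpace ℝ (Fin d))
    (Ω : Set (EuclideanSpace ℝ (Fin d))) : ℝ :=
  ∫ x in Ω, ‖x - c‖ ^ 4

/-- The linear isometries `U ∈ O(d)` with `U(Ω) = Ω`. -/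
def linearSymmetries {d : ℕ} (Ω : Set (EuclideanSpace ℝ (Fin d))) :
    Set (EuclideanSpace ℝ (Fin d) ≃ₗᵢ[ℝ] EuclideanSpace ℝ (Fin d)) :=
  {U | U '' Ω = Ω}

/-- `Ω` admits `p`-frames: up to constant multiples `|x|^{2p}` is the only homogeneous polynomial
of degree `2p` that is invariant under the group of linear isometries of `Ω`. -/
def AdmitsFrames {d : ℕ} (p : ℕ) (Ω : Set (EuclideanSpace ℝ (Fin d))) : Prop :=
  ∀ P : MvPolynomial (Fin d) ℝ, P.IsHomogeneous (2 * p) →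
    (∀ U ∈ linearSymmetries Ω, ∀ x : EuclideanSpace ℝ (Fin d),
      P.eval (fun i => U x i) = P.eval (fun i => x i)) →
    ∃ c : ℝ, ∀ x : EuclideanSpace ℝ (Fin d), P.eval (fun i => x i) = c * ‖x‖ ^ (2 * p)

/-- A bounded domain: bounded, open and connected (in particular nonempty). -/
def IsBoundedDomain {d : ℕ} (Ω : Set (EuclideanSpace ℝ (Fin d))) : Prop :=
  IsOpen Ω ∧ IsConnected Ω ∧ Bornology.IsBounded Ω

/-- `T` is a scalar multiple of an orthogonal transformation. -/
def IsMultipleOfOrthogonal {d : ℕ}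
    (T : EuclideanSpace ℝ (Fin d) ≃ₗ[ℝ] EuclideanSpace ℝ (Fin d)) : Prop :=
  ∃ (c : ℝ) (U : EuclideanSpace ℝ (Fin d) ≃ₗᵢ[ℝ] EuclideanSpace ℝ (Fin d)),
    ∀ x, T x = c • U x

/-- The standing assumption `τ = 0`, or `|det T| = 1` and `τ > 0`. -/
def AdmissibleTension {d : ℕ} (τ : ℝ)
    (T : EuclideanSpace ℝ (Fin d) ≃ₗ[ℝ] EuclideanSpace ℝ (Fin d)) : Prop :=
  τ = 0 ∨ (|LinearMap.det (T : EuclideanSpace ℝ (Fin d) →ₗ[ℝ] EuclideanSpace ℝ (Fin d))| = 1 ∧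
    0 < τ)

/-- `(Γ₁ + … + Γ_n) V^{4/d}` evaluated on `T(Ω)`, times `V^{1 + 4/d} / I₄` evaluated on
`T⁻¹(Ω)`. -/
noncomputable def plateProduct {d : ℕ} (τ : ℝ) (n : ℕ) (Ω : Set (EuclideanSpace ℝ (Fin d)))
    (T : EuclideanSpace ℝ (Fin d) ≃ₗ[ℝ] EuclideanSpace ℝ (Fin d)) : ℝ :=
  (plateEigenvalueSum τ n (T '' Ω) * volume.real (T '' Ω) ^ ((4 : ℝ) / d)) *
    (volume.real (T.symm '' Ω) ^ (1 + (4 : ℝ) / d) / fourthMoment 0 (T.symm '' Ω))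

/-- `(Γ₁ + … + Γ_n) A² · A³ / I₄` of a planar domain, with `I₄` taken about the point `c`. -/
noncomputable def planarPlateProduct (τ : ℝ) (n : ℕ) (c : EuclideanSpace ℝ (Fin 2))
    (Ω : Set (EuclideanSpace ℝ (Fin 2))) : ℝ :=
  (plateEigenvalueSum τ n Ω * volume.real Ω ^ 2) * (volume.real Ω ^ 3 / fourthMoment c Ω)

/-- The open ellipse with centre `c` which is the image of the unit disk under `x ↦ c + T x`. -/
def ellipse (c : EuclideanSpace ℝ (Fin 2))
    (T : EuclideanSpace ℝ (Fin 2) ≃ₗ[ℝ] EuclideanSpace ℝ (Fin 2)) :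
    Set (EuclideanSpace ℝ (Fin 2)) :=
  (fun x => c + T x) '' Metric.ball 0 1

/-! The eigenvalue sum is the infimum of the total energy `∑ ∫ |Δf_j|² + τ|∇f_j|²` over
L²-orthonormal families of test functions. Ky Fan's inequality (`IsEigenSystem.sum_le`) and density
of test functions (`IsEigenSystem.le_sum_of_dense`) give this once the form domain is known to embed
compactly in L²; the result is `plateEigenvalueSum_le` and `le_plateEigenvalueSum`, after which
eigenfunctions play no role.

Let f_j be such a family on Ω and U a symmetry of Ω. Since SU(Ω) = S(Ω), the normalized functions
f_j ∘ (SU)⁻¹ are admissible on S(Ω), so every U bounds the same eigenvalue sum from above. On the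
Fourier side (`plateEnergy_schwartzPullback`) their energy is that of f_j with ξ replaced by BUξ in
the weight `|2πξ|⁴ + τ|2πξ|²`, where B is the transposed inverse of S. Averaging over U turns |BUξ|⁴
into an invariant quartic form, which by the frame hypothesis is c|ξ|⁴. No invariant measure is
needed: `exists_invariant_quartic` takes the element of least norm in the closed convex hull of the
orbit, and a linear bound valid along the orbit is valid there (`AdmitsFrames.exists_average`).

The constant is found by integrating the same average over Ω: c ∫_Ω |x|⁴ = ∫_Ω |Bx|⁴. Because
directional fourth moments of Ω are the same in all directions, Fubini removes the transposition
(`AdmitsFrames.setIntegral_adjoint`), leaving ∫_Ω |S⁻¹x|⁴, which is the fourth moment of S⁻¹(Ω) up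
to the determinant. For τ > 0 the quadratic term is bounded by `sq_le_half_add`, so that it
contributes at most (c + 1)/2 times its original value; this is at most c times, because |det S| = 1
forces c ≥ 1 by Hadamard's inequality and AM-GM. Similarities give equality by scaling
(`plateProduct_le`).

In the plane the inverse is, up to the determinant and quarter turns, the transpose, so T⁻¹(Ω) can
be traded for T(Ω) (`AdmitsFrames.setIntegral_symm`). A threefold rotation already forces 2-frames
(`admitsFrames_two_of_threefold`), which covers disks and equilateral triangles; all ellipses and
triangles are affine images of these. -/

/-! ### Eigenvalues of compact embeddings of Hilbert spaces -/

section CompactEmbedding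

open scoped InnerProductSpace

variable {V H : Type*} [NormedAddCommGroup V] [InnerProductSpace ℝ V]
  [NormedAddCommGroup H] [InnerProductSpace ℝ H]

/-- A compact nonzero operator attains its norm at a singular vector. -/
theorem IsCompactOperator.exists_inner_eq_norm_sq_mul [CompleteSpace V] [CompleteSpace H]
    (T : V →L[ℝ] H) (hT : IsCompactOperator T)
    (h0 : T ≠ 0) :
    ∃ e : V, e ≠ 0 ∧ ∀ w, ⟪T e, T w⟫_ℝ = ‖T‖ ^ 2 * ⟪e, w⟫_ℝ := by
  set S : V →L[ℝ] V := T.adjoint ∘L T with hS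
  have hSn : ‖S‖ = ‖T‖ ^ 2 := by
    rw [hS, ContinuousLinearMap.norm_adjoint_comp_self, sq]
  have hSc : IsCompactOperator S := hT.clm_comp T.adjoint
  have hsymm : (S : V →ₗ[ℝ] V).IsSymmetric := by
    intro x y
    simp [hS, ContinuousLinearMap.adjoint_inner_left, ContinuousLinearMap.adjoint_inner_right]
  have hnt : Nontrivial V := by
    by_contra h
    rw [not_nontrivial_iff_subsingleton] at h
    exact h0 (ContinuousLinearMap.ext fun x => by simp [Subsingleton.elim x 0])
  have hSpos : 0 < ‖S‖ := by
    rw [hSn]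
    have := norm_pos_iff.mpr h0
    positivity
  -- Otherwise the Rayleigh quotient would stay below ‖S‖ by a fixed gap, while for a symmetric
  -- operator the supremum of its absolute value is the norm, and here the quotient is nonnegative.
  have hmem : ‖S‖ ∈ spectrum ℝ S := by
    intro hres
    obtain ⟨ε, hε, hle⟩ := S.rayleighQuotient_le_of_norm_mem_resolventSet
      (by simpa [spectrum] using hres)
    have hpos : ∀ x, 0 ≤ S.rayleighQuotient x := by
      intro x
      apply div_nonneg _ (sq_nonneg _)
      simp [ContinuousLinearMap.reApplyInnerSelf, hS, ContinuousLinearMap.adjoint_inner_left]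
    have h1 := S.norm_eq_iSup_rayleighQuotient hsymm
    have h2 : ⨆ x, |S.rayleighQuotient x| ≤ ‖S‖ - ε := by
      apply ciSup_le
      intro x
      rw [abs_of_nonneg (hpos x)]
      exact hle x
    linarith
  have hev := (hSc.hasEigenvalue_iff_mem_spectrum hSpos.ne').mpr hmem
  obtain ⟨e, he⟩ := hev.exists_hasEigenvector
  refine ⟨e, he.2, fun w => ?_⟩
  have h := he.apply_eq_smul
  have h' : S e = ‖S‖ • e := h
  rw [← ContinuousLinearMap.adjoint_inner_left]
  change ⟪S e, w⟫_ℝ = _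
  rw [h', inner_smul_left, hSn]
  simp

/-- `e 0, …, e (n - 1)` are the first `n` eigenvectors, with eigenvalues `l 0 ≤ … ≤ l (n - 1)`, of
the quadratic form `‖v‖²` relative to `‖π v‖²`. -/
structure IsEigenSystem (π : V →L[ℝ] H) (n : ℕ) (e : ℕ → V) (l : ℕ → ℝ) : Prop where
  inner_eq : ∀ i < n, ∀ v, ⟪e i, v⟫_ℝ = l i * ⟪π (e i), π v⟫_ℝ
  orthonormal : ∀ i < n, ∀ j < n, ⟪π (e i), π (e j)⟫_ℝ = if i = j then 1 else 0
  le_norm_sq : ∀ k < n, ∀ v, (∀ i < k, ⟪π (e i), π v⟫_ℝ = 0) → l k * ‖π v‖ ^ 2 ≤ ‖v‖ ^ 2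

namespace IsEigenSystem

variable {π : V →L[ℝ] H} {n : ℕ} {e : ℕ → V} {l : ℕ → ℝ}

theorem norm_map_sq (h : IsEigenSystem π n e l) {i : ℕ} (hi : i < n) : ‖π (e i)‖ ^ 2 = 1 := by
  rw [← real_inner_self_eq_norm_sq, h.orthonormal i hi i hi, if_pos rfl]

theorem norm_sq (h : IsEigenSystem π n e l) {i : ℕ} (hi : i < n) : ‖e i‖ ^ 2 = l i := by
  rw [← real_inner_self_eq_norm_sq, h.inner_eq i hi, h.orthonormal i hi i hi, if_pos rfl, mul_one]

theorem mono (h : IsEigenSystem π n e l) {i j : ℕ} (hij : i ≤ j) (hj : j < n) : l i ≤ l j := by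
  have := h.le_norm_sq i (by omega) (e j) fun m hm => by
    rw [h.orthonormal m (by omega) j hj, if_neg (by omega)]
  rwa [h.norm_map_sq hj, h.norm_sq hj, mul_one] at this

end IsEigenSystem

/-- Greedy construction: the next eigenvector is a maximizing singular vector of π restricted to the
orthogonal complement of the previous ones, which is nonzero because V has infinite dimension. -/
theorem exists_isEigenSystem [CompleteSpace V] [CompleteSpace H] (π : V →L[ℝ] H) (hc : IsCompactOperator π)
    (hinj : Function.Injective π) (hV : ¬ FiniteDimensional ℝ V) (n : ℕ) :
    ∃ (e : ℕ → V) (l : ℕ → ℝ), IsEigenSystem π n e l := by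
  induction n with
  | zero => exact ⟨0, 0, by constructor <;> simp⟩
  | succ n ih =>
    obtain ⟨e, l, h⟩ := ih
    set F : Submodule ℝ V := Submodule.span ℝ (e '' Set.Iio n) with hF
    have hFfin : FiniteDimensional ℝ F :=
      FiniteDimensional.span_of_finite ℝ ((Set.finite_Iio n).image e)
    set W := Fᗮ with hW
    have hWne : W ≠ ⊥ := by
      intro hbot
      have hFtop : F = ⊤ := (Submodule.orthogonal_eq_bot_iff).mp hbot
      rw [hFtop] at hFfin
      exact hV (Module.Finite.equiv (Submodule.topEquiv (R := ℝ) (M := V)))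
    -- Orthogonality for the form and for its image in H coincide against eigenvectors, as their
    -- eigenvalues are nonzero.
    have hmemW : ∀ v, v ∈ W ↔ ∀ i < n, ⟪π (e i), π v⟫_ℝ = 0 := by
      intro v
      rw [hW, Submodule.mem_orthogonal]
      constructor
      · intro hv i hi
        have h1 := hv (e i) (Submodule.subset_span ⟨i, hi, rfl⟩)
        rw [h.inner_eq i hi] at h1
        have hl : l i ≠ 0 := by
          rw [← h.norm_sq hi]
          have h2 := h.norm_map_sq hi
          intro h3
          have h4 : e i = 0 := by simpa using h3
          simp [h4] at h2
        exact (mul_eq_zero.mp h1).resolve_left hl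
      · intro hv u hu
        induction hu using Submodule.span_induction with
        | mem x hx =>
          obtain ⟨i, hi, rfl⟩ := hx
          rw [h.inner_eq i hi, hv i hi, mul_zero]
        | zero => simp
        | add x y _ _ hx hy => rw [inner_add_left, hx, hy, add_zero]
        | smul a x _ hx => rw [inner_smul_left, hx, mul_zero]
    set T : W →L[ℝ] H := π ∘L W.subtypeL with hT
    have hTc : IsCompactOperator T := hc.comp_clm W.subtypeL
    have hT0 : T ≠ 0 := by
      intro h0
      obtain ⟨x, hx, hx0⟩ := Submodule.exists_mem_ne_zero_of_ne_bot hWne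
      apply hx0
      apply hinj
      have := DFunLike.congr_fun h0 (⟨x, hx⟩ : W)
      simpa [hT] using this
    have hTpos : 0 < ‖T‖ := (norm_nonneg T).lt_of_ne (Ne.symm (mt (ContinuousLinearMap.opNorm_zero_iff (f := T)).mp hT0))
    obtain ⟨e₀, he0, hinner⟩ := IsCompactOperator.exists_inner_eq_norm_sq_mul T hTc hT0
    have hπ0 : π e₀ ≠ 0 := by
      intro h0
      apply he0
      have : (e₀ : V) = 0 := hinj (by simpa using h0)
      exact_mod_cast this
    have hπpos : 0 < ‖π e₀‖ := norm_pos_iff.mpr hπ0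
    set a : V := ‖π e₀‖⁻¹ • (e₀ : V) with ha
    have haW : a ∈ W := W.smul_mem _ e₀.2
    have hπa : ⟪π a, π a⟫_ℝ = 1 := by
      rw [ha, map_smul, inner_smul_left, inner_smul_right, real_inner_self_eq_norm_sq]
      simp
      field_simp
    -- The singular vector equation is known only on W. On F both sides vanish, and V = F ⊕ W.
    have hainner : ∀ v, ⟪a, v⟫_ℝ = 1 / ‖T‖ ^ 2 * ⟪π a, π v⟫_ℝ := by
      have hw : ∀ w ∈ W, ⟪a, w⟫_ℝ = 1 / ‖T‖ ^ 2 * ⟪π a, π w⟫_ℝ := by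
        intro w hw
        have h1 := hinner ⟨w, hw⟩
        simp only [hT, ContinuousLinearMap.comp_apply, Submodule.subtypeL_apply,
          Submodule.coe_inner] at h1
        rw [ha, map_smul, inner_smul_left, inner_smul_left, h1]
        field_simp
        rfl
      have hf : ∀ u ∈ F, ⟪a, u⟫_ℝ = 0 ∧ ⟪π a, π u⟫_ℝ = 0 := by
        intro u hu
        refine ⟨by rw [real_inner_comm]; exact haW u hu, ?_⟩
        induction hu using Submodule.span_induction with
        | mem x hx =>
          obtain ⟨i, hi, rfl⟩ := hx
          rw [real_inner_comm]
          exact (hmemW a).mp haW i hi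
        | zero => simp
        | add x y _ _ hx hy => rw [map_add, inner_add_right, hx, hy, add_zero]
        | smul c x _ hx => rw [π.map_smul c x, inner_smul_right, hx, mul_zero]
      intro v
      obtain ⟨y, hy, z, hz, rfl⟩ := F.exists_add_mem_mem_orthogonal v
      rw [map_add, inner_add_right, inner_add_right, hw z hz, (hf y hy).1, (hf y hy).2]
      ring
    have hup : ∀ v ∈ W, 1 / ‖T‖ ^ 2 * ‖π v‖ ^ 2 ≤ ‖v‖ ^ 2 := by
      intro v hv
      have h1 : ‖π v‖ ≤ ‖T‖ * ‖v‖ := T.le_opNorm (⟨v, hv⟩ : W)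
      rw [div_mul_eq_mul_div, one_mul, div_le_iff₀ (by positivity)]
      calc ‖π v‖ ^ 2 ≤ (‖T‖ * ‖v‖) ^ 2 := by gcongr
        _ = _ := by ring
    refine ⟨Function.update e n a, Function.update l n (1 / ‖T‖ ^ 2), ?_, ?_, ?_⟩
    · intro i hi v
      rcases eq_or_ne i n with rfl | hne
      · simpa using hainner v
      · simpa [hne] using h.inner_eq i (by omega) v
    · intro i hi j hj
      rcases eq_or_ne i n with hin | hne <;> rcases eq_or_ne j n with hjn | hne'
      · simpa [hin, hjn] using hπa
      · simp only [hin, Function.update_self, Function.update_of_ne hne', hne'.symm, if_false]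
        rw [real_inner_comm]
        exact (hmemW a).mp haW j (by omega)
      · simp only [hjn, Function.update_self, Function.update_of_ne hne, hne, if_false]
        exact (hmemW a).mp haW i (by omega)
      · simpa [hne, hne'] using h.orthonormal i (by omega) j (by omega)
    · intro k hk v hv
      have hv' : ∀ i < k, ⟪π (e i), π v⟫_ℝ = 0 := by
        intro i hi
        have := hv i hi
        rwa [Function.update_of_ne (by omega)] at this
      rcases eq_or_ne k n with rfl | hne
      · simpa using hup v ((hmemW v).mpr hv')
      · simpa [hne] using h.le_norm_sq k (by omega) v hv'

namespace IsEigenSystem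

variable {π : V →L[ℝ] H} {n : ℕ} {e : ℕ → V} {l : ℕ → ℝ}

/-- **Ky Fan's inequality**: the sum of the first eigenvalues bounds the trace of the form on any
orthonormal family from below. -/
theorem sum_le (h : IsEigenSystem π n e l) (φ : Fin n → V)
    (hφ : Orthonormal ℝ fun j => π (φ j)) :
    ∑ i : Fin n, l i ≤ ∑ j, ‖φ j‖ ^ 2 := by
  rcases n with _ | m
  · simp
  set c : Fin (m + 1) → Fin (m + 1) → ℝ := fun i j => ⟪π (e i), π (φ j)⟫_ℝ with hc
  have horth : Orthonormal ℝ fun i : Fin (m + 1) => π (e i) := by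
    rw [orthonormal_iff_ite]
    intro i j
    rw [h.orthonormal i i.2 j j.2]
    simp [Fin.ext_iff]
  have hrow : ∀ i, ∑ j, c i j ^ 2 ≤ 1 := by
    intro i
    have := hφ.sum_inner_products_le (x := π (e i)) (s := Finset.univ)
    rw [h.norm_map_sq i.2] at this
    simpa [hc, real_inner_comm] using this
  -- Split φ j into its component y along the eigenvectors and a remainder r orthogonal to them in
  -- both senses. The energy of y is computed exactly; that of r is at least the largest eigenvalue
  -- l m times ‖π r‖².
  have hlow : ∀ j, ∑ i : Fin (m + 1), l i * c i j ^ 2 + l m * (1 - ∑ i, c i j ^ 2) ≤ ‖φ j‖ ^ 2 := by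
    intro j
    set y : V := ∑ i : Fin (m + 1), c i j • e i with hy
    set r : V := φ j - y with hr
    have hπr : ∀ i : Fin (m + 1), ⟪π (e i), π r⟫_ℝ = 0 := by
      intro i
      rw [hr, map_sub, inner_sub_right, hy, map_sum, inner_sum]
      simp only [map_smul, inner_smul_right]
      simp_rw [fun k : Fin (m + 1) => h.orthonormal i i.2 k k.2]
      simp [hc, ← Fin.ext_iff]
    have hyr : ⟪y, r⟫_ℝ = 0 := by
      rw [hy, sum_inner]
      refine Finset.sum_eq_zero fun i _ => ?_
      rw [inner_smul_left, h.inner_eq i i.2, hπr i]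
      simp
    have hπyr : ⟪π y, π r⟫_ℝ = 0 := by
      rw [hy, map_sum, sum_inner]
      refine Finset.sum_eq_zero fun i _ => ?_
      rw [map_smul, inner_smul_left, hπr i, mul_zero]
    have hφy : φ j = y + r := by rw [hr]; abel
    have hπy : ‖π y‖ ^ 2 = ∑ i, c i j ^ 2 := by
      rw [← real_inner_self_eq_norm_sq]
      have : π y = ∑ i, c i j • π (e i) := by rw [hy, map_sum]; simp
      rw [this, horth.inner_sum]
      simp [sq]
    have hyn : ‖y‖ ^ 2 = ∑ i : Fin (m + 1), l i * c i j ^ 2 := by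
      rw [← real_inner_self_eq_norm_sq]
      conv_lhs => rw [hy, sum_inner]
      refine Finset.sum_congr rfl fun i _ => ?_
      rw [inner_smul_left, h.inner_eq i i.2]
      have : ⟪π (e i), π y⟫_ℝ = c i j := by
        have h1 := hπr i
        rw [hr, map_sub, inner_sub_right, sub_eq_zero] at h1
        exact h1.symm
      rw [this]
      simp
      ring
    have h1 : ‖φ j‖ ^ 2 = ‖y‖ ^ 2 + ‖r‖ ^ 2 := by
      rw [hφy, norm_add_sq_real, hyr]; ring
    have h2 : ‖π (φ j)‖ ^ 2 = ‖π y‖ ^ 2 + ‖π r‖ ^ 2 := by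
      rw [hφy, map_add, norm_add_sq_real, hπyr]; ring
    rw [hφ.1 j, hπy] at h2
    have h3 : l m * ‖π r‖ ^ 2 ≤ ‖r‖ ^ 2 :=
      h.le_norm_sq m (by omega) r fun i hi => hπr ⟨i, by omega⟩
    rw [h1, hyn]
    have h4 : ‖π r‖ ^ 2 = 1 - ∑ i, c i j ^ 2 := by linarith
    rw [← h4]
    linarith
  -- Bessel makes each row sum of c² at most 1, so moving the deficit from l i to the larger l m
  -- only increases the total. Exchanging the sums works because there are as many test vectors as
  -- eigenvectors.
  calc ∑ i : Fin (m + 1), l i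
      ≤ ∑ i : Fin (m + 1), (l i * ∑ j, c i j ^ 2 + l m * (1 - ∑ j, c i j ^ 2)) := by
        refine Finset.sum_le_sum fun i _ => ?_
        have h1 := h.mono (show (i : ℕ) ≤ m by omega) (by omega)
        have h2 := hrow i
        nlinarith
    _ = ∑ j, (∑ i : Fin (m + 1), l i * c i j ^ 2 + l m * (1 - ∑ i, c i j ^ 2)) := by
        simp only [Finset.sum_add_distrib, Finset.mul_sum, mul_sub, Finset.sum_sub_distrib]
        rw [Finset.sum_comm (f := fun (i j : Fin (m + 1)) => l i * c i j ^ 2),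
          Finset.sum_comm (f := fun i j => l m * c i j ^ 2)]
    _ ≤ _ := Finset.sum_le_sum fun j _ => hlow j

/-- An eigenvector with eigenvalue below `l k` lies in the span of the first `k` eigenvectors. -/
theorem mem_span_of_lt (h : IsEigenSystem π n e l) {k : ℕ} (hk : k < n) {v : V} {g : ℝ}
    (hv : ∀ w, ⟪v, w⟫_ℝ = g * ⟪π v, π w⟫_ℝ) (hg : g < l k) (hinj : Function.Injective π) :
    v ∈ Submodule.span ℝ (Set.range fun i : Fin k => e i) := by
  -- Eigenvectors for different eigenvalues are orthogonal. Hence the projection y, and with it r,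
  -- again satisfies the eigenvector equation for g; being orthogonal to the first k eigenvectors, r
  -- would need g ≥ l k unless it vanishes.
  have hcomm : ∀ i < n, (l i - g) * ⟪π (e i), π v⟫_ℝ = 0 := by
    intro i hi
    have h1 := h.inner_eq i hi v
    have h2 := hv (e i)
    rw [real_inner_comm, h1, real_inner_comm (π (e i)) (π v)] at h2
    linarith [real_inner_comm (π (e i)) (π v)]
  set y : V := ∑ i : Fin k, ⟪π (e i), π v⟫_ℝ • e i with hy
  set r : V := v - y with hr
  have hπr : ∀ i < k, ⟪π (e i), π r⟫_ℝ = 0 := by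
    intro i hi
    rw [hr, map_sub, inner_sub_right, hy, map_sum, inner_sum]
    simp only [map_smul, inner_smul_right]
    simp_rw [fun k' : Fin k => h.orthonormal i (by omega) k' (by omega)]
    have : ∀ x : Fin k, (i = (x : ℕ)) ↔ (⟨i, hi⟩ : Fin k) = x := by
      intro x; simp [Fin.ext_iff]
    simp [this]
  have hre : ∀ w, ⟪r, w⟫_ℝ = g * ⟪π r, π w⟫_ℝ := by
    intro w
    have : ⟪y, w⟫_ℝ = g * ⟪π y, π w⟫_ℝ := by
      rw [hy, map_sum, sum_inner, sum_inner, Finset.mul_sum]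
      refine Finset.sum_congr rfl fun i _ => ?_
      rw [map_smul, inner_smul_left, inner_smul_left, h.inner_eq i (by omega)]
      have := hcomm i (by omega)
      simp only [conj_trivial]
      linear_combination ⟪π (e i), π w⟫_ℝ * this
    rw [hr, inner_sub_left, map_sub, inner_sub_left, this, hv w]
    ring
  have h1 := h.le_norm_sq k hk r hπr
  have h2 := hre r
  rw [real_inner_self_eq_norm_sq, real_inner_self_eq_norm_sq] at h2
  have h3 : ‖π r‖ ^ 2 = 0 := by
    by_contra hne
    have : 0 < ‖π r‖ ^ 2 := lt_of_le_of_ne (sq_nonneg _) (Ne.symm hne)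
    nlinarith
  have h4 : r = 0 := by
    apply hinj
    rw [map_zero]
    simpa using h3
  have h5 : v = y := by rw [hr] at h4; exact sub_eq_zero.mp h4
  rw [h5, hy]
  exact Submodule.sum_mem _ fun i _ => Submodule.smul_mem _ _ (Submodule.subset_span ⟨i, rfl⟩)

theorem linearIndependent_map (h : IsEigenSystem π n e l) :
    LinearIndependent ℝ fun i : Fin n => π (e i) := by
  apply Orthonormal.linearIndependent
  rw [orthonormal_iff_ite]
  intro i j
  rw [h.orthonormal i i.2 j j.2]
  simp [Fin.ext_iff]

/-- The dimension count of eigenvectors with eigenvalues up to `t`. -/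
theorem succ_le_rank_iff (h : IsEigenSystem π n e l) (hinj : Function.Injective π) {k : ℕ}
    (hk : k < n) (s t : ℝ) :
    ((k + 1 : ℕ) : Cardinal) ≤ Module.rank ℝ (Submodule.span ℝ {u : H | ∃ γ ≤ t, ∃ v, π v = u ∧
      ∀ w, ⟪v, w⟫_ℝ = (γ + s) * ⟪π v, π w⟫_ℝ}) ↔ l k - s ≤ t := by
  constructor
  · intro hle
    by_contra! hlt
    have hsub : Submodule.span ℝ {u : H | ∃ γ ≤ t, ∃ v, π v = u ∧
        ∀ w, ⟪v, w⟫_ℝ = (γ + s) * ⟪π v, π w⟫_ℝ} ≤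
        (Submodule.span ℝ (Set.range fun i : Fin k => e i)).map (π : V →ₗ[ℝ] H) := by
      rw [Submodule.span_le]
      rintro u ⟨γ, hγ, v, rfl, hv⟩
      exact Submodule.mem_map_of_mem (h.mem_span_of_lt hk hv (by linarith) hinj)
    have h1 : Module.rank ℝ (Submodule.span ℝ {u : H | ∃ γ ≤ t, ∃ v, π v = u ∧
        ∀ w, ⟪v, w⟫_ℝ = (γ + s) * ⟪π v, π w⟫_ℝ}) ≤ (k : Cardinal) := by
      refine (Submodule.rank_mono hsub).trans ?_
      rw [Submodule.map_span, ← Set.range_comp]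
      refine (rank_span_le _).trans ?_
      have h3 := Cardinal.mk_range_le_lift (f := (π : V →ₗ[ℝ] H) ∘ fun i : Fin k => e i)
      simpa using h3
    have h2 := hle.trans h1
    rw [Nat.cast_le] at h2
    omega
  · intro hle
    have hind : LinearIndependent ℝ fun i : Fin (k + 1) => π (e i) :=
      h.linearIndependent_map.comp (Fin.castLE (show k + 1 ≤ n by omega))
        (Fin.castLE_injective _)
    have h1 := rank_span hind
    have h2 := Cardinal.mk_range_eq_of_injective hind.injective
    simp only [Cardinal.lift_uzero, Cardinal.mk_fin, Cardinal.lift_natCast] at h2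
    rw [← h2, ← h1]
    apply Submodule.rank_mono
    apply Submodule.span_mono
    rintro _ ⟨i, rfl⟩
    refine ⟨l i - s, ?_, e i, rfl, fun w => ?_⟩
    · have := h.mono (show (i : ℕ) ≤ k by omega) hk
      linarith
    · rw [h.inner_eq i (by omega)]; ring

/-- Eigenvectors are limits of orthonormal families from a dense subspace. -/
theorem exists_orthonormal_tendsto (h : IsEigenSystem π n e l) (S : Submodule ℝ V)
    (hS : Dense (S : Set V)) (m : ℕ) (hm : m ≤ n) :
    ∃ w : ℕ → ℕ → V, (∀ k, ∀ j < m, w k j ∈ S) ∧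
      (∀ j < m, Tendsto (fun k => w k j) atTop (𝓝 (e j))) ∧
      ∀ᶠ k in atTop, ∀ i < m, ∀ j < m, ⟪π (w k i), π (w k j)⟫_ℝ = if i = j then 1 else 0 := by
  induction m with
  | zero => exact ⟨fun _ _ => 0, by simp, by simp, by simp⟩
  | succ m ih =>
    obtain ⟨w, hwS, hwt, hwo⟩ := ih (by omega)
    obtain ⟨v, hvS, hvt⟩ := mem_closure_iff_seq_limit.mp (hS (e m))
    -- One Gram–Schmidt step inside S. The subtracted coefficients tend to zero, so r k still tends
    -- to e m and can be normalized for large k; orthonormality therefore holds only eventually.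
    set r : ℕ → V := fun k => v k - ∑ i ∈ Finset.range m, ⟪π (w k i), π (v k)⟫_ℝ • w k i with hr
    have hrS : ∀ k, r k ∈ S := fun k => S.sub_mem (hvS k)
      (S.sum_mem fun i hi => S.smul_mem _ (hwS k i (Finset.mem_range.mp hi)))
    have hrt : Tendsto r atTop (𝓝 (e m)) := by
      have h1 : Tendsto r atTop
          (𝓝 (e m - ∑ i ∈ Finset.range m, ⟪π (e i), π (e m)⟫_ℝ • e i)) := by
        refine hvt.sub (tendsto_finsetSum _ fun i hi => ?_)
        have hi := Finset.mem_range.mp hi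
        have h2 := (π.continuous.tendsto _).comp (hwt i hi)
        have h3 := (π.continuous.tendsto _).comp hvt
        exact (h2.inner h3).smul (hwt i hi)
      have h2 : ∑ i ∈ Finset.range m, ⟪π (e i), π (e m)⟫_ℝ • e i = 0 := by
        refine Finset.sum_eq_zero fun i hi => ?_
        have hi := Finset.mem_range.mp hi
        rw [h.orthonormal i (by omega) m (by omega), if_neg (by omega), zero_smul]
      rwa [h2, sub_zero] at h1
    have hnorm : Tendsto (fun k => ‖π (r k)‖) atTop (𝓝 1) := by
      have h1 := ((π.continuous.tendsto _).comp hrt).norm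
      have h2 : ‖π (e m)‖ = 1 := by
        have := h.norm_map_sq (i := m) (by omega)
        nlinarith [norm_nonneg (π (e m))]
      rwa [h2] at h1
    have hpos : ∀ᶠ k in atTop, 0 < ‖π (r k)‖ := hnorm.eventually_const_lt zero_lt_one
    refine ⟨fun k => Function.update (w k) m (‖π (r k)‖⁻¹ • r k), ?_, ?_, ?_⟩
    · intro k j hj
      rcases eq_or_ne j m with rfl | hne
      · simpa using S.smul_mem _ (hrS k)
      · simpa [hne] using hwS k j (by omega)
    · intro j hj
      rcases eq_or_ne j m with rfl | hne
      · simpa using (hnorm.inv₀ one_ne_zero).smul hrt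
      · simpa [hne] using hwt j (by omega)
    · filter_upwards [hwo, hpos] with k hk hkpos
      have horth : ∀ j < m, ⟪π (w k j), π (r k)⟫_ℝ = 0 := by
        intro j hj
        simp only [hr, map_sub, map_sum, map_smul, inner_sub_right, inner_sum, inner_smul_right]
        rw [Finset.sum_congr rfl fun i hi => by
          rw [hk j hj i (Finset.mem_range.mp hi)]]
        simp [hj]
      intro i hi j hj
      rcases eq_or_ne i m with him | hne <;> rcases eq_or_ne j m with hjm | hne'
      · simp only [him, hjm, Function.update_self, map_smul, inner_smul_left, inner_smul_right,
          real_inner_self_eq_norm_sq, if_true]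
        simp
        field_simp
      · simp only [him, Function.update_self, Function.update_of_ne hne', hne'.symm, if_false, map_smul,
          inner_smul_left]
        rw [real_inner_comm, horth j (by omega), mul_zero]
      · simp only [hjm, Function.update_self, Function.update_of_ne hne, hne, if_false, map_smul,
          inner_smul_right]
        rw [horth i (by omega), mul_zero]
      · simpa [hne, hne'] using hk i (by omega) j (by omega)

/-- The sum of the first eigenvalues is approximated by traces over orthonormal families from a
dense subspace. -/
theorem le_sum_of_dense (h : IsEigenSystem π n e l) (S : Submodule ℝ V)
    (hS : Dense (S : Set V)) (C : ℝ)
    (hC : ∀ φ : Fin n → V, (∀ j, φ j ∈ S) → (Orthonormal ℝ fun j => π (φ j)) →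
      C ≤ ∑ j, ‖φ j‖ ^ 2) :
    C ≤ ∑ i : Fin n, l i := by
  obtain ⟨w, hwS, hwt, hwo⟩ := h.exists_orthonormal_tendsto S hS n le_rfl
  have hlim : Tendsto (fun k => ∑ j : Fin n, ‖w k j‖ ^ 2) atTop (𝓝 (∑ j : Fin n, ‖e j‖ ^ 2)) :=
    tendsto_finsetSum _ fun j _ => ((hwt j j.2).norm).pow 2
  have hle : C ≤ ∑ j : Fin n, ‖e j‖ ^ 2 := by
    refine ge_of_tendsto hlim ?_
    filter_upwards [hwo] with k hk
    refine hC (fun j => w k j) (fun j => hwS k j j.2) ?_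
    rw [orthonormal_iff_ite]
    intro i j
    rw [hk i i.2 j j.2]
    simp [Fin.ext_iff]
  rwa [Finset.sum_congr rfl fun (j : Fin n) _ => h.norm_sq j.2] at hle

end IsEigenSystem

end CompactEmbedding

/-! ### Sobolev norms of Schwartz functions -/

namespace SchwartzMap

open scoped SchwartzMap LineDeriv Laplacian InnerProductSpace

variable {d : ℕ}

local notation "𝔼" => EuclideanSpace ℝ (Fin d)

theorem integrable_mul (f g : 𝓢(𝔼, ℝ)) : Integrable fun x => f x * g x :=
  (f.memLp 2).integrable_mul (g.memLp 2)

theorem inner_toLp_real (f g : 𝓢(𝔼, ℝ)) :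
    ⟪f.toLp 2, g.toLp 2⟫_ℝ = ∫ x, f x * g x := by
  apply integral_congr_ae
  filter_upwards [f.coeFn_toLp 2, g.coeFn_toLp 2] with x hf hg
  rw [hf, hg, real_inner_eq_re_inner]
  simp [mul_comm]

theorem norm_toLp_sq (f : 𝓢(𝔼, ℝ)) : ‖f.toLp 2‖ ^ 2 = ∫ x, f x ^ 2 := by
  rw [← real_inner_self_eq_norm_sq, inner_toLp_real]
  simp_rw [sq]

theorem lineDerivOp_lineDerivOp_apply (f : 𝓢(𝔼, ℝ)) (v w x : 𝔼) :
    ∂_{v} (∂_{w} f) x = fderiv ℝ (fderiv ℝ f) x v w := by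
  rw [lineDerivOp_apply_eq_fderiv]
  have h1 : (⇑(∂_{w} f : 𝓢(𝔼, ℝ)) : 𝔼 → ℝ) = fun y => fderiv ℝ f y w := rfl
  have h2 : DifferentiableAt ℝ (fderiv ℝ f) x := (fderivCLM ℝ 𝔼 ℝ f).differentiableAt
  rw [h1, fderiv_clm_apply h2 (differentiableAt_const w)]
  simp

theorem lineDerivOp_comm (f : 𝓢(𝔼, ℝ)) (v w : 𝔼) : ∂_{v} (∂_{w} f) = ∂_{w} (∂_{v} f) := by
  ext x
  rw [lineDerivOp_lineDerivOp_apply, lineDerivOp_lineDerivOp_apply]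
  exact ((f.smooth 2).contDiffAt.isSymmSndFDerivAt (by simp)) v w

theorem laplacian_eq_sum_single (f : 𝓢(𝔼, ℝ)) :
    Δ f = ∑ i : Fin d, ∂_{(EuclideanSpace.basisFun (Fin d) ℝ i)}
      (∂_{(EuclideanSpace.basisFun (Fin d) ℝ i)} f) :=
  laplacian_eq_sum _ f

/-- The `L²` norms of the Hessian and of the Laplacian agree. -/
theorem sum_integral_lineDerivOp_sq (f : 𝓢(𝔼, ℝ)) :
    ∑ i : Fin d, ∑ j : Fin d, ∫ x, (∂_{(EuclideanSpace.basisFun (Fin d) ℝ i)}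
      (∂_{(EuclideanSpace.basisFun (Fin d) ℝ j)} f) x) ^ 2 = ∫ x, (Δ f x) ^ 2 := by
  set b := EuclideanSpace.basisFun (Fin d) ℝ with hb
  -- One integration by parts on each side leads to the same integral of a third derivative against
  -- a first derivative.
  have h1 : ∀ i j, ∫ x, (∂_{b i} (∂_{b j} f) x) ^ 2
      = ∫ x, (∂_{b i} (∂_{b i} f) x) * (∂_{b j} (∂_{b j} f) x) := by
    intro i j
    have e1 := integral_mul_lineDerivOp_right_eq_neg_left (μ := volume)
      (∂_{b i} (∂_{b j} f)) (∂_{b j} f) (b i)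
    have e2 := integral_mul_lineDerivOp_right_eq_neg_left (μ := volume)
      (∂_{b i} (∂_{b i} f)) (∂_{b j} f) (b j)
    rw [lineDerivOp_comm (∂_{b i} f) (b j) (b i), lineDerivOp_comm f (b j) (b i)] at e2
    simp_rw [sq]
    rw [e1, e2]
  simp_rw [h1]
  rw [laplacian_eq_sum_single]
  simp only [sum_apply, sq, Finset.sum_mul_sum]
  rw [integral_finsetSum _ fun i _ => integrable_finsetSum _ fun j _ => integrable_mul _ _]
  refine Finset.sum_congr rfl fun i _ => ?_
  rw [integral_finsetSum _ fun j _ => integrable_mul _ _]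

theorem sum_integral_lineDerivOp_sq_one (f : 𝓢(𝔼, ℝ)) :
    ∑ i : Fin d, ∫ x, (∂_{(EuclideanSpace.basisFun (Fin d) ℝ i)} f x) ^ 2
      = - ∫ x, f x * Δ f x := by
  set b := EuclideanSpace.basisFun (Fin d) ℝ with hb
  rw [laplacian_eq_sum_single]
  simp only [sum_apply, Finset.mul_sum]
  rw [integral_finsetSum _ fun j _ => integrable_mul _ _, ← Finset.sum_neg_distrib]
  refine Finset.sum_congr rfl fun i _ => ?_
  rw [integral_mul_lineDerivOp_right_eq_neg_left, neg_neg, hb]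
  simp_rw [sq]

theorem norm_sq_le_sum_basisFun {F : Type*} [NormedAddCommGroup F] [NormedSpace ℝ F]
    (L : 𝔼 →L[ℝ] F) : ‖L‖ ^ 2 ≤ d * ∑ i, ‖L (EuclideanSpace.basisFun (Fin d) ℝ i)‖ ^ 2 := by
  set b := EuclideanSpace.basisFun (Fin d) ℝ with hb
  have h1 : ‖L‖ ≤ ∑ i, ‖L (b i)‖ := by
    refine L.opNorm_le_bound (by positivity) fun x => ?_
    conv_lhs => rw [← b.sum_repr x, map_sum]
    refine (norm_sum_le _ _).trans ?_
    rw [Finset.sum_mul]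
    refine Finset.sum_le_sum fun i _ => ?_
    rw [map_smul, norm_smul, mul_comm]
    gcongr
    simpa [hb] using PiLp.norm_apply_le x i
  calc ‖L‖ ^ 2 ≤ (∑ i, ‖L (b i)‖) ^ 2 := by gcongr
    _ ≤ _ := by
      have := sq_sum_le_card_mul_sum_sq (s := Finset.univ) (f := fun i => ‖L (b i)‖)
      simpa using this

theorem integrable_norm_iteratedFDeriv_sq (f : 𝓢(𝔼, ℝ)) :
    (Integrable fun x => ‖iteratedFDeriv ℝ 0 f x‖ ^ 2) ∧
    (Integrable fun x => ‖iteratedFDeriv ℝ 1 f x‖ ^ 2) ∧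
    (Integrable fun x => ‖iteratedFDeriv ℝ 2 f x‖ ^ 2) := by
  refine ⟨?_, ?_, ?_⟩
  · simpa using (f.memLp 2).integrable_norm_pow (p := 2) (by simp)
  · have := ((fderivCLM ℝ 𝔼 ℝ f).memLp 2 (volume)).integrable_norm_pow (p := 2) (by simp)
    simpa [norm_iteratedFDeriv_one] using this
  · have := ((fderivCLM ℝ 𝔼 _ (fderivCLM ℝ 𝔼 ℝ f)).memLp 2 (volume)).integrable_norm_pow
      (p := 2) (by simp)
    have h2 : ∀ x, ‖iteratedFDeriv ℝ 2 f x‖ = ‖fderiv ℝ (fderiv ℝ f) x‖ := by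
      intro x
      rw [← norm_iteratedFDeriv_fderiv, norm_iteratedFDeriv_one]
    simp_rw [h2]
    exact this

theorem sobolevNormSq_eq (f : 𝓢(𝔼, ℝ)) : sobolevNormSq f =
    (∫ x, f x ^ 2) + (∫ x, ‖fderiv ℝ f x‖ ^ 2) + ∫ x, ‖fderiv ℝ (fderiv ℝ f) x‖ ^ 2 := by
  have h2 : ∀ x, ‖iteratedFDeriv ℝ 2 f x‖ = ‖fderiv ℝ (fderiv ℝ f) x‖ := by
    intro x
    rw [← norm_iteratedFDeriv_fderiv, norm_iteratedFDeriv_one]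
  simp [sobolevNormSq, Finset.sum_range_succ, h2, norm_iteratedFDeriv_one]

/-- On the whole space the Hessian has the same L² norm as the Laplacian, and the gradient is
controlled by -∫ f Δf. The full H² norm is thus equivalent to the graph norm of the Laplacian, which
is what the form sees. -/
theorem sobolevNormSq_le (f : 𝓢(𝔼, ℝ)) :
    sobolevNormSq f ≤ (1 + d + d ^ 2) * ((∫ x, f x ^ 2) + ∫ x, (Δ f x) ^ 2) := by
  set b := EuclideanSpace.basisFun (Fin d) ℝ with hb
  rw [sobolevNormSq_eq]
  have hD : ∫ x, ‖fderiv ℝ f x‖ ^ 2 ≤ d * ((∫ x, f x ^ 2) + ∫ x, (Δ f x) ^ 2) := by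
    calc ∫ x, ‖fderiv ℝ f x‖ ^ 2 ≤ ∫ x, d * ∑ i, (∂_{b i} f x) ^ 2 := by
          refine integral_mono ?_ ?_ fun x => ?_
          · simpa [norm_iteratedFDeriv_one] using f.integrable_norm_iteratedFDeriv_sq.2.1
          · simp_rw [sq]
            exact (integrable_finsetSum _ fun j _ => integrable_mul _ _).const_mul _
          · simpa [lineDerivOp_apply_eq_fderiv, hb] using norm_sq_le_sum_basisFun (fderiv ℝ f x)
      _ = d * ∑ i, ∫ x, (∂_{b i} f x) ^ 2 := by
          rw [integral_const_mul, integral_finsetSum]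
          intro i _
          simp_rw [sq]
          exact integrable_mul _ _
      _ = d * (- ∫ x, f x * Δ f x) := by rw [sum_integral_lineDerivOp_sq_one]
      _ ≤ _ := by
          gcongr
          rw [← integral_neg, ← integral_add]
          · refine integral_mono (integrable_mul _ _).neg ?_ fun x => ?_
            · simp_rw [sq]
              exact (integrable_mul _ _).add (integrable_mul _ _)
            · simp only
              nlinarith [sq_nonneg (f x + Δ f x), sq_nonneg (f x), sq_nonneg (Δ f x)]
          · simp_rw [sq]; exact integrable_mul _ _
          · simp_rw [sq]; exact integrable_mul _ _
  have hD2 : ∫ x, ‖fderiv ℝ (fderiv ℝ f) x‖ ^ 2 ≤ d ^ 2 * ∫ x, (Δ f x) ^ 2 := by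
    calc ∫ x, ‖fderiv ℝ (fderiv ℝ f) x‖ ^ 2
        ≤ ∫ x, d ^ 2 * ∑ i, ∑ j, (∂_{b i} (∂_{b j} f) x) ^ 2 := by
          refine integral_mono ?_ ?_ fun x => ?_
          · have := f.integrable_norm_iteratedFDeriv_sq.2.2
            refine this.congr (ae_of_all _ fun x => ?_)
            simp only
            rw [← norm_iteratedFDeriv_fderiv, norm_iteratedFDeriv_one]
          · simp_rw [sq]
            exact (integrable_finsetSum _ fun i _ =>
              integrable_finsetSum _ fun j _ => integrable_mul _ _).const_mul _
          · simp only
            refine (norm_sq_le_sum_basisFun _).trans ?_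
            rw [sq (d : ℝ), mul_assoc]
            gcongr
            rw [Finset.mul_sum]
            refine Finset.sum_le_sum fun i _ => ?_
            refine (norm_sq_le_sum_basisFun _).trans (le_of_eq ?_)
            congr 1
            refine Finset.sum_congr rfl fun j _ => ?_
            rw [lineDerivOp_lineDerivOp_apply, Real.norm_eq_abs, sq_abs]
      _ = d ^ 2 * ∑ i, ∑ j, ∫ x, (∂_{b i} (∂_{b j} f) x) ^ 2 := by
          rw [integral_const_mul, integral_finsetSum]
          · congr 1
            refine Finset.sum_congr rfl fun i _ => ?_
            rw [integral_finsetSum]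
            intro j _
            simp_rw [sq]
            exact integrable_mul _ _
          · intro i _
            simp_rw [sq]
            exact integrable_finsetSum _ fun j _ => integrable_mul _ _
      _ = _ := by rw [sum_integral_lineDerivOp_sq]
  have h0 : 0 ≤ ∫ x, f x ^ 2 := integral_nonneg fun x => sq_nonneg _
  have h1 : 0 ≤ ∫ x, (Δ f x) ^ 2 := integral_nonneg fun x => sq_nonneg _
  have hd : (0 : ℝ) ≤ d ^ 2 := by positivity
  nlinarith

theorem integral_sq_le_sobolevNormSq (f : 𝓢(𝔼, ℝ)) : ∫ x, f x ^ 2 ≤ sobolevNormSq f := by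
  rw [sobolevNormSq_eq]
  have h0 : 0 ≤ ∫ x, ‖fderiv ℝ f x‖ ^ 2 := integral_nonneg fun x => sq_nonneg _
  have h1 : 0 ≤ ∫ x, ‖fderiv ℝ (fderiv ℝ f) x‖ ^ 2 := integral_nonneg fun x => sq_nonneg _
  linarith

theorem integral_laplacian_sq_le_sobolevNormSq (f : 𝓢(𝔼, ℝ)) :
    ∫ x, (Δ f x) ^ 2 ≤ d ^ 2 * sobolevNormSq f := by
  set b := EuclideanSpace.basisFun (Fin d) ℝ with hb
  have h1 : ∫ x, (Δ f x) ^ 2 ≤ ∫ x, d ^ 2 * ‖fderiv ℝ (fderiv ℝ f) x‖ ^ 2 := by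
    refine integral_mono ?_ ?_ fun x => ?_
    · simp_rw [sq]; exact integrable_mul _ _
    · refine Integrable.const_mul ?_ _
      refine f.integrable_norm_iteratedFDeriv_sq.2.2.congr (ae_of_all _ fun x => ?_)
      simp only
      rw [← norm_iteratedFDeriv_fderiv, norm_iteratedFDeriv_one]
    · simp only
      rw [← sq_abs, ← mul_pow]
      gcongr
      rw [laplacian_eq_sum_single, sum_apply]
      refine (Finset.abs_sum_le_sum_abs _ _).trans ?_
      calc _ ≤ ∑ i : Fin d, ‖fderiv ℝ (fderiv ℝ f) x‖ := by
            refine Finset.sum_le_sum fun i _ => ?_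
            rw [lineDerivOp_lineDerivOp_apply, ← Real.norm_eq_abs]
            refine (ContinuousLinearMap.le_opNorm₂ _ _ _).trans ?_
            simp
        _ = _ := by simp
  refine h1.trans ?_
  rw [integral_const_mul, sobolevNormSq_eq]
  have h0 : 0 ≤ ∫ x, ‖fderiv ℝ f x‖ ^ 2 := integral_nonneg fun x => sq_nonneg _
  have h1 : 0 ≤ ∫ x, f x ^ 2 := integral_nonneg fun x => sq_nonneg _
  gcongr
  linarith

end SchwartzMap

/-! ### The energy density on the Fourier side -/

namespace SchwartzMap

open scoped SchwartzMap LineDeriv Laplacian InnerProductSpace FourierTransform Real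

variable {d : ℕ}

local notation "𝔼" => EuclideanSpace ℝ (Fin d)

/-- The Fourier transform of a real valued Schwartz function. -/
noncomputable def spectralTransform (f : 𝓢(𝔼, ℝ)) : 𝓢(𝔼, ℂ) :=
  𝓕 (f.postcompCLM Complex.ofRealCLM)

theorem spectralTransform_apply (f : 𝓢(𝔼, ℝ)) (ξ : 𝔼) :
    spectralTransform f ξ = ∫ x, Complex.exp ((↑(-2 * π * ⟪x, ξ⟫_ℝ) * Complex.I)) * (f x : ℂ) := by
  rw [spectralTransform, fourier_coe, Real.fourier_eq']
  rfl

theorem spectralTransform_sub (f g : 𝓢(𝔼, ℝ)) :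
    spectralTransform (f - g) = spectralTransform f - spectralTransform g := by
  simp only [spectralTransform, map_sub]
  exact map_sub (FourierTransform.fourierCLM ℂ 𝓢(𝔼, ℂ)) _ _

theorem postcompCLM_laplacian (f : 𝓢(𝔼, ℝ)) :
    (Δ f).postcompCLM Complex.ofRealCLM = Δ (f.postcompCLM Complex.ofRealCLM) := by
  ext x
  rw [postcompCLM_apply, laplacian_apply, laplacian_apply]
  exact ((f.smooth 2).contDiffAt.laplacian_CLM_comp_left (l := Complex.ofRealCLM)).symm

theorem fourier_laplacian_apply (f : 𝓢(𝔼, ℂ)) (ξ : 𝔼) :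
    𝓕 (Δ f) ξ = -((2 * π) ^ 2 * ‖ξ‖ ^ 2 : ℝ) * 𝓕 f ξ := by
  have h : 𝓕 (Δ f) = -(2 * π) ^ 2 • smulLeftCLM ℂ (fun x : 𝔼 => ‖x‖ ^ 2) (𝓕 f) := by
    rw [laplacian_eq_fourierMultiplierCLM, fourierMultiplierCLM_apply]
    have h1 := FourierTransform.fourier_smul (-(2 * π) ^ 2 : ℝ)
      (𝓕⁻ (smulLeftCLM ℂ (fun x : 𝔼 => ‖x‖ ^ 2) (𝓕 f)))
    rw [FourierTransform.fourier_fourierInv_eq] at h1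
    exact h1
  rw [h, smul_apply, smulLeftCLM_apply_apply (by fun_prop)]
  simp
  ring

theorem spectralTransform_laplacian (f : 𝓢(𝔼, ℝ)) (ξ : 𝔼) :
    spectralTransform (Δ f) ξ = -((2 * π) ^ 2 * ‖ξ‖ ^ 2 : ℝ) * spectralTransform f ξ := by
  rw [spectralTransform, postcompCLM_laplacian, fourier_laplacian_apply]
  rfl

theorem integral_mul_eq_re_spectralTransform (f g : 𝓢(𝔼, ℝ)) :
    ((∫ x, f x * g x : ℝ) : ℂ)
      = ∫ ξ, inner ℂ (spectralTransform f ξ) (spectralTransform g ξ) := by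
  rw [spectralTransform, spectralTransform, integral_inner_fourier_fourier, ← integral_complex_ofReal]
  refine integral_congr_ae (ae_of_all _ fun x => ?_)
  simp [postcompCLM_apply, mul_comm]

theorem integral_sq_eq_spectral (f : 𝓢(𝔼, ℝ)) :
    ∫ x, f x ^ 2 = ∫ ξ, ‖spectralTransform f ξ‖ ^ 2 := by
  rw [spectralTransform, integral_norm_sq_fourier]
  simp [postcompCLM_apply]

theorem integral_laplacian_sq_eq_spectral (f : 𝓢(𝔼, ℝ)) :
    ∫ x, (Δ f x) ^ 2 = ∫ ξ, ‖(2 * π) • ξ‖ ^ 4 * ‖spectralTransform f ξ‖ ^ 2 := by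
  rw [integral_sq_eq_spectral]
  refine integral_congr_ae (ae_of_all _ fun ξ => ?_)
  simp only
  rw [spectralTransform_laplacian, norm_mul, norm_neg, Complex.norm_real, norm_smul,
    Real.norm_of_nonneg (by positivity), Real.norm_of_nonneg (by positivity)]
  ring

theorem integral_mul_laplacian_eq_spectral (f : 𝓢(𝔼, ℝ)) :
    - ∫ x, f x * Δ f x = ∫ ξ, ‖(2 * π) • ξ‖ ^ 2 * ‖spectralTransform f ξ‖ ^ 2 := by
  have h : ((- ∫ x, f x * Δ f x : ℝ) : ℂ) =
      ((∫ ξ, ‖(2 * π) • ξ‖ ^ 2 * ‖spectralTransform f ξ‖ ^ 2 : ℝ) : ℂ) := by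
    rw [Complex.ofReal_neg, integral_mul_eq_re_spectralTransform, ← integral_complex_ofReal,
      ← integral_neg]
    refine integral_congr_ae (ae_of_all _ fun ξ => ?_)
    simp only
    rw [spectralTransform_laplacian, norm_smul, Real.norm_of_nonneg (by positivity)]
    rw [← Complex.ofReal_neg, ← Complex.real_smul, inner_smul_right_eq_smul,
      inner_self_eq_norm_sq_to_K]
    simp only [Complex.real_smul, Complex.coe_algebraMap]
    push_cast
    ring
  exact_mod_cast h

theorem integrable_norm_pow_mul_spectral (f : 𝓢(𝔼, ℝ)) (k : ℕ) :
    Integrable fun ξ : 𝔼 => ‖ξ‖ ^ k * ‖spectralTransform f ξ‖ ^ 2 := by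
  obtain ⟨C, hC, hb⟩ := (spectralTransform f).decay 0 0
  have h1 := (spectralTransform f).integrable_pow_mul (volume : Measure 𝔼) k
  refine (h1.mul_const C).mono' (by fun_prop) (ae_of_all _ fun ξ => ?_)
  rw [Real.norm_of_nonneg (by positivity), sq, ← mul_assoc]
  gcongr
  simpa using hb ξ

theorem _root_.integral_comp_linearMap_of_det_ne_zero {F : Type*} [NormedAddCommGroup F]
    [NormedSpace ℝ F] {L : 𝔼 →ₗ[ℝ] 𝔼} (hL : LinearMap.det L ≠ 0) (g : 𝔼 → F) :
    ∫ x, g (L x) = |LinearMap.det L|⁻¹ • ∫ x, g x := by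
  have hemb : MeasurableEmbedding L :=
    (L.equivOfDetNeZero hL).toContinuousLinearEquiv.toHomeomorph.measurableEmbedding
  rw [← hemb.integral_map, Measure.map_linearMap_addHaar_eq_smul_addHaar _ hL,
    integral_smul_measure, ENNReal.toReal_ofReal (abs_nonneg _), abs_inv]

theorem _root_.LinearMap.det_adjoint_real (L : 𝔼 →ₗ[ℝ] 𝔼) :
    LinearMap.det L.adjoint = LinearMap.det L := by
  have h := LinearMap.toMatrix_adjoint (EuclideanSpace.basisFun (Fin d) ℝ)
    (EuclideanSpace.basisFun (Fin d) ℝ) L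
  rw [← LinearMap.det_toMatrix (EuclideanSpace.basisFun (Fin d) ℝ).toBasis L.adjoint, h,
    Matrix.det_conjTranspose, LinearMap.det_toMatrix]
  simp

/-- Substitute y = A x in the Fourier integral; the adjoint moves A across the inner product in the
exponent. -/
theorem spectralTransform_comp (A : 𝔼 ≃L[ℝ] 𝔼) (f : 𝓢(𝔼, ℝ)) (η : 𝔼) :
    spectralTransform (compCLMOfContinuousLinearEquiv ℝ A f)
      ((A.toLinearEquiv : 𝔼 →ₗ[ℝ] 𝔼).adjoint η) =
      |LinearMap.det (A.toLinearEquiv : 𝔼 →ₗ[ℝ] 𝔼)|⁻¹ • spectralTransform f η := by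
  rw [spectralTransform_apply, spectralTransform_apply,
    ← integral_comp_linearMap_of_det_ne_zero (LinearEquiv.isUnit_det' _).ne_zero]
  refine integral_congr_ae (ae_of_all _ fun x => ?_)
  simp only
  rw [LinearMap.adjoint_inner_right]
  rfl

/-- The change of the Fourier energy under composition with a linear map. -/
theorem integral_mul_spectralTransform_comp (A : 𝔼 ≃L[ℝ] 𝔼) (f : 𝓢(𝔼, ℝ)) (m : 𝔼 → ℝ) :
    ∫ ξ, m ξ * ‖spectralTransform (compCLMOfContinuousLinearEquiv ℝ A f) ξ‖ ^ 2 =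
      |LinearMap.det (A.toLinearEquiv : 𝔼 →ₗ[ℝ] 𝔼)|⁻¹ *
      ∫ η, m ((A.toLinearEquiv : 𝔼 →ₗ[ℝ] 𝔼).adjoint η) * ‖spectralTransform f η‖ ^ 2 := by
  have hdet : LinearMap.det (A.toLinearEquiv : 𝔼 →ₗ[ℝ] 𝔼) ≠ 0 :=
    (LinearEquiv.isUnit_det' _).ne_zero
  -- With ξ = A*η the squared transform contributes |det A|⁻² and the substitution |det A|, which
  -- leaves |det A|⁻¹.
  have h := integral_comp_linearMap_of_det_ne_zero
    (L := (A.toLinearEquiv : 𝔼 →ₗ[ℝ] 𝔼).adjoint) (by rwa [LinearMap.det_adjoint_real])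
    (fun ξ => m ξ * ‖spectralTransform (compCLMOfContinuousLinearEquiv ℝ A f) ξ‖ ^ 2)
  rw [LinearMap.det_adjoint_real] at h
  simp only [spectralTransform_comp, norm_smul, mul_pow, norm_inv, Real.norm_eq_abs,
    abs_abs] at h
  have hpos : 0 < |LinearMap.det (A.toLinearEquiv : 𝔼 →ₗ[ℝ] 𝔼)| := abs_pos.mpr hdet
  set D := |LinearMap.det (A.toLinearEquiv : 𝔼 →ₗ[ℝ] 𝔼)| with hD
  have h2 : ∀ η, m ((A.toLinearEquiv : 𝔼 →ₗ[ℝ] 𝔼).adjoint η) *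
      (D⁻¹ ^ 2 * ‖spectralTransform f η‖ ^ 2) =
      D⁻¹ ^ 2 * (m ((A.toLinearEquiv : 𝔼 →ₗ[ℝ] 𝔼).adjoint η) *
        ‖spectralTransform f η‖ ^ 2) := fun η => by ring
  simp_rw [h2, integral_const_mul, smul_eq_mul] at h
  field_simp at h ⊢
  linarith

/-- The Fourier transform is Lipschitz on functions supported in a fixed ball. -/
theorem integral_norm_le_of_support (f : 𝓢(𝔼, ℝ)) {R : ℝ} (hf : tsupport f ⊆ Metric.closedBall 0 R) :
    ∫ x, |f x| ≤ √(volume.real (Metric.closedBall (0 : 𝔼) R)) * √(∫ x, f x ^ 2) := by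
  set B := Metric.closedBall (0 : 𝔼) R with hB
  have h0 : ∀ x, |f x| = B.indicator (fun _ => (1 : ℝ)) x * |f x| := by
    intro x
    by_cases hx : x ∈ B
    · simp [hx]
    · have : f x = 0 := image_eq_zero_of_notMem_tsupport fun h => hx (hf h)
      simp [this]
  have h1 := integral_mul_le_Lp_mul_Lq_of_nonneg (μ := (volume : Measure 𝔼))
    (Real.HolderConjugate.two_two) (f := B.indicator fun _ => (1 : ℝ)) (g := fun x => |f x|)
    (ae_of_all _ fun x => Set.indicator_nonneg (fun _ _ => zero_le_one) x)
    (ae_of_all _ fun x => abs_nonneg _)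
    (by
      refine memLp_indicator_const _ measurableSet_closedBall _ (Or.inr ?_)
      exact measure_closedBall_lt_top.ne)
    (by rw [show ENNReal.ofReal 2 = 2 by simp]; exact (f.memLp 2).abs)
  rw [integral_congr_ae (ae_of_all _ h0)]
  refine h1.trans (le_of_eq ?_)
  have h2 : ∀ x, (B.indicator (fun _ => (1 : ℝ)) x) ^ (2 : ℝ) = B.indicator (fun _ => (1 : ℝ)) x := by
    intro x
    by_cases hx : x ∈ B <;> simp [hx]
  simp_rw [h2]
  rw [integral_indicator_const _ measurableSet_closedBall, Real.sqrt_eq_rpow, Real.sqrt_eq_rpow]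
  simp [hB]

/-- On the support |x| ≤ R, so the phase changes by at most 2πR|ξ - η|. This equicontinuity replaces
infinitely many low frequencies by a finite net. -/
theorem norm_spectralTransform_sub_le (f : 𝓢(𝔼, ℝ)) {R : ℝ}
    (hf : tsupport f ⊆ Metric.closedBall 0 R) (ξ η : 𝔼) :
    ‖spectralTransform f ξ - spectralTransform f η‖ ≤ 2 * π * R * ‖ξ - η‖ * ∫ x, |f x| := by
  have hint : ∀ ζ : 𝔼, Integrable fun x : 𝔼 =>
      Complex.exp ((↑(-2 * π * ⟪x, ζ⟫_ℝ) * Complex.I)) * (f x : ℂ) := by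
    intro ζ
    refine (f.integrable (μ := volume)).norm.mono' (by fun_prop) (ae_of_all _ fun x => ?_)
    rw [norm_mul, Complex.norm_exp_ofReal_mul_I]
    simp
  rw [spectralTransform_apply, spectralTransform_apply, ← integral_sub (hint ξ) (hint η),
    ← integral_const_mul]
  refine norm_integral_le_of_norm_le (f.integrable.abs.const_mul _) (ae_of_all _ fun x => ?_)
  rw [← sub_mul, norm_mul, Complex.norm_real, Real.norm_eq_abs]
  by_cases hx : x ∈ tsupport f
  · gcongr
    have h1 : Complex.exp ((↑(-2 * π * ⟪x, ξ⟫_ℝ) * Complex.I)) -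
        Complex.exp ((↑(-2 * π * ⟪x, η⟫_ℝ) * Complex.I)) =
        Complex.exp ((↑(-2 * π * ⟪x, η⟫_ℝ) * Complex.I)) *
          (Complex.exp (Complex.I * ↑(-2 * π * ⟪x, ξ - η⟫_ℝ)) - 1) := by
      rw [mul_sub, ← Complex.exp_add, inner_sub_right]
      push_cast
      ring_nf
    rw [h1, norm_mul, Complex.norm_exp_ofReal_mul_I, one_mul]
    refine Real.norm_exp_I_mul_ofReal_sub_one_le.trans ?_
    have h2 : ‖x‖ ≤ R := by simpa using hf hx
    rw [norm_mul, Real.norm_eq_abs, Real.norm_eq_abs]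
    have h3 := abs_real_inner_le_norm x (ξ - η)
    have h4 : |-2 * π| = 2 * π := by
      rw [abs_of_neg (by linarith [Real.pi_pos])]; ring
    rw [h4, mul_assoc (2 * π)]
    gcongr
    exact h3.trans (by gcongr)
  · have : f x = 0 := image_eq_zero_of_notMem_tsupport hx
    simp [this]

end SchwartzMap

/-! ### Compactness of the embedding of the form domain -/

namespace SchwartzMap

open scoped SchwartzMap LineDeriv Laplacian InnerProductSpace FourierTransform Real

variable {d : ℕ}

local notation "𝔼" => EuclideanSpace ℝ (Fin d)

/-- Up to a small multiple of the energy, the `L²` norm is controlled by finitely many values of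
the Fourier transform. -/
theorem exists_finset_integral_sq_le {R : ℝ} (hR : 0 ≤ R) {ε : ℝ} (hε : 0 < ε) :
    ∃ (t : Finset 𝔼) (C : ℝ), 0 ≤ C ∧ ∀ f : 𝓢(𝔼, ℝ), tsupport f ⊆ Metric.closedBall 0 R →
      ∫ x, f x ^ 2 ≤ ε * ((∫ x, f x ^ 2) + ∫ x, (Δ f x) ^ 2) +
        C * ∑ ξ ∈ t, ‖spectralTransform f ξ‖ ^ 2 := by
  -- Frequency cutoff: ε ρ⁴ ≥ 1, so frequencies beyond ρ are absorbed by ε times the Laplacian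
  -- energy.
  set ρ : ℝ := max 1 (1 / ε) with hρ
  have hρ1 : 1 ≤ ρ := le_max_left _ _
  have hρε : 1 ≤ ε * ρ ^ 4 := by
    have h1 : 1 / ε ≤ ρ := le_max_right _ _
    have h2 : 1 ≤ ε * ρ := by rw [div_le_iff₀ hε] at h1; linarith
    have h3 : ρ ≤ ρ ^ 4 := le_self_pow₀ hρ1 (by norm_num)
    nlinarith
  set B := Metric.closedBall (0 : 𝔼) ρ with hB
  set M := volume.real B with hM
  set K := 2 * π * R * √(volume.real (Metric.closedBall (0 : 𝔼) R)) with hK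
  have hK0 : 0 ≤ K := by positivity
  have hM0 : 0 ≤ M := by positivity
  -- Mesh of the net of low frequencies: replacing ξ by its nearest net point then costs at most ε ∫
  -- f² after integration over the ball.
  obtain ⟨δ, hδ, hδε⟩ : ∃ δ : ℝ, 0 < δ ∧ 2 * (K * δ) ^ 2 * M ≤ ε := by
    refine ⟨min 1 (ε / (2 * K ^ 2 * M + 1)), by positivity, ?_⟩
    set δ := min 1 (ε / (2 * K ^ 2 * M + 1)) with hδ
    have h0 : 0 < δ := by positivity
    have h1 : δ ≤ 1 := min_le_left _ _
    have h2 : δ ≤ ε / (2 * K ^ 2 * M + 1) := min_le_right _ _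
    rw [le_div_iff₀ (by positivity)] at h2
    have h3 : δ ^ 2 ≤ δ := by nlinarith
    have h4 : 0 ≤ 2 * K ^ 2 * M := by positivity
    nlinarith
  obtain ⟨t, -, htfin, htc⟩ := (isCompact_closedBall (0 : 𝔼) ρ).finite_cover_balls hδ
  refine ⟨htfin.toFinset, 2 * M, by positivity, fun f hf => ?_⟩
  set N := ∫ x, f x ^ 2 with hN
  have hN0 : 0 ≤ N := integral_nonneg fun x => sq_nonneg _
  set g := spectralTransform f with hg
  set S₀ := ∑ ξ ∈ htfin.toFinset, ‖g ξ‖ ^ 2 with hS₀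
  have hlip : ∀ ξ η, ‖g ξ - g η‖ ≤ K * ‖ξ - η‖ * √N := by
    intro ξ η
    refine (norm_spectralTransform_sub_le f hf ξ η).trans ?_
    have h1 := integral_norm_le_of_support f hf
    calc _ ≤ 2 * π * R * ‖ξ - η‖ * (√(volume.real (Metric.closedBall (0 : 𝔼) R)) * √N) := by
          gcongr
      _ = _ := by rw [hK]; ring
  have hpt : ∀ ξ, ‖g ξ‖ ^ 2 ≤ B.indicator (fun _ => 2 * S₀ + 2 * (K * δ) ^ 2 * N) ξ +
      ε * (‖(2 * π) • ξ‖ ^ 4 * ‖g ξ‖ ^ 2) := by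
    intro ξ
    by_cases hξ : ξ ∈ B
    · rw [Set.indicator_of_mem hξ]
      obtain ⟨η, hη, hd⟩ := Set.mem_iUnion₂.mp (htc hξ)
      rw [mem_ball_iff_norm] at hd
      have h1 : ‖g ξ‖ ≤ ‖g η‖ + K * δ * √N := by
        have h2 : ‖g ξ‖ ≤ ‖g η‖ + ‖g ξ - g η‖ := by
          have := norm_add_le (g η) (g ξ - g η)
          simpa using this
        have h3 : K * ‖ξ - η‖ * √N ≤ K * δ * √N := by gcongr
        linarith [hlip ξ η]
      have h2 : ‖g η‖ ^ 2 ≤ S₀ :=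
        Finset.single_le_sum (f := fun ξ => ‖g ξ‖ ^ 2) (fun _ _ => sq_nonneg _)
          (htfin.mem_toFinset.mpr hη)
      have h3 : ‖g ξ‖ ^ 2 ≤ (‖g η‖ + K * δ * √N) ^ 2 := by gcongr
      have h4 : (‖g η‖ + K * δ * √N) ^ 2 ≤ 2 * ‖g η‖ ^ 2 + 2 * (K * δ * √N) ^ 2 := by
        nlinarith [sq_nonneg (‖g η‖ - K * δ * √N)]
      have h5 : (K * δ * √N) ^ 2 = (K * δ) ^ 2 * N := by
        rw [mul_pow, Real.sq_sqrt hN0]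
      have h6 : 0 ≤ ε * (‖(2 * π) • ξ‖ ^ 4 * ‖g ξ‖ ^ 2) := by positivity
      linarith
    · rw [Set.indicator_of_notMem hξ, zero_add, ← mul_assoc]
      have h1 : ρ ≤ ‖(2 * π) • ξ‖ := by
        have h2 : ρ < ‖ξ‖ := by simpa [hB] using hξ
        rw [norm_smul, Real.norm_of_nonneg (by positivity)]
        nlinarith [Real.pi_gt_three, norm_nonneg ξ]
      have h2 : 1 ≤ ε * ‖(2 * π) • ξ‖ ^ 4 := hρε.trans (by gcongr)
      exact le_mul_of_one_le_left (sq_nonneg _) h2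
  have hint4 : Integrable fun ξ => ‖(2 * π) • ξ‖ ^ 4 * ‖g ξ‖ ^ 2 := by
    have := (integrable_norm_pow_mul_spectral f 4).const_mul ((2 * π) ^ 4)
    refine this.congr (ae_of_all _ fun ξ => ?_)
    simp only
    rw [norm_smul, Real.norm_of_nonneg (by positivity)]
    ring
  have hint0 : Integrable fun ξ => ‖g ξ‖ ^ 2 := by
    simpa using integrable_norm_pow_mul_spectral f 0
  have hintB : Integrable (B.indicator fun _ : 𝔼 => 2 * S₀ + 2 * (K * δ) ^ 2 * N) :=
    (integrable_indicator_iff measurableSet_closedBall).mpr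
      (integrableOn_const measure_closedBall_lt_top.ne)
  have h1 := integral_mono hint0 (hintB.add (hint4.const_mul ε)) hpt
  simp only [Pi.add_apply] at h1
  rw [integral_add hintB (hint4.const_mul ε), integral_const_mul,
    integral_indicator_const _ measurableSet_closedBall, ← integral_laplacian_sq_eq_spectral,
    ← integral_sq_eq_spectral] at h1
  simp only [smul_eq_mul] at h1
  have h2 : 2 * (K * δ) ^ 2 * M * N ≤ ε * N := by gcongr
  nlinarith

end SchwartzMap

/-- A family is totally bounded as soon as its distances are controlled, up to small errors, by
bounded finite-dimensional data. -/
theorem totallyBounded_range_of_finite_data {ι H : Type*} [PseudoMetricSpace H] (a : ι → H)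
    (h : ∀ ε > 0, ∃ (X : Type) (_ : PseudoMetricSpace X) (_ : ProperSpace X) (Λ : ι → X) (δ : ℝ),
      0 < δ ∧ Bornology.IsBounded (Set.range Λ) ∧
      ∀ f g, dist (Λ f) (Λ g) < δ → dist (a f) (a g) < ε) :
    TotallyBounded (Set.range a) := by
  rw [Metric.totallyBounded_iff]
  intro ε hε
  obtain ⟨X, _, _, Λ, δ, hδ, hb, hΛ⟩ := h ε hε
  obtain ⟨t, htΛ, htfin, htc⟩ :=
    Metric.finite_approx_of_totallyBounded (hb.isCompact_closure.totallyBounded.subset subset_closure) δ hδ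
  have hex : ∀ y : t, ∃ f, Λ f = y := fun y => htΛ y.2
  choose s hs using hex
  have := htfin.to_subtype
  refine ⟨Set.range fun y => a (s y), Set.finite_range _, ?_⟩
  rintro _ ⟨f, rfl⟩
  obtain ⟨y, hy, hd⟩ := Set.mem_iUnion₂.mp (htc ⟨f, rfl⟩)
  refine Set.mem_iUnion₂.mpr ⟨a (s ⟨y, hy⟩), ⟨⟨y, hy⟩, rfl⟩, ?_⟩
  apply hΛ
  rw [hs ⟨y, hy⟩]
  exact hd

/-! ### The form domain -/

section PlateSpace

open scoped SchwartzMap Laplacian InnerProductSpace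

variable {d : ℕ}

local notation "𝔼" => EuclideanSpace ℝ (Fin d)

/-- The test functions as a space of Schwartz functions. -/
def testSchwartz (Ω : Set (EuclideanSpace ℝ (Fin d))) :
    Submodule ℝ 𝓢(EuclideanSpace ℝ (Fin d), ℝ) where
  carrier := {f | HasCompactSupport f ∧ tsupport f ⊆ Ω}
  zero_mem' := by
    have : (⇑(0 : 𝓢(𝔼, ℝ)) : 𝔼 → ℝ) = 0 := rfl
    simp [this, HasCompactSupport.zero]
  add_mem' {f g} hf hg :=
    ⟨hf.1.add hg.1, (tsupport_add f g).trans (Set.union_subset hf.2 hg.2)⟩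
  smul_mem' c f hf := by
    refine ⟨hf.1.smul_left (f := fun _ => c), ?_⟩
    exact (tsupport_smul_subset_right (fun _ => c) f).trans hf.2

theorem isTestFunction_of_mem {Ω : Set 𝔼} {f : 𝓢(𝔼, ℝ)} (hf : f ∈ testSchwartz Ω) :
    IsTestFunction Ω f :=
  ⟨f.smooth ⊤, hf.1, hf.2⟩

theorem IsTestFunction.exists_mem {Ω : Set 𝔼} {φ : 𝔼 → ℝ} (h : IsTestFunction Ω φ) :
    ∃ f ∈ testSchwartz Ω, ⇑f = φ :=
  ⟨h.2.1.toSchwartzMap h.1, ⟨h.2.1, h.2.2⟩, rfl⟩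

/-- The shifted Laplacian whose square is the plate operator up to a constant. -/
noncomputable def shiftedLaplacian (τ : ℝ) :
    𝓢(EuclideanSpace ℝ (Fin d), ℝ) →ₗ[ℝ] 𝓢(EuclideanSpace ℝ (Fin d), ℝ) :=
  (LineDeriv.laplacianCLM ℝ 𝔼 𝓢(𝔼, ℝ)).toLinearMap - (τ / 2) • LinearMap.id

theorem shiftedLaplacian_apply (τ : ℝ) (f : 𝓢(𝔼, ℝ)) :
    shiftedLaplacian τ f = Δ f - (τ / 2) • f := by
  rfl

/-- The embedding of smooth functions into the form domain of the plate operator. -/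
noncomputable def plateEmbedding (τ : ℝ) : 𝓢(EuclideanSpace ℝ (Fin d), ℝ) →ₗ[ℝ]
    WithLp 2 (Lp ℝ 2 (volume : Measure (EuclideanSpace ℝ (Fin d))) ×
      Lp ℝ 2 (volume : Measure (EuclideanSpace ℝ (Fin d)))) :=
  (WithLp.linearEquiv 2 ℝ _).symm.toLinearMap ∘ₗ
    LinearMap.prod (SchwartzMap.toLpCLM ℝ ℝ 2 volume).toLinearMap
      ((SchwartzMap.toLpCLM ℝ ℝ 2 volume).toLinearMap ∘ₗ shiftedLaplacian τ)

theorem inner_plateEmbedding (τ : ℝ) (v) (f : 𝓢(𝔼, ℝ)) :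
    ⟪v, plateEmbedding τ f⟫_ℝ = ⟪v.fst, f.toLp 2⟫_ℝ + ⟪v.snd, (shiftedLaplacian τ f).toLp 2⟫_ℝ :=
  rfl

theorem plateEmbedding_fst (τ : ℝ) (f : 𝓢(𝔼, ℝ)) : (plateEmbedding τ f).fst = f.toLp 2 := rfl

theorem plateEmbedding_snd (τ : ℝ) (f : 𝓢(𝔼, ℝ)) :
    (plateEmbedding τ f).snd = (shiftedLaplacian τ f).toLp 2 := rfl

/-- The energy `∫ |Δf|² + τ|∇f|²`. -/
noncomputable def plateEnergy (τ : ℝ) (f : 𝓢(EuclideanSpace ℝ (Fin d), ℝ)) : ℝ :=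
  (∫ x, (Δ f x) ^ 2) - τ * ∫ x, f x * Δ f x

/-- Completing the square, (Δ - τ/2)² = Δ² - τΔ + τ²/4. The Hilbert norm is thus the energy plus a
constant multiple of the L² norm, and 1 + τ²/4 is the spectral shift used throughout. No sign of τ
is needed. -/
theorem norm_plateEmbedding_sq (τ : ℝ) (f : 𝓢(𝔼, ℝ)) :
    ‖plateEmbedding τ f‖ ^ 2 = plateEnergy τ f + (1 + τ ^ 2 / 4) * ∫ x, f x ^ 2 := by
  have h1 : ‖plateEmbedding τ f‖ ^ 2 =
      ‖f.toLp 2 (volume : Measure 𝔼)‖ ^ 2 + ‖(shiftedLaplacian τ f).toLp 2 (volume : Measure 𝔼)‖ ^ 2 := by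
    rw [WithLp.prod_norm_sq_eq_of_L2]
    rfl
  have hff : Integrable fun x => f x ^ 2 := by simp_rw [sq]; exact f.integrable_mul f
  have hll : Integrable fun x => (Δ f x) ^ 2 := by simp_rw [sq]; exact (Δ f).integrable_mul (Δ f)
  have h2 : ∫ x, (shiftedLaplacian τ f x) ^ 2 =
      (∫ x, (Δ f x) ^ 2) - τ * (∫ x, f x * Δ f x) + τ ^ 2 / 4 * ∫ x, f x ^ 2 := by
    rw [← integral_const_mul, ← integral_const_mul, ← integral_sub hll, ← integral_add]
    · refine integral_congr_ae (ae_of_all _ fun x => ?_)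
      simp only [shiftedLaplacian_apply, sub_apply, smul_apply, smul_eq_mul]
      ring
    · exact hll.sub ((f.integrable_mul _).const_mul _)
    · exact hff.const_mul _
    · exact (f.integrable_mul _).const_mul _
  rw [h1, SchwartzMap.norm_toLp_sq, SchwartzMap.norm_toLp_sq, h2, plateEnergy]
  ring

end PlateSpace

/-! ### The completed form domain: closability and Rellich compactness -/

section PlateSpace

open scoped SchwartzMap Laplacian InnerProductSpace

variable {d : ℕ}

local notation "𝔼" => EuclideanSpace ℝ (Fin d)

theorem norm_plateEmbedding_sq' (τ : ℝ) (f : 𝓢(𝔼, ℝ)) :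
    ‖plateEmbedding τ f‖ ^ 2 = (∫ x, f x ^ 2) + ∫ x, (shiftedLaplacian τ f x) ^ 2 := by
  rw [← SchwartzMap.norm_toLp_sq, ← SchwartzMap.norm_toLp_sq, WithLp.prod_norm_sq_eq_of_L2]
  rfl

theorem integrable_schwartz_sq (f : 𝓢(𝔼, ℝ)) : Integrable fun x => f x ^ 2 := by
  simp_rw [sq]; exact f.integrable_mul f

theorem integral_sq_add_laplacian_sq_le (τ : ℝ) (f : 𝓢(𝔼, ℝ)) :
    (∫ x, f x ^ 2) + ∫ x, (Δ f x) ^ 2 ≤ (2 + τ ^ 2) * ‖plateEmbedding τ f‖ ^ 2 := by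
  rw [norm_plateEmbedding_sq', ← integral_add, ← integral_add, ← integral_const_mul]
  · refine integral_mono ?_ ?_ fun x => ?_
    · exact (integrable_schwartz_sq f).add (integrable_schwartz_sq _)
    · exact ((integrable_schwartz_sq f).add (integrable_schwartz_sq _)).const_mul _
    · simp only [shiftedLaplacian_apply, sub_apply, smul_apply, smul_eq_mul]
      nlinarith [sq_nonneg (Δ f x - τ * f x), sq_nonneg (τ * f x),
        sq_nonneg (τ * (Δ f x - (τ / 2) * f x)), sq_nonneg (f x)]
  all_goals exact integrable_schwartz_sq _

theorem norm_plateEmbedding_sq_le (τ : ℝ) (f : 𝓢(𝔼, ℝ)) :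
    ‖plateEmbedding τ f‖ ^ 2 ≤ (2 + τ ^ 2) * ((∫ x, f x ^ 2) + ∫ x, (Δ f x) ^ 2) := by
  rw [norm_plateEmbedding_sq', ← integral_add, ← integral_add, ← integral_const_mul]
  · refine integral_mono ?_ ?_ fun x => ?_
    · exact (integrable_schwartz_sq f).add (integrable_schwartz_sq _)
    · exact ((integrable_schwartz_sq f).add (integrable_schwartz_sq _)).const_mul _
    · simp only [shiftedLaplacian_apply, sub_apply, smul_apply, smul_eq_mul]
      nlinarith [sq_nonneg (Δ f x + (τ / 2) * f x), sq_nonneg (τ * f x),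
        sq_nonneg (τ * Δ f x), sq_nonneg (f x)]
  all_goals exact integrable_schwartz_sq _

/-- The form domain of the plate operator. -/
noncomputable abbrev plateSpace (τ : ℝ) (Ω : Set (EuclideanSpace ℝ (Fin d))) :
    Submodule ℝ (WithLp 2 (Lp ℝ 2 (volume : Measure (EuclideanSpace ℝ (Fin d))) ×
      Lp ℝ 2 (volume : Measure (EuclideanSpace ℝ (Fin d))))) :=
  ((testSchwartz Ω).map (plateEmbedding τ)).topologicalClosure

/-- The embedding of the form domain into `L²`. -/
noncomputable def plateProj (τ : ℝ) (Ω : Set (EuclideanSpace ℝ (Fin d))) :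
    plateSpace τ Ω →L[ℝ] Lp ℝ 2 (volume : Measure (EuclideanSpace ℝ (Fin d))) :=
  WithLp.fstL 2 ℝ _ _ ∘L (plateSpace τ Ω).subtypeL

theorem plateProj_apply (τ : ℝ) (Ω : Set 𝔼) (v : plateSpace τ Ω) :
    plateProj τ Ω v = v.1.fst := rfl

theorem plateEmbedding_mem {τ : ℝ} {Ω : Set 𝔼} {f : 𝓢(𝔼, ℝ)} (hf : f ∈ testSchwartz Ω) :
    plateEmbedding τ f ∈ plateSpace τ Ω :=
  Submodule.le_topologicalClosure _ (Submodule.mem_map_of_mem hf)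

theorem exists_seq_tendsto_plateSpace {τ : ℝ} {Ω : Set 𝔼} {v} (hv : v ∈ plateSpace τ Ω) :
    ∃ f : ℕ → 𝓢(𝔼, ℝ), (∀ k, f k ∈ testSchwartz Ω) ∧
      Tendsto (fun k => plateEmbedding τ (f k)) atTop (𝓝 v) := by
  obtain ⟨u, hu, hut⟩ := mem_closure_iff_seq_limit.mp hv
  choose f hf hfu using hu
  exact ⟨f, hf, by simpa [hfu] using hut⟩

/-- The images of test functions in the form domain. -/
noncomputable def testSubspace (τ : ℝ) (Ω : Set (EuclideanSpace ℝ (Fin d))) :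
    Submodule ℝ (plateSpace τ Ω) :=
  ((testSchwartz Ω).map (plateEmbedding τ)).comap (plateSpace τ Ω).subtype

theorem mem_testSubspace {τ : ℝ} {Ω : Set 𝔼} {v : plateSpace τ Ω} :
    v ∈ testSubspace τ Ω ↔ ∃ f ∈ testSchwartz Ω, plateEmbedding τ f = v := Iff.rfl

theorem dense_testSubspace (τ : ℝ) (Ω : Set 𝔼) :
    Dense (testSubspace τ Ω : Set (plateSpace τ Ω)) := by
  intro v
  obtain ⟨f, hf, hft⟩ := exists_seq_tendsto_plateSpace v.2
  refine mem_closure_of_tendsto (f := fun k => (⟨plateEmbedding τ (f k),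
    plateEmbedding_mem (hf k)⟩ : plateSpace τ Ω)) (b := atTop) ?_ ?_
  · rw [tendsto_subtype_rng]
    exact hft
  · exact Eventually.of_forall fun k => ⟨f k, hf k, rfl⟩

theorem integral_mul_shiftedLaplacian (τ : ℝ) (f g : 𝓢(𝔼, ℝ)) :
    ∫ x, f x * shiftedLaplacian τ g x = ∫ x, shiftedLaplacian τ f x * g x := by
  simp only [shiftedLaplacian_apply, sub_apply, smul_apply, smul_eq_mul, mul_sub, sub_mul]
  have h1 : ∫ x, f x * (τ / 2 * g x) = ∫ x, τ / 2 * f x * g x := by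
    congr 1; ext x; ring
  have h2 : Integrable fun x => f x * (τ / 2 * g x) := f.integrable_mul ((τ / 2) • g)
  have h3 : Integrable fun x => τ / 2 * f x * g x := ((τ / 2) • f).integrable_mul g
  rw [integral_sub (f.integrable_mul _) h2, integral_sub ((Δ f).integrable_mul _) h3,
    SchwartzMap.integral_mul_laplacian_right_eq_left, h1]

/-- The form is represented by the plate operator. -/
theorem inner_plateEmbedding_eq {τ : ℝ} {Ω : Set 𝔼} {v} (hv : v ∈ plateSpace τ Ω)
    (f : 𝓢(𝔼, ℝ)) :
    ⟪v, plateEmbedding τ f⟫_ℝ =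
      ⟪v.fst, (f + shiftedLaplacian τ (shiftedLaplacian τ f)).toLp 2⟫_ℝ := by
  obtain ⟨g, hg, hgt⟩ := exists_seq_tendsto_plateSpace hv
  have h1 : Tendsto (fun k => ⟪plateEmbedding τ (g k), plateEmbedding τ f⟫_ℝ) atTop
      (𝓝 ⟪v, plateEmbedding τ f⟫_ℝ) := hgt.inner tendsto_const_nhds
  have h2 : Tendsto (fun k => ⟪(plateEmbedding τ (g k)).fst,
      (f + shiftedLaplacian τ (shiftedLaplacian τ f)).toLp 2⟫_ℝ) atTop
      (𝓝 ⟪v.fst, (f + shiftedLaplacian τ (shiftedLaplacian τ f)).toLp 2⟫_ℝ) :=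
    (((WithLp.fstL 2 ℝ _ _).continuous.tendsto v).comp hgt).inner tendsto_const_nhds
  refine tendsto_nhds_unique h1 (h2.congr fun k => ?_)
  have h3 : (f + shiftedLaplacian τ (shiftedLaplacian τ f)).toLp 2 (volume : Measure 𝔼) =
      f.toLp 2 volume + (shiftedLaplacian τ (shiftedLaplacian τ f)).toLp 2 volume := rfl
  rw [inner_plateEmbedding, plateEmbedding_fst, plateEmbedding_snd, h3, inner_add_right]
  simp only [SchwartzMap.inner_toLp_real]
  rw [integral_mul_shiftedLaplacian]

/-- Closability of the form: pairing with a test function only involves the L² component, so an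
element whose L² component vanishes is orthogonal to a dense subspace. -/
theorem plateProj_injective (τ : ℝ) (Ω : Set 𝔼) : Function.Injective (plateProj τ Ω) := by
  rw [injective_iff_map_eq_zero]
  intro v hv
  have h1 : ∀ w ∈ testSubspace τ Ω, ⟪v, w⟫_ℝ = 0 := by
    rintro w ⟨f, hf, hw⟩
    have h2 : ⟪v.1, plateEmbedding τ f⟫_ℝ = 0 := by
      rw [inner_plateEmbedding_eq v.2, ← plateProj_apply, hv, inner_zero_left]
    rw [hw] at h2
    exact h2
  exact (dense_testSubspace τ Ω).eq_zero_of_inner_left ℝ h1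

theorem norm_spectralTransform_le_integral (f : 𝓢(𝔼, ℝ)) (ξ : 𝔼) :
    ‖SchwartzMap.spectralTransform f ξ‖ ≤ ∫ x, |f x| := by
  rw [SchwartzMap.spectralTransform_apply]
  refine norm_integral_le_of_norm_le f.integrable.abs (ae_of_all _ fun x => ?_)
  rw [norm_mul, Complex.norm_exp_ofReal_mul_I]
  simp

/-- Test functions of bounded energy form a totally bounded family in `L²`. -/
theorem totallyBounded_range_toLp (τ : ℝ) {Ω : Set 𝔼} (hΩ : Bornology.IsBounded Ω) :
    TotallyBounded (Set.range fun f : {f : 𝓢(𝔼, ℝ) // f ∈ testSchwartz Ω ∧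
      ‖plateEmbedding τ f‖ ≤ 1} => f.1.toLp 2 (volume : Measure 𝔼)) := by
  obtain ⟨R₀, hR₀⟩ := hΩ.subset_closedBall 0
  set R := max R₀ 0 with hRdef
  have hR : Ω ⊆ Metric.closedBall 0 R :=
    hR₀.trans (Metric.closedBall_subset_closedBall (le_max_left _ _))
  have hR0 : 0 ≤ R := le_max_right _ _
  have hle : ∀ f : 𝓢(𝔼, ℝ), ∫ x, f x ^ 2 ≤ ‖plateEmbedding τ f‖ ^ 2 := by
    intro f
    rw [norm_plateEmbedding_sq']
    have : 0 ≤ ∫ x, (shiftedLaplacian τ f x) ^ 2 := integral_nonneg fun x => sq_nonneg _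
    linarith
  set a : {f : 𝓢(𝔼, ℝ) // f ∈ testSchwartz Ω ∧ ‖plateEmbedding τ f‖ ≤ 1} →
    Lp ℝ 2 (volume : Measure 𝔼) := fun f => f.1.toLp 2 with ha
  refine totallyBounded_range_of_finite_data a fun ε hε => ?_
  -- The difference of two members has plate norm at most 2, so this parameter makes the energy term
  -- at most ε²/2. The choice of δ below makes the term from the sampled frequencies at most ε²/4,
  -- which keeps the sum below ε².
  obtain ⟨t, C, hC, ht⟩ := SchwartzMap.exists_finset_integral_sq_le (d := d) hR0
    (ε := ε ^ 2 / (8 * (2 + τ ^ 2))) (by positivity)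
  obtain ⟨δ, hδ, h8⟩ : ∃ δ : ℝ, 0 < δ ∧ C * (t.card * δ ^ 2) ≤ ε ^ 2 / 4 := by
    have hc : (0 : ℝ) ≤ C * t.card := mul_nonneg hC (Nat.cast_nonneg _)
    generalize hcc : C * t.card = c at hc
    refine ⟨ε / (2 * (c + 1)), by positivity, ?_⟩
    rw [← mul_assoc, hcc, div_pow, mul_div_assoc', div_le_div_iff₀ (by positivity) (by norm_num)]
    nlinarith [mul_nonneg hc (sq_nonneg ε), mul_nonneg (mul_nonneg hc hc) (sq_nonneg ε)]
  refine ⟨t → ℂ, inferInstance, inferInstance,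
    fun f ξ => SchwartzMap.spectralTransform f.1 ξ, δ, hδ,
    ?_, ?_⟩
  · rw [isBounded_iff_forall_norm_le]
    refine ⟨√(volume.real (Metric.closedBall (0 : 𝔼) R)) * 1, ?_⟩
    rintro _ ⟨f, rfl⟩
    rw [pi_norm_le_iff_of_nonneg (by positivity)]
    intro ξ
    refine (norm_spectralTransform_le_integral _ _).trans ?_
    refine (SchwartzMap.integral_norm_le_of_support f.1 (f.2.1.2.trans hR)).trans ?_
    gcongr
    rw [Real.sqrt_le_one]
    exact (hle f.1).trans (pow_le_one₀ (norm_nonneg _) f.2.2)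
  · intro f g hfg
    have hsub : tsupport (f.1 - g.1 : 𝓢(𝔼, ℝ)) ⊆ Metric.closedBall 0 R :=
      ((testSchwartz Ω).sub_mem f.2.1 g.2.1).2.trans hR
    have h1 := ht (f.1 - g.1) hsub
    have h2 := integral_sq_add_laplacian_sq_le τ (f.1 - g.1)
    have h3 : ‖plateEmbedding τ (f.1 - g.1)‖ ≤ 2 := by
      rw [map_sub]
      have := norm_sub_le (plateEmbedding τ f.1) (plateEmbedding τ g.1)
      linarith [f.2.2, g.2.2]
    have h4 : ‖plateEmbedding τ (f.1 - g.1)‖ ^ 2 ≤ 4 := by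
      nlinarith [norm_nonneg (plateEmbedding τ (f.1 - g.1))]
    have h5 : ∑ ξ ∈ t, ‖SchwartzMap.spectralTransform (f.1 - g.1) ξ‖ ^ 2 ≤ t.card * δ ^ 2 := by
      rw [← nsmul_eq_mul]
      refine Finset.sum_le_card_nsmul _ _ _ fun ξ hξ => ?_
      have h6 := (dist_le_pi_dist _ _ (⟨ξ, hξ⟩ : t)).trans hfg.le
      rw [dist_eq_norm] at h6
      rw [SchwartzMap.spectralTransform_sub, sub_apply]
      gcongr
    have h6 : ‖a f - a g‖ ^ 2 < ε ^ 2 := by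
      have h7 : a f - a g = (f.1 - g.1).toLp 2 (volume : Measure 𝔼) :=
        (map_sub (SchwartzMap.toLpCLM ℝ ℝ 2 (volume : Measure 𝔼)) f.1 g.1).symm
      rw [h7, SchwartzMap.norm_toLp_sq]
      have h9 : ε ^ 2 / (8 * (2 + τ ^ 2)) *
          ((∫ x, (f.1 - g.1) x ^ 2) + ∫ x, (Δ (f.1 - g.1)) x ^ 2) ≤ ε ^ 2 / 2 := by
        calc _ ≤ ε ^ 2 / (8 * (2 + τ ^ 2)) * ((2 + τ ^ 2) * 4) := by
              gcongr
              exact h2.trans (by gcongr)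
          _ = _ := by field_simp; norm_num
      have h10 := mul_le_mul_of_nonneg_left h5 hC
      have h11 : 0 < ε ^ 2 := by positivity
      linarith
    rw [dist_eq_norm]
    exact lt_of_pow_lt_pow_left₀ 2 hε.le h6

/-- **Rellich's theorem** for the form domain of the plate operator. -/
theorem isCompactOperator_plateProj (τ : ℝ) {Ω : Set 𝔼} (hΩ : Bornology.IsBounded Ω) :
    IsCompactOperator (plateProj τ Ω) := by
  have htb := totallyBounded_range_toLp τ hΩ
  refine (isCompactOperator_iff_image_ball_subset_compact (𝕜₁ := ℝ)
    (plateProj τ Ω).toLinearMap zero_lt_one).mpr ?_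
  refine ⟨closure (Set.range _), (htb.closure).isCompact_of_isClosed isClosed_closure, ?_⟩
  rintro _ ⟨v, hv, rfl⟩
  obtain ⟨f, hf, hft⟩ := exists_seq_tendsto_plateSpace v.2
  have hv1 : ‖v.1‖ < 1 := by simpa using hv
  have hev : ∀ᶠ k in atTop, ‖plateEmbedding τ (f k)‖ < 1 := hft.norm.eventually_lt_const hv1
  have hlim : Tendsto (fun k => (f k).toLp 2 (volume : Measure 𝔼)) atTop
      (𝓝 v.1.fst) :=
    ((WithLp.fstL 2 ℝ _ _).continuous.tendsto _).comp hft
  refine mem_closure_of_tendsto hlim ?_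
  filter_upwards [hev] with k hk
  exact ⟨⟨f k, hf k, hk.le⟩, rfl⟩

end PlateSpace

/-! ### Infinite dimension of the form domain and its identification with H²₀ -/

section PlateSpace

open scoped SchwartzMap Laplacian InnerProductSpace

variable {d : ℕ}

local notation "𝔼" => EuclideanSpace ℝ (Fin d)

theorem plateEmbedding_injective (τ : ℝ) :
    Function.Injective (plateEmbedding τ : 𝓢(𝔼, ℝ) →ₗ[ℝ] _) := by
  intro f g h
  apply SchwartzMap.injective_toLp 2 (volume : Measure 𝔼)
  simpa [plateEmbedding_fst] using congrArg WithLp.fst h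

/-- Bump functions separating the points of a finite subset of Ω are independent, and Ω has
arbitrarily large finite subsets because d ≥ 1. -/
theorem not_finiteDimensional_testSchwartz (hd : 1 ≤ d) {Ω : Set 𝔼} (ho : IsOpen Ω)
    (hne : Ω.Nonempty) : ¬ FiniteDimensional ℝ (testSchwartz Ω) := by
  intro hfin
  have : Nonempty (Fin d) := ⟨⟨0, hd⟩⟩
  obtain ⟨x₀, hx₀⟩ := hne
  have hinf : Ω.Infinite := infinite_of_mem_nhds x₀ (ho.mem_nhds hx₀)
  obtain ⟨s, hsΩ, hsfin, hscard⟩ :=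
    hinf.exists_subset_ncard_eq (Module.finrank ℝ (testSchwartz Ω) + 1)
  have hex : ∀ x : s, ∃ f : testSchwartz Ω, f.1 x = 1 ∧ ∀ y ∈ s, y ≠ x → f.1 y = 0 := by
    intro x
    have hU : Ω ∩ (s \ {(x : 𝔼)})ᶜ ∈ 𝓝 (x : 𝔼) := by
      refine (ho.inter (hsfin.subset Set.sdiff_subset).isClosed.isOpen_compl).mem_nhds ?_
      exact ⟨hsΩ x.2, by simp⟩
    obtain ⟨f, hfs, hfc, hfd, -, hfx⟩ := exists_contDiff_tsupport_subset (n := ⊤) hU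
    refine ⟨⟨hfc.toSchwartzMap hfd, hfc, hfs.trans Set.inter_subset_left⟩, hfx, fun y hy hyx => ?_⟩
    refine image_eq_zero_of_notMem_tsupport (f := f) fun hmem => ?_
    exact (hfs hmem).2 ⟨hy, by simpa using hyx⟩
  choose f hf1 hf0 using hex
  have := hsfin.fintype
  have hli : LinearIndependent ℝ f := by
    rw [Fintype.linearIndependent_iff]
    intro c hc x
    have h1 := congrArg (fun g : testSchwartz Ω => g.1 (x : 𝔼)) hc
    simp only [AddSubmonoidClass.coe_finsetSum, Submodule.coe_smul, sum_apply,
      smul_apply, smul_eq_mul, ZeroMemClass.coe_zero, zero_apply] at h1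
    rw [Finset.sum_eq_single x] at h1
    · simpa [hf1] using h1
    · intro y _ hyx
      rw [hf0 y x x.2 (fun h => hyx (Subtype.ext h.symm)), mul_zero]
    · simp
  have h2 := hli.fintype_card_le_finrank
  rw [← Nat.card_eq_fintype_card, Nat.card_coe_set_eq, hscard] at h2
  omega

theorem not_finiteDimensional_plateSpace (hd : 1 ≤ d) (τ : ℝ) {Ω : Set 𝔼} (ho : IsOpen Ω)
    (hne : Ω.Nonempty) : ¬ FiniteDimensional ℝ (plateSpace τ Ω) := by
  intro hfin
  refine not_finiteDimensional_testSchwartz hd ho hne ?_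
  set j : testSchwartz Ω →ₗ[ℝ] plateSpace τ Ω :=
    ((plateEmbedding τ) ∘ₗ (testSchwartz Ω).subtype).codRestrict _
      (fun f => plateEmbedding_mem f.2) with hj
  refine Module.Finite.of_injective j ?_
  intro f g h
  apply Subtype.ext
  apply plateEmbedding_injective τ
  exact congrArg Subtype.val h

theorem inner_toLp_eq_integral (u : Lp ℝ 2 (volume : Measure 𝔼)) (g : 𝓢(𝔼, ℝ)) :
    ⟪u, g.toLp 2⟫_ℝ = ∫ x, u x * g x := by
  rw [L2.inner_def]
  apply integral_congr_ae
  filter_upwards [g.coeFn_toLp 2 volume] with x hg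
  rw [hg]
  simp [mul_comm]

theorem integral_sub_sq_eq_norm (u : Lp ℝ 2 (volume : Measure 𝔼)) (f : 𝓢(𝔼, ℝ)) :
    ∫ x, (f x - u x) ^ 2 = ‖f.toLp 2 volume - u‖ ^ 2 := by
  rw [← real_inner_self_eq_norm_sq, L2.inner_def]
  apply integral_congr_ae
  filter_upwards [f.coeFn_toLp 2 volume, Lp.coeFn_sub (f.toLp 2 volume) u] with x hf hs
  rw [hs, Pi.sub_apply, hf]
  simp [sq]

theorem sobolevNormSq_le_norm_plateEmbedding (τ : ℝ) (f : 𝓢(𝔼, ℝ)) :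
    sobolevNormSq f ≤ (1 + d + d ^ 2) * (2 + τ ^ 2) * ‖plateEmbedding τ f‖ ^ 2 := by
  refine f.sobolevNormSq_le.trans ?_
  rw [mul_assoc]
  gcongr
  exact integral_sq_add_laplacian_sq_le τ f

theorem norm_plateEmbedding_sq_le_sobolevNormSq (τ : ℝ) (f : 𝓢(𝔼, ℝ)) :
    ‖plateEmbedding τ f‖ ^ 2 ≤ (2 + τ ^ 2) * (1 + d ^ 2) * sobolevNormSq f := by
  refine (norm_plateEmbedding_sq_le τ f).trans ?_
  rw [mul_assoc]
  gcongr
  have h1 := f.integral_sq_le_sobolevNormSq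
  have h2 := f.integral_laplacian_sq_le_sobolevNormSq
  linarith

/-- The form domain is `H²₀`. -/
theorem memSobolevH20_iff (τ : ℝ) (Ω : Set 𝔼) (u : Lp ℝ 2 (volume : Measure 𝔼)) :
    MemSobolevH20 Ω u ↔ ∃ v : plateSpace τ Ω, plateProj τ Ω v = u := by
  constructor
  · rintro ⟨φ, hφ, hL2, hC⟩
    choose f hf hfφ using fun k => (hφ k).exists_mem
    -- By equivalence of norms, Cauchy in H² means Cauchy in the plate norm. The limit lies in the
    -- closure, and its first component must be u.
    have hcau : CauchySeq fun k => plateEmbedding τ (f k) := by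
      rw [cauchySeq_iff_tendsto_dist_atTop_0]
      have h1 : Tendsto (fun p : ℕ × ℕ => (2 + τ ^ 2) * (1 + d ^ 2) *
          sobolevNormSq (fun x => φ p.1 x - φ p.2 x)) atTop (𝓝 0) := by
        simpa using hC.const_mul ((2 + τ ^ 2) * (1 + (d : ℝ) ^ 2))
      have h2 : Tendsto (fun p : ℕ × ℕ => dist (plateEmbedding τ (f p.1))
          (plateEmbedding τ (f p.2)) ^ 2) atTop (𝓝 0) := by
        refine squeeze_zero (fun _ => sq_nonneg _) (fun p => ?_) h1
        rw [dist_eq_norm, ← map_sub]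
        refine (norm_plateEmbedding_sq_le_sobolevNormSq τ _).trans (le_of_eq ?_)
        congr 2
        ext x
        simp [← hfφ]
      simpa [Real.sqrt_sq dist_nonneg] using h2.sqrt
    obtain ⟨v, hv⟩ := cauchySeq_tendsto_of_complete hcau
    have hvmem : v ∈ plateSpace τ Ω :=
      mem_closure_of_tendsto hv (Eventually.of_forall fun k => ⟨f k, hf k, rfl⟩)
    refine ⟨⟨v, hvmem⟩, ?_⟩
    have h1 : Tendsto (fun k => (f k).toLp 2 (volume : Measure 𝔼)) atTop (𝓝 v.fst) :=
      ((WithLp.fstL 2 ℝ _ _).continuous.tendsto _).comp hv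
    have h2 : Tendsto (fun k => (f k).toLp 2 (volume : Measure 𝔼)) atTop (𝓝 u) := by
      rw [tendsto_iff_norm_sub_tendsto_zero]
      have h3 : Tendsto (fun k => ‖(f k).toLp 2 (volume : Measure 𝔼) - u‖ ^ 2) atTop (𝓝 0) := by
        refine hL2.congr fun k => ?_
        rw [← integral_sub_sq_eq_norm, hfφ]
      simpa [Real.sqrt_sq (norm_nonneg _)] using h3.sqrt
    exact tendsto_nhds_unique h1 h2
  · rintro ⟨v, rfl⟩
    obtain ⟨f, hf, hft⟩ := exists_seq_tendsto_plateSpace v.2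
    refine ⟨fun k => f k, fun k => isTestFunction_of_mem (hf k), ?_, ?_⟩
    · simp_rw [integral_sub_sq_eq_norm]
      have h1 : Tendsto (fun k => (f k).toLp 2 (volume : Measure 𝔼)) atTop (𝓝 v.1.fst) :=
        ((WithLp.fstL 2 ℝ _ _).continuous.tendsto _).comp hft
      rw [tendsto_iff_norm_sub_tendsto_zero] at h1
      simpa [plateProj_apply] using h1.pow 2
    · have hcau := (cauchySeq_iff_tendsto_dist_atTop_0).mp hft.cauchySeq
      have h1 : Tendsto (fun p : ℕ × ℕ => (1 + d + d ^ 2) * (2 + τ ^ 2) *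
          dist (plateEmbedding τ (f p.1)) (plateEmbedding τ (f p.2)) ^ 2) atTop (𝓝 0) := by
        simpa using (hcau.pow 2).const_mul ((1 + d + (d : ℝ) ^ 2) * (2 + τ ^ 2))
      refine squeeze_zero (fun p => ?_) (fun p => ?_) h1
      · exact Finset.sum_nonneg fun j _ => integral_nonneg fun x => sq_nonneg _
      · rw [dist_eq_norm, ← map_sub]
        exact sobolevNormSq_le_norm_plateEmbedding τ (f p.1 - f p.2)

theorem toLp_two_add (f g : 𝓢(𝔼, ℝ)) :
    (f + g).toLp 2 (volume : Measure 𝔼) = f.toLp 2 volume + g.toLp 2 volume := rfl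

theorem toLp_two_smul (c : ℝ) (f : 𝓢(𝔼, ℝ)) :
    (c • f).toLp 2 (volume : Measure 𝔼) = c • f.toLp 2 volume := rfl

theorem add_shiftedLaplacian_shiftedLaplacian (τ : ℝ) (f : 𝓢(𝔼, ℝ)) :
    f + shiftedLaplacian τ (shiftedLaplacian τ f) =
      (Δ (Δ f) - τ • Δ f) + (1 + τ ^ 2 / 4) • f := by
  have h1 : Δ (Δ f - (τ / 2) • f) = Δ (Δ f) - (τ / 2) • Δ f := by
    simp only [← SchwartzMap.laplacianCLM_eq', map_sub, map_smul]
  simp only [shiftedLaplacian_apply, h1]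
  module

theorem coe_laplacian_schwartz (f : 𝓢(𝔼, ℝ)) :
    Laplacian.laplacian (⇑f : 𝔼 → ℝ) = ⇑(Δ f : 𝓢(𝔼, ℝ)) :=
  funext fun x => (SchwartzMap.laplacian_apply f x).symm

end PlateSpace

/-! ### Weak eigenfunctions and the variational principle for eigenvalue sums -/

section PlateSpace

open scoped SchwartzMap Laplacian InnerProductSpace

variable {d : ℕ}

local notation "𝔼" => EuclideanSpace ℝ (Fin d)

theorem laplacian_laplacian_sub_apply (τ : ℝ) (f : 𝓢(𝔼, ℝ)) (x : 𝔼) :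
    (Δ (Δ f) - τ • Δ f) x = Laplacian.laplacian (Laplacian.laplacian (⇑f : 𝔼 → ℝ)) x -
      τ * Laplacian.laplacian (⇑f : 𝔼 → ℝ) x := by
  rw [coe_laplacian_schwartz f, coe_laplacian_schwartz (Δ f)]
  rfl

/-- The form is the weak form of the plate operator, up to a shift. -/
theorem inner_plateEmbedding_eq_integral (τ : ℝ) {Ω : Set 𝔼} (v : plateSpace τ Ω)
    (f : 𝓢(𝔼, ℝ)) : ⟪v.1, plateEmbedding τ f⟫_ℝ =
      (∫ x, plateProj τ Ω v x * (Δ (Δ f) - τ • Δ f) x) +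
      (1 + τ ^ 2 / 4) * ∫ x, plateProj τ Ω v x * f x := by
  have h1 := inner_plateEmbedding_eq v.2 f
  rw [← plateProj_apply] at h1
  generalize plateProj τ Ω v = u at h1 ⊢
  rw [add_shiftedLaplacian_shiftedLaplacian, toLp_two_add, toLp_two_smul, inner_add_right,
    inner_smul_right, inner_toLp_eq_integral, inner_toLp_eq_integral] at h1
  exact h1

theorem plateProj_eq_toLp {τ : ℝ} {Ω : Set 𝔼} {f : 𝓢(𝔼, ℝ)}
    {w : plateSpace τ Ω} (hw : plateEmbedding τ f = w.1) :
    plateProj τ Ω w = f.toLp 2 volume := by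
  rw [plateProj_apply, ← plateEmbedding_fst τ f, hw]

theorem inner_plateProj_toLp (τ : ℝ) {Ω : Set 𝔼} (v : plateSpace τ Ω) {f : 𝓢(𝔼, ℝ)}
    {w : plateSpace τ Ω} (hw : plateEmbedding τ f = w.1) :
    ⟪plateProj τ Ω v, plateProj τ Ω w⟫_ℝ = ∫ x, plateProj τ Ω v x * f x := by
  rw [plateProj_eq_toLp hw, inner_toLp_eq_integral]

theorem inner_plateProj_plateProj {τ : ℝ} {Ω : Set 𝔼} {f g : 𝓢(𝔼, ℝ)}
    {v w : plateSpace τ Ω} (hv : plateEmbedding τ f = v.1) (hw : plateEmbedding τ g = w.1) :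
    ⟪plateProj τ Ω v, plateProj τ Ω w⟫_ℝ = ∫ x, f x * g x := by
  rw [plateProj_eq_toLp hw, plateProj_eq_toLp hv, SchwartzMap.inner_toLp_real]

theorem inner_eq_of_weak {τ γ : ℝ} {Ω : Set 𝔼} {v w : plateSpace τ Ω}
    (hweak : ∀ φ : 𝔼 → ℝ, IsTestFunction Ω φ → ∫ x, plateProj τ Ω v x *
      (Laplacian.laplacian (Laplacian.laplacian φ) x - τ * Laplacian.laplacian φ x)
        = γ * ∫ x, plateProj τ Ω v x * φ x)
    {f : 𝓢(𝔼, ℝ)} (hf : f ∈ testSchwartz Ω) (hw : plateEmbedding τ f = w.1) :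
    ⟪v, w⟫_ℝ = (γ + (1 + τ ^ 2 / 4)) * ⟪plateProj τ Ω v, plateProj τ Ω w⟫_ℝ := by
  have h2 := inner_plateEmbedding_eq_integral τ v f
  have h3 := hweak f (isTestFunction_of_mem hf)
  simp_rw [← laplacian_laplacian_sub_apply] at h3
  rw [h3] at h2
  rw [inner_plateProj_toLp τ v hw, Submodule.coe_inner, ← hw, h2]
  ring

theorem weak_of_inner_eq {τ γ : ℝ} {Ω : Set 𝔼} {v : plateSpace τ Ω}
    (hv : ∀ w, ⟪v, w⟫_ℝ = (γ + (1 + τ ^ 2 / 4)) * ⟪plateProj τ Ω v, plateProj τ Ω w⟫_ℝ)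
    {f : 𝓢(𝔼, ℝ)} (hf : f ∈ testSchwartz Ω) :
    ∫ x, plateProj τ Ω v x *
      (Laplacian.laplacian (Laplacian.laplacian (⇑f : 𝔼 → ℝ)) x -
        τ * Laplacian.laplacian (⇑f : 𝔼 → ℝ) x) = γ * ∫ x, plateProj τ Ω v x * f x := by
  have hw : ∃ w : plateSpace τ Ω, plateEmbedding τ f = w.1 := ⟨⟨_, plateEmbedding_mem hf⟩, rfl⟩
  obtain ⟨w, hw⟩ := hw
  have h1 := hv w
  have h2 := inner_plateEmbedding_eq_integral τ v f
  simp_rw [← laplacian_laplacian_sub_apply]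
  rw [inner_plateProj_toLp τ v hw, Submodule.coe_inner, ← hw, h2] at h1
  linarith

/-- The weak equation tests only against smooth functions; both sides are continuous in w, so
density extends it to the whole form domain. The eigenvalue γ becomes γ + 1 + τ²/4 for the Hilbert
norm. -/
theorem isWeakPlateSolution_iff (τ γ : ℝ) (Ω : Set 𝔼) (u : Lp ℝ 2 (volume : Measure 𝔼)) :
    IsWeakPlateSolution τ γ Ω u ↔ ∃ v : plateSpace τ Ω, plateProj τ Ω v = u ∧
      ∀ w, ⟪v, w⟫_ℝ = (γ + (1 + τ ^ 2 / 4)) * ⟪plateProj τ Ω v, plateProj τ Ω w⟫_ℝ := by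
  constructor
  · rintro ⟨hmem, hweak⟩
    obtain ⟨v, rfl⟩ := (memSobolevH20_iff τ Ω u).mp hmem
    refine ⟨v, rfl, ?_⟩
    have hcl : IsClosed {w | ⟪v, w⟫_ℝ =
        (γ + (1 + τ ^ 2 / 4)) * ⟪plateProj τ Ω v, plateProj τ Ω w⟫_ℝ} :=
      isClosed_eq (continuous_const.inner continuous_id) (continuous_const.mul
        (continuous_const.inner (plateProj τ Ω).continuous))
    have hsub : (testSubspace τ Ω : Set (plateSpace τ Ω)) ⊆ {w | ⟪v, w⟫_ℝ =
        (γ + (1 + τ ^ 2 / 4)) * ⟪plateProj τ Ω v, plateProj τ Ω w⟫_ℝ} := by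
      intro w hw'
      obtain ⟨f, hf, hw⟩ := mem_testSubspace.mp hw'
      exact inner_eq_of_weak hweak hf hw
    exact fun w => hcl.closure_subset_iff.mpr hsub (dense_testSubspace τ Ω w)
  · rintro ⟨v, rfl, hv⟩
    refine ⟨(memSobolevH20_iff τ Ω _).mpr ⟨v, rfl⟩, fun φ hφ => ?_⟩
    obtain ⟨f, hf, rfl⟩ := hφ.exists_mem
    exact weak_of_inner_eq hv hf

/-- The dimension count makes the set in the infimum a closed half-line, starting at the unshifted
eigenvalue. The indices differ by one because eigen systems start at 0. -/
theorem plateEigenvalue_eq {τ : ℝ} {Ω : Set 𝔼} {n : ℕ} {e : ℕ → plateSpace τ Ω} {l : ℕ → ℝ}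
    (h : IsEigenSystem (plateProj τ Ω) n e l) {k : ℕ} (hk : k < n) :
    plateEigenvalue τ Ω (k + 1) = l k - (1 + τ ^ 2 / 4) := by
  have hset : {t : ℝ | ((k + 1 : ℕ) : Cardinal) ≤ plateCounting τ Ω t} =
      Set.Ici (l k - (1 + τ ^ 2 / 4)) := by
    ext t
    have h1 := h.succ_le_rank_iff (plateProj_injective τ Ω) hk (1 + τ ^ 2 / 4) t
    have h2 : {u : Lp ℝ 2 (volume : Measure 𝔼) | ∃ γ ≤ t, IsWeakPlateSolution τ γ Ω u} =
        {u | ∃ γ ≤ t, ∃ v : plateSpace τ Ω, plateProj τ Ω v = u ∧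
          ∀ w, ⟪v, w⟫_ℝ = (γ + (1 + τ ^ 2 / 4)) * ⟪plateProj τ Ω v, plateProj τ Ω w⟫_ℝ} := by
      ext u
      exact exists_congr fun γ => and_congr_right fun _ => isWeakPlateSolution_iff τ γ Ω u
    rw [Set.mem_ofPred_eq, Set.mem_Ici, plateCounting, h2]
    exact h1
  rw [plateEigenvalue, hset, csInf_Ici]

theorem plateEigenvalueSum_eq {τ : ℝ} {Ω : Set 𝔼} {n : ℕ} {e : ℕ → plateSpace τ Ω} {l : ℕ → ℝ}
    (h : IsEigenSystem (plateProj τ Ω) n e l) :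
    plateEigenvalueSum τ n Ω = (∑ i : Fin n, l i) - n * (1 + τ ^ 2 / 4) := by
  have h1 : plateEigenvalueSum τ n Ω = ∑ i ∈ Finset.range n, plateEigenvalue τ Ω (i + 1) := by
    rw [plateEigenvalueSum, Finset.range_eq_Ico, Finset.sum_Ico_add', zero_add]
    rfl
  rw [h1, Fin.sum_univ_eq_sum_range (fun i => l i),
    Finset.sum_congr rfl fun k hk => plateEigenvalue_eq h (Finset.mem_range.mp hk)]
  simp only [Finset.sum_sub_distrib, Finset.sum_const, Finset.card_range, nsmul_eq_mul]

theorem exists_isEigenSystem_plateProj (hd : 1 ≤ d) (τ : ℝ) {Ω : Set 𝔼} (ho : IsOpen Ω)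
    (hne : Ω.Nonempty) (hb : Bornology.IsBounded Ω) (n : ℕ) :
    ∃ (e : ℕ → plateSpace τ Ω) (l : ℕ → ℝ), IsEigenSystem (plateProj τ Ω) n e l :=
  exists_isEigenSystem _ (isCompactOperator_plateProj τ hb) (plateProj_injective τ Ω)
    (not_finiteDimensional_plateSpace hd τ ho hne) n

/-- Orthonormality in `L²` of a family of Schwartz functions. -/
def IsL2Orthonormal {n : ℕ} (f : Fin n → 𝓢(EuclideanSpace ℝ (Fin d), ℝ)) : Prop :=
  ∀ i j, ∫ x, f i x * f j x = if i = j then 1 else 0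

theorem IsL2Orthonormal.sum_norm_plateEmbedding_sq {n : ℕ} {f : Fin n → 𝓢(𝔼, ℝ)}
    (h : IsL2Orthonormal f) (τ : ℝ) : ∑ j, ‖plateEmbedding τ (f j)‖ ^ 2 =
      (∑ j, plateEnergy τ (f j)) + n * (1 + τ ^ 2 / 4) := by
  have h1 : ∀ j, ∫ x, f j x ^ 2 = 1 := fun j => by simpa [sq] using h j j
  have h2 : ∀ j, ‖plateEmbedding τ (f j)‖ ^ 2 = plateEnergy τ (f j) + (1 + τ ^ 2 / 4) :=
    fun j => by rw [norm_plateEmbedding_sq, h1, mul_one]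
  rw [Finset.sum_congr rfl fun j _ => h2 j, Finset.sum_add_distrib]
  simp only [Finset.sum_const, Finset.card_univ, Fintype.card_fin, nsmul_eq_mul]

/-- The eigenvalue sum is a lower bound of the energy of orthonormal test functions. -/
theorem plateEigenvalueSum_le (hd : 1 ≤ d) (τ : ℝ) {Ω : Set 𝔼} (ho : IsOpen Ω)
    (hne : Ω.Nonempty) (hb : Bornology.IsBounded Ω) {n : ℕ} {f : Fin n → 𝓢(𝔼, ℝ)}
    (hf : ∀ j, f j ∈ testSchwartz Ω) (horth : IsL2Orthonormal f) :
    plateEigenvalueSum τ n Ω ≤ ∑ j, plateEnergy τ (f j) := by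
  obtain ⟨e, l, h⟩ := exists_isEigenSystem_plateProj hd τ ho hne hb n
  rw [plateEigenvalueSum_eq h]
  have hv : ∀ j, ∃ v : plateSpace τ Ω, plateEmbedding τ (f j) = v.1 :=
    fun j => ⟨⟨_, plateEmbedding_mem (hf j)⟩, rfl⟩
  choose v hv using hv
  have h1 := h.sum_le v ?_
  · have h2 := horth.sum_norm_plateEmbedding_sq τ
    have h3 : ∀ j, ‖v j‖ = ‖plateEmbedding τ (f j)‖ := fun j => by
      rw [hv j, Submodule.coe_norm]
    simp_rw [h3] at h1
    rw [h2] at h1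
    linarith
  · rw [orthonormal_iff_ite]
    intro i j
    rw [← horth i j, inner_plateProj_plateProj (hv i) (hv j)]

/-- The eigenvalue sum is the greatest lower bound of the energy of orthonormal test functions. -/
theorem le_plateEigenvalueSum (hd : 1 ≤ d) (τ : ℝ) {Ω : Set 𝔼} (ho : IsOpen Ω)
    (hne : Ω.Nonempty) (hb : Bornology.IsBounded Ω) {n : ℕ} {C : ℝ}
    (hC : ∀ f : Fin n → 𝓢(𝔼, ℝ), (∀ j, f j ∈ testSchwartz Ω) → IsL2Orthonormal f →
      C ≤ ∑ j, plateEnergy τ (f j)) :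
    C ≤ plateEigenvalueSum τ n Ω := by
  obtain ⟨e, l, h⟩ := exists_isEigenSystem_plateProj hd τ ho hne hb n
  rw [plateEigenvalueSum_eq h, le_sub_iff_add_le]
  refine h.le_sum_of_dense (testSubspace τ Ω) (dense_testSubspace τ Ω) _ fun φ hφ horth => ?_
  choose f hf hfφ using fun j => mem_testSubspace.mp (hφ j)
  have h1 : IsL2Orthonormal f := by
    intro i j
    rw [← (orthonormal_iff_ite.mp horth) i j, inner_plateProj_plateProj (hfφ i) (hfφ j)]
  have h2 := h1.sum_norm_plateEmbedding_sq τ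
  have h3 : ∀ j, ‖φ j‖ = ‖plateEmbedding τ (f j)‖ := fun j => by rw [hfφ, Submodule.coe_norm]
  simp_rw [h3, h2]
  linarith [hC f hf h1]

end PlateSpace

/-! ### Linear changes of variables and translations -/

section ChangeOfVariables

open scoped SchwartzMap Laplacian InnerProductSpace Real

variable {d : ℕ}

local notation "𝔼" => EuclideanSpace ℝ (Fin d)

theorem plateEnergy_eq_spectral (τ : ℝ) (f : 𝓢(𝔼, ℝ)) :
    plateEnergy τ f = ∫ ξ, (‖(2 * π) • ξ‖ ^ 4 + τ * ‖(2 * π) • ξ‖ ^ 2) *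
      ‖f.spectralTransform ξ‖ ^ 2 := by
  have hn : ∀ k, Integrable fun ξ : 𝔼 => ‖(2 * π) • ξ‖ ^ k * ‖f.spectralTransform ξ‖ ^ 2 := by
    intro k
    refine ((f.integrable_norm_pow_mul_spectral k).const_mul ((2 * π) ^ k)).congr
      (ae_of_all _ fun ξ => ?_)
    simp only [norm_smul, Real.norm_of_nonneg (by positivity : (0 : ℝ) ≤ 2 * π)]
    ring
  have h : plateEnergy τ f = (∫ x, (Δ f x) ^ 2) + τ * (- ∫ x, f x * Δ f x) := by
    rw [plateEnergy]; ring
  rw [h, f.integral_laplacian_sq_eq_spectral, f.integral_mul_laplacian_eq_spectral,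
    ← integral_const_mul, ← integral_add (hn 4) ((hn 2).const_mul τ)]
  refine integral_congr_ae (ae_of_all _ fun ξ => ?_)
  simp only
  ring

/-- The `L²`-normalized composition of a Schwartz function with a linear map. -/
noncomputable def schwartzPullback (A : EuclideanSpace ℝ (Fin d) ≃L[ℝ] EuclideanSpace ℝ (Fin d))
    (f : 𝓢(EuclideanSpace ℝ (Fin d), ℝ)) : 𝓢(EuclideanSpace ℝ (Fin d), ℝ) :=
  √|LinearMap.det (A.toLinearEquiv : EuclideanSpace ℝ (Fin d) →ₗ[ℝ] EuclideanSpace ℝ (Fin d))| •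
    SchwartzMap.compCLMOfContinuousLinearEquiv ℝ A f

theorem schwartzPullback_apply (A : 𝔼 ≃L[ℝ] 𝔼) (f : 𝓢(𝔼, ℝ)) (x : 𝔼) :
    schwartzPullback A f x = √|LinearMap.det (A.toLinearEquiv : 𝔼 →ₗ[ℝ] 𝔼)| * f (A x) := rfl

theorem abs_det_pos (A : 𝔼 ≃L[ℝ] 𝔼) : 0 < |LinearMap.det (A.toLinearEquiv : 𝔼 →ₗ[ℝ] 𝔼)| :=
  abs_pos.mpr (LinearEquiv.isUnit_det' _).ne_zero

theorem schwartzPullback_mem (A : 𝔼 ≃L[ℝ] 𝔼) {Ω : Set 𝔼} {f : 𝓢(𝔼, ℝ)}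
    (hf : f ∈ testSchwartz Ω) : schwartzPullback A f ∈ testSchwartz (A ⁻¹' Ω) := by
  refine Submodule.smul_mem _ _ ⟨hf.1.comp_homeomorph A.toHomeomorph, ?_⟩
  have h := tsupport_comp_eq_preimage (⇑f) A.toHomeomorph
  refine h.subset.trans ?_
  exact Set.preimage_mono hf.2

theorem integral_schwartzPullback_mul (A : 𝔼 ≃L[ℝ] 𝔼) (f g : 𝓢(𝔼, ℝ)) :
    ∫ x, schwartzPullback A f x * schwartzPullback A g x = ∫ x, f x * g x := by
  have h := integral_comp_linearMap_of_det_ne_zero (L := (A.toLinearEquiv : 𝔼 →ₗ[ℝ] 𝔼))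
    (LinearEquiv.isUnit_det' _).ne_zero fun x => f x * g x
  have h1 := abs_det_pos A
  set D := |LinearMap.det (A.toLinearEquiv : 𝔼 →ₗ[ℝ] 𝔼)| with hD
  have h2 : ∀ x, schwartzPullback A f x * schwartzPullback A g x = D * (f (A x) * g (A x)) := by
    intro x
    rw [schwartzPullback_apply, schwartzPullback_apply, ← hD]
    rw [mul_mul_mul_comm, Real.mul_self_sqrt h1.le]
  simp_rw [h2]
  rw [integral_const_mul]
  have h3 : ∫ x, f (A x) * g (A x) = D⁻¹ • ∫ x, f x * g x := h
  rw [h3, smul_eq_mul, mul_inv_cancel_left₀ h1.ne']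

/-- The normalizing factor cancels the Jacobian, so A enters only through its adjoint in the Fourier
weight. The density of f itself is untouched, which is what allows averaging over symmetries. -/
theorem plateEnergy_schwartzPullback (τ : ℝ) (A : 𝔼 ≃L[ℝ] 𝔼) (f : 𝓢(𝔼, ℝ)) :
    plateEnergy τ (schwartzPullback A f) =
      ∫ ξ, (‖(2 * π) • (A.toLinearEquiv : 𝔼 →ₗ[ℝ] 𝔼).adjoint ξ‖ ^ 4 +
        τ * ‖(2 * π) • (A.toLinearEquiv : 𝔼 →ₗ[ℝ] 𝔼).adjoint ξ‖ ^ 2) *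
        ‖f.spectralTransform ξ‖ ^ 2 := by
  have h1 := abs_det_pos A
  have h := SchwartzMap.integral_mul_spectralTransform_comp A f
    fun ξ => ‖(2 * π) • ξ‖ ^ 4 + τ * ‖(2 * π) • ξ‖ ^ 2
  have h2 : ∀ (c : ℝ) (g : 𝓢(𝔼, ℝ)), plateEnergy τ (c • g) = c ^ 2 * plateEnergy τ g := by
    intro c g
    have h3 : (Δ (c • g) : 𝓢(𝔼, ℝ)) = c • Δ g := by
      simp only [← SchwartzMap.laplacianCLM_eq', map_smul]
    have h4 : ∫ x, (Δ (c • g) x) ^ 2 = c ^ 2 * ∫ x, (Δ g x) ^ 2 := by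
      rw [h3, ← integral_const_mul]
      exact integral_congr_ae (ae_of_all _ fun x => by simp [mul_pow])
    have h5 : ∫ x, (c • g) x * Δ (c • g) x = c ^ 2 * ∫ x, g x * Δ g x := by
      rw [h3, ← integral_const_mul]
      refine integral_congr_ae (ae_of_all _ fun x => ?_)
      simp only [smul_apply, smul_eq_mul]
      ring
    rw [plateEnergy, plateEnergy, h4, h5]
    ring
  rw [schwartzPullback, h2, Real.sq_sqrt h1.le, plateEnergy_eq_spectral, h,
    mul_inv_cancel_left₀ h1.ne']

/-- Transplanting orthonormal test functions bounds the eigenvalue sum of a linear image. -/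
theorem plateEigenvalueSum_preimage_le (hd : 1 ≤ d) (τ : ℝ) (A : 𝔼 ≃L[ℝ] 𝔼) {Ω : Set 𝔼}
    (ho : IsOpen Ω) (hne : Ω.Nonempty) (hb : Bornology.IsBounded Ω) {n : ℕ} {f : Fin n → 𝓢(𝔼, ℝ)}
    (hf : ∀ j, f j ∈ testSchwartz Ω) (horth : IsL2Orthonormal f) :
    plateEigenvalueSum τ n (A ⁻¹' Ω) ≤ ∑ j,
      ∫ ξ, (‖(2 * π) • (A.toLinearEquiv : 𝔼 →ₗ[ℝ] 𝔼).adjoint ξ‖ ^ 4 +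
        τ * ‖(2 * π) • (A.toLinearEquiv : 𝔼 →ₗ[ℝ] 𝔼).adjoint ξ‖ ^ 2) *
        ‖(f j).spectralTransform ξ‖ ^ 2 := by
  have himg : A ⁻¹' Ω = A.symm '' Ω := A.image_symm_eq_preimage Ω |>.symm
  refine (plateEigenvalueSum_le hd τ (ho.preimage A.continuous) ?_ ?_
    (fun j => schwartzPullback_mem A (hf j)) fun i j => ?_).trans_eq
    (Finset.sum_congr rfl fun j _ => plateEnergy_schwartzPullback τ A (f j))
  · rw [himg]; exact hne.image _
  · rw [himg]; exact A.symm.lipschitz.isBounded_image hb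
  · rw [integral_schwartzPullback_mul, horth]

/-- Translating test functions preserves inner products and energies. Applying the inequality also
to -a gives the equality used below. -/
theorem plateEigenvalueSum_preimage_add_le (hd : 1 ≤ d) (τ : ℝ) (a : 𝔼) {Ω : Set 𝔼}
    (ho : IsOpen Ω) (hne : Ω.Nonempty) (hb : Bornology.IsBounded Ω) (n : ℕ) :
    plateEigenvalueSum τ n ((fun x => x + a) ⁻¹' Ω) ≤ plateEigenvalueSum τ n Ω := by
  have himg : (fun x => x + a) ⁻¹' Ω = (fun x => x - a) '' Ω := by
    ext x
    constructor
    · intro hx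
      exact ⟨x + a, hx, by simp⟩
    · rintro ⟨y, hy, rfl⟩
      simpa using hy
  refine le_plateEigenvalueSum hd τ ho hne hb fun f hf horth => ?_
  have hg : ∀ j, ∃ g ∈ testSchwartz ((fun x => x + a) ⁻¹' Ω), ⇑g = fun x => f j (x + a) := by
    intro j
    refine IsTestFunction.exists_mem ⟨?_, ?_, ?_⟩
    · exact ((f j).smooth ⊤).comp (contDiff_id.add contDiff_const)
    · exact (hf j).1.comp_homeomorph (Homeomorph.addRight a)
    · have h := tsupport_comp_eq_preimage (⇑(f j)) (Homeomorph.addRight a)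
      exact h.subset.trans (Set.preimage_mono (hf j).2)
  choose g hg hgf using hg
  have hlap : ∀ j x, (Δ (g j)) x = (Δ (f j)) (x + a) := by
    intro j x
    rw [← coe_laplacian_schwartz, ← coe_laplacian_schwartz, hgf]
    simp only [InnerProductSpace.laplacian_eq_iteratedFDeriv_stdOrthonormalBasis]
    simp_rw [iteratedFDeriv_comp_add_right]
  refine (plateEigenvalueSum_le hd τ (ho.preimage (by fun_prop)) ?_ ?_ hg
    fun i j => ?_).trans_eq (Finset.sum_congr rfl fun j _ => ?_)
  · rw [himg]; exact hne.image _
  · rw [himg]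
    exact (LipschitzWith.id.sub (LipschitzWith.const a)).isBounded_image hb
  · rw [← horth i j, hgf, hgf]
    exact integral_add_right_eq_self (fun x => f i x * f j x) a
  · simp only [plateEnergy, hlap, hgf]
    rw [integral_add_right_eq_self (fun x => (Δ (f j) x) ^ 2) a,
      integral_add_right_eq_self (fun x => f j x * Δ (f j) x) a]

theorem plateEigenvalueSum_image_add (hd : 1 ≤ d) (τ : ℝ) (a : 𝔼) {Ω : Set 𝔼}
    (ho : IsOpen Ω) (hne : Ω.Nonempty) (hb : Bornology.IsBounded Ω) (n : ℕ) :
    plateEigenvalueSum τ n ((fun x => a + x) '' Ω) = plateEigenvalueSum τ n Ω := by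
  have h1 : (fun x => a + x) '' Ω = (fun x => x + -a) ⁻¹' Ω := by
    ext x
    constructor
    · rintro ⟨y, hy, rfl⟩
      simpa using hy
    · intro hx
      exact ⟨x + -a, hx, by simp⟩
  apply le_antisymm
  · rw [h1]
    exact plateEigenvalueSum_preimage_add_le hd τ (-a) ho hne hb n
  · have h2 : Ω = (fun x => x + a) ⁻¹' ((fun x => a + x) '' Ω) := by
      rw [h1]; ext x; simp
    conv_lhs => rw [h2]
    refine plateEigenvalueSum_preimage_add_le hd τ a ?_ (hne.image _) ?_ n
    · rw [h1]; exact ho.preimage (by fun_prop)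
    · exact ((LipschitzWith.const a).add LipschitzWith.id).isBounded_image hb

end ChangeOfVariables

/-! ### Averaging quartic forms over the symmetries of a domain -/

section FixedPoint

open scoped InnerProductSpace

variable {H : Type*} [NormedAddCommGroup H] [InnerProductSpace ℝ H] [CompleteSpace H]

/-- The element of least norm in the closed convex hull of an invariant set is a fixed point. -/
theorem exists_fixedPoint_mem_closure_convexHull {s : Set H} (hs : s.Nonempty)
    (G : Set (H →ₗᵢ[ℝ] H)) (hG : ∀ g ∈ G, ∀ x ∈ s, g x ∈ s) :
    ∃ w ∈ closure (convexHull ℝ s), ∀ g ∈ G, g w = w := by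
  have hconv : Convex ℝ (closure (convexHull ℝ s)) := (convex_convexHull ℝ s).closure
  obtain ⟨v, hv, hmin⟩ := exists_norm_eq_iInf_of_complete_convex
    (hs.convexHull (𝕜 := ℝ)).closure isClosed_closure.isComplete hconv 0
  rw [norm_eq_iInf_iff_real_inner_le_zero hconv hv] at hmin
  refine ⟨v, hv, fun g hg => ?_⟩
  have hmaps : Set.MapsTo g (convexHull ℝ s) (convexHull ℝ s) := by
    have h1 : g.toLinearMap '' convexHull ℝ s = convexHull ℝ (g.toLinearMap '' s) :=
      g.toLinearMap.image_convexHull s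
    have h2 : g.toLinearMap '' s ⊆ s := by
      rintro _ ⟨x, hx, rfl⟩
      exact hG g hg x hx
    intro x hx
    exact convexHull_mono h2 (h1 ▸ Set.mem_image_of_mem _ hx)
  have hgv : g v ∈ closure (convexHull ℝ s) := hmaps.closure g.continuous hv
  -- The variational inequality for the point nearest 0 gives ‖v‖² ≤ ⟪v, g v⟫; with ‖g v‖ = ‖v‖ this
  -- forces g v = v.
  have h1 := hmin (g v) hgv
  rw [zero_sub, inner_neg_left, inner_sub_right, real_inner_self_eq_norm_sq] at h1
  have h2 := norm_sub_sq_real v (g v)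
  rw [g.norm_map] at h2
  have h3 : ‖v - g v‖ ^ 2 ≤ 0 := by linarith
  have h4 : ‖v - g v‖ = 0 := by nlinarith [norm_nonneg (v - g v)]
  exact (sub_eq_zero.mp (norm_eq_zero.mp h4)).symm

end FixedPoint

/-! ### Quartic forms as linear functionals on the fourth tensor power -/

section QuarticForms

open scoped InnerProductSpace TensorProduct

variable {E : Type*} [NormedAddCommGroup E] [InnerProductSpace ℝ E]

/-- The fourth tensor power of a Euclidean space. -/
def QuarticTensor (E : Type*) [NormedAddCommGroup E] [InnerProductSpace ℝ E] : Type _ :=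
  (E ⊗[ℝ] E) ⊗[ℝ] (E ⊗[ℝ] E)

noncomputable instance : NormedAddCommGroup (QuarticTensor E) :=
  inferInstanceAs (NormedAddCommGroup ((E ⊗[ℝ] E) ⊗[ℝ] (E ⊗[ℝ] E)))

noncomputable instance : InnerProductSpace ℝ (QuarticTensor E) :=
  inferInstanceAs (InnerProductSpace ℝ ((E ⊗[ℝ] E) ⊗[ℝ] (E ⊗[ℝ] E)))

instance [FiniteDimensional ℝ E] : FiniteDimensional ℝ (QuarticTensor E) :=
  inferInstanceAs (FiniteDimensional ℝ ((E ⊗[ℝ] E) ⊗[ℝ] (E ⊗[ℝ] E)))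

/-- Elementary tensors. -/
noncomputable def quarticTmul (a b c e : E) : QuarticTensor E :=
  (a ⊗ₜ[ℝ] b) ⊗ₜ[ℝ] (c ⊗ₜ[ℝ] e)

/-- The fourth tensor power of a vector. -/
noncomputable def fourthPower (x : E) : QuarticTensor E := quarticTmul x x x x

/-- The action of linear isometries on the fourth tensor power. -/
noncomputable def quarticMap (U : E ≃ₗᵢ[ℝ] E) : QuarticTensor E →ₗᵢ[ℝ] QuarticTensor E :=
  TensorProduct.mapIsometry (TensorProduct.mapIsometry U.toLinearIsometry U.toLinearIsometry)
    (TensorProduct.mapIsometry U.toLinearIsometry U.toLinearIsometry)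

theorem quarticMap_tmul (U : E ≃ₗᵢ[ℝ] E) (a b c e : E) :
    quarticMap U (quarticTmul a b c e) = quarticTmul (U a) (U b) (U c) (U e) := rfl

theorem quarticMap_quarticMap (U V : E ≃ₗᵢ[ℝ] E) (w : QuarticTensor E) :
    quarticMap V (quarticMap U w) = quarticMap (U.trans V) w := by
  have h : ∀ f g : E →ₗ[ℝ] E, ∀ w : (E ⊗[ℝ] E) ⊗[ℝ] (E ⊗[ℝ] E),
      TensorProduct.map (TensorProduct.map g g) (TensorProduct.map g g)
        (TensorProduct.map (TensorProduct.map f f) (TensorProduct.map f f) w) =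
      TensorProduct.map (TensorProduct.map (g ∘ₗ f) (g ∘ₗ f))
        (TensorProduct.map (g ∘ₗ f) (g ∘ₗ f)) w := by
    intro f g w
    simp only [TensorProduct.map_comp, LinearMap.comp_apply]
  exact h U.toLinearEquiv V.toLinearEquiv w

theorem inner_fourthPower_quarticMap (U : E ≃ₗᵢ[ℝ] E) (x : E) (w : QuarticTensor E) :
    ⟪fourthPower (U x), quarticMap U w⟫_ℝ = ⟪fourthPower x, w⟫_ℝ := by
  rw [fourthPower, ← quarticMap_tmul, LinearIsometry.inner_map_map, fourthPower]

theorem inner_quarticTmul (a b c e a' b' c' e' : E) :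
    ⟪quarticTmul a b c e, quarticTmul a' b' c' e'⟫_ℝ =
      ⟪a, a'⟫_ℝ * ⟪b, b'⟫_ℝ * (⟪c, c'⟫_ℝ * ⟪e, e'⟫_ℝ) := by
  refine (TensorProduct.inner_tmul (𝕜 := ℝ) (a ⊗ₜ[ℝ] b) (a' ⊗ₜ[ℝ] b') (c ⊗ₜ[ℝ] e)
    (c' ⊗ₜ[ℝ] e')).trans ?_
  rw [TensorProduct.inner_tmul, TensorProduct.inner_tmul]

theorem norm_fourthPower (x : E) : ‖fourthPower x‖ = ‖x‖ ^ 4 := by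
  have h : ‖fourthPower x‖ ^ 2 = (‖x‖ ^ 4) ^ 2 := by
    rw [← real_inner_self_eq_norm_sq, fourthPower, inner_quarticTmul, real_inner_self_eq_norm_sq]
    ring
  exact (sq_eq_sq₀ (norm_nonneg _) (by positivity)).mp h

theorem continuous_fourthPower : Continuous (fourthPower (E := E)) := by
  have h : Continuous fun x : E => (x ⊗ₜ[ℝ] x) ⊗ₜ[ℝ] (x ⊗ₜ[ℝ] x) := by fun_prop
  exact h

theorem fourthPower_eq_sum {ι : Type*} [Fintype ι] (b : OrthonormalBasis ι ℝ E) (x : E) :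
    fourthPower x = ∑ i, ∑ j, ∑ k, ∑ l,
      ((⟪b i, x⟫_ℝ * ⟪b j, x⟫_ℝ) * (⟪b k, x⟫_ℝ * ⟪b l, x⟫_ℝ)) •
        quarticTmul (b i) (b j) (b k) (b l) := by
  have h2 : x ⊗ₜ[ℝ] x = ∑ i, ∑ j, (⟪b i, x⟫_ℝ * ⟪b j, x⟫_ℝ) • (b i ⊗ₜ[ℝ] b j) := by
    conv_lhs => rw [← b.sum_repr' x]
    rw [TensorProduct.sum_tmul]
    simp only [TensorProduct.tmul_sum, TensorProduct.smul_tmul_smul]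
  have h4 : (x ⊗ₜ[ℝ] x) ⊗ₜ[ℝ] (x ⊗ₜ[ℝ] x) = ∑ i, ∑ j, ∑ k, ∑ l,
      ((⟪b i, x⟫_ℝ * ⟪b j, x⟫_ℝ) * (⟪b k, x⟫_ℝ * ⟪b l, x⟫_ℝ)) •
        ((b i ⊗ₜ[ℝ] b j) ⊗ₜ[ℝ] (b k ⊗ₜ[ℝ] b l)) := by
    rw [h2, TensorProduct.sum_tmul]
    refine Finset.sum_congr rfl fun i _ => ?_
    rw [TensorProduct.sum_tmul]
    simp only [TensorProduct.tmul_sum, TensorProduct.smul_tmul_smul]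
  exact h4

/-- A function of the form `∑ a_{ijkl} x_i x_j x_k x_l`. -/
def IsQuartic {ι : Type*} [Fintype ι] (b : OrthonormalBasis ι ℝ E) (q : E → ℝ) : Prop :=
  ∃ a : ι → ι → ι → ι → ℝ, ∀ x, q x = ∑ i, ∑ j, ∑ k, ∑ l,
    a i j k l * ((⟪b i, x⟫_ℝ * ⟪b j, x⟫_ℝ) * (⟪b k, x⟫_ℝ * ⟪b l, x⟫_ℝ))

theorem isQuartic_inner_fourthPower {ι : Type*} [Fintype ι] (b : OrthonormalBasis ι ℝ E)
    (w : QuarticTensor E) : IsQuartic b fun x => ⟪fourthPower x, w⟫_ℝ := by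
  refine ⟨fun i j k l => ⟪quarticTmul (b i) (b j) (b k) (b l), w⟫_ℝ, fun x => ?_⟩
  simp only [fourthPower_eq_sum b x, sum_inner, real_inner_smul_left]
  exact Finset.sum_congr rfl fun i _ => Finset.sum_congr rfl fun j _ =>
    Finset.sum_congr rfl fun k _ => Finset.sum_congr rfl fun l _ => mul_comm _ _

variable [FiniteDimensional ℝ E]

/-- Expand ‖B x‖² as the sum of the squares ⟪x, B* e_k⟫² and multiply it by itself; each product is
a pairing with an elementary tensor. -/
theorem exists_inner_fourthPower_eq_norm_pow (B : E →ₗ[ℝ] E) :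
    ∃ w : QuarticTensor E, ∀ x, ⟪fourthPower x, w⟫_ℝ = ‖B x‖ ^ 4 := by
  set e := stdOrthonormalBasis ℝ E with he
  refine ⟨∑ k, ∑ l, quarticTmul (B.adjoint (e k)) (B.adjoint (e k))
    (B.adjoint (e l)) (B.adjoint (e l)), fun x => ?_⟩
  have h2 : ‖B x‖ ^ 2 = ∑ k, ⟪x, B.adjoint (e k)⟫_ℝ * ⟪x, B.adjoint (e k)⟫_ℝ := by
    rw [← e.sum_sq_norm_inner_left (B x)]
    refine Finset.sum_congr rfl fun k _ => ?_
    rw [LinearMap.adjoint_inner_right, Real.norm_eq_abs, sq_abs, sq]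
  have h4 : ‖B x‖ ^ 4 = ‖B x‖ ^ 2 * ‖B x‖ ^ 2 := by ring
  rw [h4, h2, Finset.sum_mul_sum, inner_sum]
  refine Finset.sum_congr rfl fun k _ => ?_
  rw [inner_sum]
  exact Finset.sum_congr rfl fun l _ => (inner_quarticTmul _ _ _ _ _ _ _ _).symm

/-- An invariant quartic form in the closed convex hull of the orbit of `‖B x‖⁴`. -/
theorem exists_invariant_quartic [MeasurableSpace E] [BorelSpace E] {ι : Type*} [Fintype ι]
    (b : OrthonormalBasis ι ℝ E) (G : Set (E ≃ₗᵢ[ℝ] E))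
    (hrefl : LinearIsometryEquiv.refl ℝ E ∈ G) (htrans : ∀ U ∈ G, ∀ V ∈ G, U.trans V ∈ G)
    (hsymm : ∀ U ∈ G, U.symm ∈ G) (B : E →ₗ[ℝ] E) :
    ∃ q : E → ℝ, IsQuartic b q ∧ (∀ U ∈ G, ∀ x, q (U x) = q x) ∧
      ∀ (μ : Measure E) (k : E → ℝ), AEStronglyMeasurable k μ →
        Integrable (fun x => k x * ‖x‖ ^ 4) μ →
        ∀ C : ℝ, (∀ U ∈ G, C ≤ ∫ x, k x * ‖B (U x)‖ ^ 4 ∂μ) → C ≤ ∫ x, k x * q x ∂μ := by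
  obtain ⟨w₀, hw₀⟩ := exists_inner_fourthPower_eq_norm_pow B
  set s : Set (QuarticTensor E) := {w | ∃ U ∈ G, quarticMap U w₀ = w} with hs
  obtain ⟨w, hw, hfix⟩ := exists_fixedPoint_mem_closure_convexHull (s := s)
    ⟨_, _, hrefl, rfl⟩ (quarticMap '' G) (by
      rintro _ ⟨V, hV, rfl⟩ _ ⟨U, hU, rfl⟩
      exact ⟨_, htrans U hU V hV, (quarticMap_quarticMap U V w₀).symm⟩)
  refine ⟨_, isQuartic_inner_fourthPower b w, fun U hU x => ?_, fun μ k hkm hk C hC => ?_⟩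
  · conv_lhs => rw [← hfix _ ⟨U, hU, rfl⟩]
    rw [inner_fourthPower_quarticMap]
  have hint : ∀ v : QuarticTensor E, Integrable (fun x => k x * ⟪fourthPower x, v⟫_ℝ) μ := by
    intro v
    refine (hk.norm.mul_const ‖v‖).mono' (hkm.mul
      (continuous_fourthPower.inner continuous_const).aestronglyMeasurable) (ae_of_all _ fun x => ?_)
    rw [norm_mul, norm_mul, norm_pow, norm_norm, mul_assoc, ← norm_fourthPower]
    gcongr
    exact norm_inner_le_norm _ _
  set Λ : QuarticTensor E →ₗ[ℝ] ℝ :=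
    { toFun := fun v => ∫ x, k x * ⟪fourthPower x, v⟫_ℝ ∂μ
      map_add' := fun v v' => by
        rw [← integral_add (hint v) (hint v')]
        simp only [inner_add_right, mul_add]
      map_smul' := fun r v => by
        rw [RingHom.id_apply, smul_eq_mul, ← integral_const_mul]
        simp only [real_inner_smul_right, mul_left_comm] } with hΛ
  -- The bound cuts out a closed half-space, so it passes from the orbit to its closed convex hull.
  -- Acting by U on the tensor corresponds to U⁻¹ on the variable, hence the closure of G under
  -- inverses.
  have hsub : closure (convexHull ℝ s) ⊆ {v | C ≤ Λ v} := by
    refine closure_minimal (convexHull_min ?_ ?_) ?_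
    · rintro _ ⟨U, hU, rfl⟩
      have h1 : ∀ x, ⟪fourthPower x, quarticMap U w₀⟫_ℝ = ‖B (U.symm x)‖ ^ 4 := fun x => by
        rw [← hw₀, ← inner_fourthPower_quarticMap U (U.symm x), U.apply_symm_apply]
      change C ≤ ∫ x, k x * ⟪fourthPower x, quarticMap U w₀⟫_ℝ ∂μ
      simp_rw [h1]
      exact hC _ (hsymm U hU)
    · exact convex_halfSpace_ge Λ.isLinear C
    · exact isClosed_le continuous_const Λ.continuous_of_finiteDimensional
  exact hsub hw

end QuarticForms

/-! ### The frame hypothesis applied to averaged quartic forms -/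

section Frames

open scoped InnerProductSpace

variable {d : ℕ}

local notation "𝔼" => EuclideanSpace ℝ (Fin d)

theorem AdmitsFrames.exists_eq_of_isQuartic {Ω : Set 𝔼} (h : AdmitsFrames 2 Ω)
    {q : 𝔼 → ℝ} (hq : IsQuartic (EuclideanSpace.basisFun (Fin d) ℝ) q)
    (hinv : ∀ U ∈ linearSymmetries Ω, ∀ x, q (U x) = q x) :
    ∃ c : ℝ, ∀ x : 𝔼, q x = c * ‖x‖ ^ 4 := by
  obtain ⟨a, ha⟩ := hq
  set P : MvPolynomial (Fin d) ℝ := ∑ i, ∑ j, ∑ k, ∑ l, MvPolynomial.C (a i j k l) *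
    ((MvPolynomial.X i * MvPolynomial.X j) * (MvPolynomial.X k * MvPolynomial.X l)) with hP
  have hhom : P.IsHomogeneous (2 * 2) := by
    refine MvPolynomial.IsHomogeneous.sum _ _ _ fun i _ => MvPolynomial.IsHomogeneous.sum _ _ _
      fun j _ => MvPolynomial.IsHomogeneous.sum _ _ _ fun k _ =>
      MvPolynomial.IsHomogeneous.sum _ _ _ fun l _ => ?_
    have hX := MvPolynomial.isHomogeneous_X ℝ (σ := Fin d)
    exact (MvPolynomial.isHomogeneous_C (Fin d) (a i j k l)).mul
      (((hX i).mul (hX j)).mul ((hX k).mul (hX l)))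
  have heval : ∀ x : 𝔼, P.eval (fun i => x i) = q x := by
    intro x
    rw [ha x, hP]
    simp only [EuclideanSpace.basisFun_inner, map_sum, map_mul, MvPolynomial.eval_C,
      MvPolynomial.eval_X]
  obtain ⟨c, hc⟩ := h P hhom fun U hU x => by rw [heval, heval, hinv U hU]
  exact ⟨c, fun x => by rw [← heval, hc]⟩

theorem refl_mem_linearSymmetries (Ω : Set 𝔼) :
    LinearIsometryEquiv.refl ℝ 𝔼 ∈ linearSymmetries Ω := by
  simp [linearSymmetries]

theorem trans_mem_linearSymmetries {Ω : Set 𝔼} {U V : 𝔼 ≃ₗᵢ[ℝ] 𝔼}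
    (hU : U ∈ linearSymmetries Ω) (hV : V ∈ linearSymmetries Ω) :
    U.trans V ∈ linearSymmetries Ω := by
  have hU' : U '' Ω = Ω := hU
  have hV' : V '' Ω = Ω := hV
  change (U.trans V) '' Ω = Ω
  rw [LinearIsometryEquiv.coe_trans, Set.image_comp, hU', hV']

theorem symm_mem_linearSymmetries {Ω : Set 𝔼} {U : 𝔼 ≃ₗᵢ[ℝ] 𝔼}
    (hU : U ∈ linearSymmetries Ω) : U.symm ∈ linearSymmetries Ω := by
  have hU' : U '' Ω = Ω := hU
  change U.symm '' Ω = Ω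
  conv_lhs => rw [← hU', ← Set.image_comp]
  simp

/-- The average of `‖B x‖⁴` over the symmetries of a domain with `2`-frames is a multiple of
`‖x‖⁴`; any lower bound that holds for all rotated forms holds for the average. -/
theorem AdmitsFrames.exists_average {Ω : Set 𝔼} (h : AdmitsFrames 2 Ω) (B : 𝔼 →ₗ[ℝ] 𝔼) :
    ∃ c : ℝ, ∀ (μ : Measure 𝔼) (k : 𝔼 → ℝ), AEStronglyMeasurable k μ →
      Integrable (fun x => k x * ‖x‖ ^ 4) μ →
      ∀ C : ℝ, (∀ U ∈ linearSymmetries Ω, C ≤ ∫ x, k x * ‖B (U x)‖ ^ 4 ∂μ) →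
        C ≤ c * ∫ x, k x * ‖x‖ ^ 4 ∂μ := by
  obtain ⟨q, hq, hinv, hav⟩ := exists_invariant_quartic (EuclideanSpace.basisFun (Fin d) ℝ)
    (linearSymmetries Ω) (refl_mem_linearSymmetries Ω)
    (fun U hU V hV => trans_mem_linearSymmetries hU hV)
    (fun U hU => symm_mem_linearSymmetries hU) B
  obtain ⟨c, hc⟩ := h.exists_eq_of_isQuartic hq hinv
  refine ⟨c, fun μ k hkm hk C hC => (hav μ k hkm hk C hC).trans_eq ?_⟩
  rw [← integral_const_mul]
  refine integral_congr_ae (ae_of_all _ fun x => ?_)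
  simp only [hc]
  ring

end Frames

/-! ### Fourth moments of domains with frames -/

section Moments

open scoped InnerProductSpace

variable {d : ℕ}

local notation "𝔼" => EuclideanSpace ℝ (Fin d)

theorem integrableOn_of_isBounded_of_continuous {X : Type*} [MetricSpace X] [ProperSpace X]
    [MeasurableSpace X] [OpensMeasurableSpace X] {μ : Measure X} [IsFiniteMeasureOnCompacts μ]
    {F : Type*} [NormedAddCommGroup F] [SecondCountableTopologyEither X F]
    {Ω : Set X} (hb : Bornology.IsBounded Ω) {g : X → F} (hg : Continuous g) :
    IntegrableOn g Ω μ :=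
  (hg.continuousOn.integrableOn_compact hb.isCompact_closure).mono_set subset_closure

theorem setIntegral_comp_of_mem_linearSymmetries {Ω : Set 𝔼} {U : 𝔼 ≃ₗᵢ[ℝ] 𝔼}
    (hU : U ∈ linearSymmetries Ω) (g : 𝔼 → ℝ) : ∫ x in Ω, g (U x) = ∫ x in Ω, g x := by
  have h := (LinearIsometryEquiv.measurePreserving U).setIntegral_image_emb
    U.toHomeomorph.measurableEmbedding g Ω
  have hU' : U '' Ω = Ω := hU
  rw [← h, hU']

theorem setIntegral_norm_pow_pos (hd : 1 ≤ d) {Ω : Set 𝔼} (ho : IsOpen Ω) (hne : Ω.Nonempty)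
    (hb : Bornology.IsBounded Ω) {L : 𝔼 →ₗ[ℝ] 𝔼} (hL : Function.Injective L) :
    0 < ∫ x in Ω, ‖L x‖ ^ 4 := by
  have : Nonempty (Fin d) := ⟨⟨0, hd⟩⟩
  have hcont : Continuous fun x => ‖L x‖ ^ 4 := (L.continuous_of_finiteDimensional.norm).pow 4
  rw [setIntegral_pos_iff_support_of_nonneg_ae (ae_of_all _ fun x => by positivity)
    (integrableOn_of_isBounded_of_continuous hb hcont)]
  have hsupp : (Function.support fun x => ‖L x‖ ^ 4) ∩ Ω = Ω \ {0} := by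
    ext x
    simp only [Set.mem_inter_iff, Function.mem_support, Set.mem_sdiff, Set.mem_singleton_iff]
    rw [and_comm, pow_ne_zero_iff four_ne_zero, norm_ne_zero_iff, ne_eq,
      map_eq_zero_iff L hL]
  rw [hsupp, measure_sdiff_null (measure_singleton 0)]
  exact ho.measure_pos volume hne

/-- The fourth directional moments of a domain with `2`-frames do not depend on the direction. -/
theorem AdmitsFrames.exists_directional_moment {Ω : Set 𝔼} (h : AdmitsFrames 2 Ω)
    (hb : Bornology.IsBounded Ω) :
    ∃ c : ℝ, ∀ z : 𝔼, ∫ y in Ω, ⟪z, y⟫_ℝ ^ 4 = c * ‖z‖ ^ 4 := by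
  have h4 : ∀ z y : 𝔼, ⟪z, y⟫_ℝ ^ 4 = ⟪fourthPower z, fourthPower y⟫_ℝ := by
    intro z y
    rw [fourthPower, fourthPower, inner_quarticTmul]
    ring
  have hint : IntegrableOn (fun y : 𝔼 => fourthPower y) Ω :=
    integrableOn_of_isBounded_of_continuous hb continuous_fourthPower
  have hq : ∀ z : 𝔼, ∫ y in Ω, ⟪z, y⟫_ℝ ^ 4 =
      ⟪fourthPower z, ∫ y in Ω, fourthPower y⟫_ℝ := by
    intro z
    simp_rw [h4]
    exact integral_inner hint (fourthPower z)
  obtain ⟨c, hc⟩ := h.exists_eq_of_isQuartic (q := fun z => ∫ y in Ω, ⟪z, y⟫_ℝ ^ 4)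
    (by simp_rw [hq]; exact isQuartic_inner_fourthPower _ _) fun U hU x => by
      rw [← setIntegral_comp_of_mem_linearSymmetries hU]
      simp_rw [U.inner_map_map]
  exact ⟨c, hc⟩

theorem norm_pow_four_le_sum (y : 𝔼) :
    ‖y‖ ^ 4 ≤ d * ∑ i, ⟪EuclideanSpace.basisFun (Fin d) ℝ i, y⟫_ℝ ^ 4 := by
  have h1 := (EuclideanSpace.basisFun (Fin d) ℝ).sum_sq_norm_inner_right y
  have h2 := sq_sum_le_card_mul_sum_sq (s := Finset.univ)
    (f := fun i => ‖⟪EuclideanSpace.basisFun (Fin d) ℝ i, y⟫_ℝ‖ ^ 2)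
  rw [h1, Finset.card_univ, Fintype.card_fin] at h2
  calc ‖y‖ ^ 4 = (‖y‖ ^ 2) ^ 2 := by ring
    _ ≤ _ := h2
    _ = _ := by
      congr 1
      refine Finset.sum_congr rfl fun i _ => ?_
      rw [Real.norm_eq_abs, sq_abs]
      ring

/-- Transposition does not change the fourth moment of a linear image of a domain with
`2`-frames, up to the determinant. -/
theorem AdmitsFrames.setIntegral_adjoint (hd : 1 ≤ d) {Ω : Set 𝔼} (h : AdmitsFrames 2 Ω)
    (ho : IsOpen Ω) (hne : Ω.Nonempty) (hb : Bornology.IsBounded Ω) (L : 𝔼 →ₗ[ℝ] 𝔼) :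
    ∫ x in Ω, ‖L.adjoint x‖ ^ 4 = ∫ x in Ω, ‖L x‖ ^ 4 := by
  obtain ⟨c, hc⟩ := h.exists_directional_moment hb
  -- If c were zero, every directional moment would vanish, and so would ∫_Ω |x|⁴, which is bounded
  -- by the moments along the coordinate axes.
  have hcpos : c ≠ 0 := by
    rintro rfl
    have h1 := setIntegral_norm_pow_pos hd ho hne hb (L := LinearMap.id) Function.injective_id
    have h2 : ∫ x in Ω, ‖LinearMap.id (R := ℝ) x‖ ^ 4 ≤
        ∫ x in Ω, d * ∑ i, ⟪EuclideanSpace.basisFun (Fin d) ℝ i, x⟫_ℝ ^ 4 :=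
      integral_mono (integrableOn_of_isBounded_of_continuous hb (by fun_prop))
        (integrableOn_of_isBounded_of_continuous hb (by fun_prop)) norm_pow_four_le_sum
    rw [integral_const_mul, integral_finsetSum _ fun i _ =>
      integrableOn_of_isBounded_of_continuous hb (by fun_prop)] at h2
    simp only [hc, zero_mul, Finset.sum_const_zero, mul_zero] at h2
    linarith
  have hLc : Continuous L := L.continuous_of_finiteDimensional
  -- Integrating out y first gives c‖L x‖⁴, while integrating out x first gives c‖L* y‖⁴.
  have hswap : ∫ x in Ω, ∫ y in Ω, ⟪L x, y⟫_ℝ ^ 4 = ∫ y in Ω, ∫ x in Ω, ⟪L x, y⟫_ℝ ^ 4 := by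
    refine integral_integral_swap ?_
    rw [Measure.prod_restrict]
    refine integrableOn_of_isBounded_of_continuous (hb.prod hb) ?_
    exact ((hLc.comp continuous_fst).inner continuous_snd).pow 4
  have h1 : ∀ x y, ⟪L x, y⟫_ℝ = ⟪L.adjoint y, x⟫_ℝ := fun x y => by
    rw [LinearMap.adjoint_inner_left, real_inner_comm]
  simp_rw [hc, h1, hc, integral_const_mul] at hswap
  exact (mul_left_cancel₀ hcpos hswap).symm

/-- Hadamard's inequality bounds the product of the column lengths below by 1; AM-GM, in the form
log t + 1 ≤ t, passes from product to sum. -/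
theorem card_le_sum_norm_pow_of_abs_det {L : 𝔼 →ₗ[ℝ] 𝔼} (hL : |LinearMap.det L| = 1) :
    (d : ℝ) ≤ ∑ i, ‖L (EuclideanSpace.basisFun (Fin d) ℝ i)‖ ^ 4 := by
  set e := EuclideanSpace.basisFun (Fin d) ℝ with he
  have : Fact (Module.finrank ℝ 𝔼 = d) := ⟨by simp⟩
  have hhad : 1 ≤ ∏ i, ‖L (e i)‖ := by
    have h1 := (e.toBasis.orientation).abs_volumeForm_apply_le fun i => L (e i)
    rw [Orientation.volumeForm_robust' _ e] at h1
    have h2 : e.toBasis.det (fun i => L (e i)) = LinearMap.det L := by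
      have h3 := e.toBasis.det_comp L e
      rw [← e.coe_toBasis, Module.Basis.det_self, mul_one, e.coe_toBasis] at h3
      exact h3
    rwa [h2, hL] at h1
  have hpos : ∀ i, 0 < ‖L (e i)‖ := by
    intro i
    refine lt_of_le_of_ne (norm_nonneg _) fun h0 => ?_
    rw [Finset.prod_eq_zero (Finset.mem_univ i) h0.symm] at hhad
    linarith
  have hlog : 0 ≤ ∑ i, Real.log (‖L (e i)‖ ^ 4) := by
    rw [← Real.log_prod fun i _ => (pow_pos (hpos i) 4).ne', Finset.prod_pow]
    exact Real.log_nonneg (one_le_pow₀ hhad)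
  have hle : ∀ i, Real.log (‖L (e i)‖ ^ 4) + 1 ≤ ‖L (e i)‖ ^ 4 := fun i => by
    have := Real.log_le_sub_one_of_pos (pow_pos (hpos i) 4)
    linarith
  have := Finset.sum_le_sum fun i (_ : i ∈ Finset.univ) => hle i
  rw [Finset.sum_add_distrib] at this
  simp only [Finset.sum_const, Finset.card_univ, Fintype.card_fin, nsmul_eq_mul, mul_one] at this
  linarith

theorem abs_det_linearIsometryEquiv (U : 𝔼 ≃ₗᵢ[ℝ] 𝔼) :
    |LinearMap.det (U.toLinearEquiv : 𝔼 →ₗ[ℝ] 𝔼)| = 1 := by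
  have := LinearIsometry.normDet_eq_one U.toLinearIsometry
  rw [LinearMap.normDet_eq_abs_det] at this
  exact this

/-- The averaging principle with its constant identified. -/
theorem AdmitsFrames.average_le (hd : 1 ≤ d) {Ω : Set 𝔼} (h : AdmitsFrames 2 Ω)
    (hb : Bornology.IsBounded Ω) (B : 𝔼 →ₗ[ℝ] 𝔼) :
    ∃ c : ℝ, c * (∫ x in Ω, ‖x‖ ^ 4) = (∫ x in Ω, ‖B x‖ ^ 4) ∧
      (|LinearMap.det B| = 1 → 1 ≤ c) ∧
      ∀ (μ : Measure 𝔼) (k : 𝔼 → ℝ), AEStronglyMeasurable k μ →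
      Integrable (fun x => k x * ‖x‖ ^ 4) μ →
      ∀ C : ℝ, (∀ U ∈ linearSymmetries Ω, C ≤ ∫ x, k x * ‖B (U x)‖ ^ 4 ∂μ) →
        C ≤ c * ∫ x, k x * ‖x‖ ^ 4 ∂μ := by
  obtain ⟨c, hc⟩ := h.exists_average B
  have hint : IntegrableOn (fun x : 𝔼 => ‖x‖ ^ 4) Ω :=
    integrableOn_of_isBounded_of_continuous hb (by fun_prop)
  refine ⟨c, le_antisymm ?_ ?_, fun hdet => ?_, hc⟩
  -- All rotated forms have the same integral over the invariant set Ω, so the one-sided principle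
  -- with weights -1 and 1 pins c down exactly.
  · have h1 := hc (volume.restrict Ω) (fun _ => -1) aestronglyMeasurable_const
      (hint.const_mul (-1)) (-∫ x in Ω, ‖B x‖ ^ 4) fun U hU => by
        rw [integral_const_mul, setIntegral_comp_of_mem_linearSymmetries hU fun x => ‖B x‖ ^ 4]
        linarith
    rw [integral_const_mul] at h1
    linarith
  · have h1 := hc (volume.restrict Ω) (fun _ => 1) aestronglyMeasurable_const
      (hint.const_mul 1) (∫ x in Ω, ‖B x‖ ^ 4) fun U hU => by
        rw [integral_const_mul, setIntegral_comp_of_mem_linearSymmetries hU fun x => ‖B x‖ ^ 4]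
        linarith
    rw [integral_const_mul] at h1
    linarith
  · have hd' : (0 : ℝ) < d := by exact_mod_cast hd
    set e := EuclideanSpace.basisFun (Fin d) ℝ with he
    have hsum : ∀ g : 𝔼 → ℝ, ∫ x, g x ∂(∑ i, Measure.dirac (e i)) = ∑ i, g (e i) := by
      intro g
      rw [integral_finsetSum_measure fun i _ => integrable_dirac (by simp)]
      simp_rw [integral_dirac]
    -- Testing against point masses at the basis vectors turns the bound for unimodular matrices
    -- into d ≤ c d.
    have h1 := hc (∑ i, Measure.dirac (e i)) (fun _ => 1) aestronglyMeasurable_const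
      (by
        rw [integrable_finsetSum_measure]
        exact fun i _ => integrable_dirac (by simp)) d fun U hU => by
          rw [hsum]
          simp_rw [one_mul]
          refine card_le_sum_norm_pow_of_abs_det (L := B ∘ₗ (U.toLinearEquiv : 𝔼 →ₗ[ℝ] 𝔼)) ?_
          rw [LinearMap.det_comp, abs_mul, hdet, abs_det_linearIsometryEquiv, mul_one]
    rw [hsum] at h1
    have h2 : ∀ i, ‖e i‖ = 1 := fun i => e.norm_eq_one i
    simp only [h2, one_pow, mul_one, Finset.sum_const, Finset.card_univ, Fintype.card_fin,
      nsmul_eq_mul] at h1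
    nlinarith

end Moments

/-! ### The eigenvalue sum of linear images of a domain with frames -/

section LinearImages

open scoped SchwartzMap InnerProductSpace Real

variable {d : ℕ}

local notation "𝔼" => EuclideanSpace ℝ (Fin d)

theorem volume_real_image_linearEquiv (L : 𝔼 ≃ₗ[ℝ] 𝔼) (Ω : Set 𝔼) :
    volume.real (L '' Ω) = |LinearMap.det (L : 𝔼 →ₗ[ℝ] 𝔼)| * volume.real Ω := by
  have h := Measure.addHaar_image_linearMap (volume : Measure 𝔼) (L : 𝔼 →ₗ[ℝ] 𝔼) Ω
  rw [Measure.real, Measure.real, ← ENNReal.toReal_ofReal (abs_nonneg (LinearMap.det _)),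
    ← ENNReal.toReal_mul, ← h]
  rfl

theorem setIntegral_image_linearEquiv (L : 𝔼 ≃ₗ[ℝ] 𝔼) {Ω : Set 𝔼} (ho : IsOpen Ω) (g : 𝔼 → ℝ) :
    ∫ x in L '' Ω, g x = |LinearMap.det (L : 𝔼 →ₗ[ℝ] 𝔼)| * ∫ x in Ω, g (L x) := by
  have hdet : LinearMap.det (L : 𝔼 →ₗ[ℝ] 𝔼) ≠ 0 := (LinearEquiv.isUnit_det' L).ne_zero
  have hopen : IsOpen (L '' Ω) := L.toContinuousLinearEquiv.toHomeomorph.isOpenMap Ω ho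
  rw [← integral_indicator hopen.measurableSet, ← integral_indicator ho.measurableSet]
  have h := integral_comp_linearMap_of_det_ne_zero hdet ((L '' Ω).indicator g)
  have h2 : ∀ x, (L '' Ω).indicator g ((L : 𝔼 →ₗ[ℝ] 𝔼) x) = Ω.indicator (fun y => g (L y)) x := by
    intro x
    by_cases hx : x ∈ Ω
    · rw [Set.indicator_of_mem hx, LinearEquiv.coe_coe,
        Set.indicator_of_mem (Set.mem_image_of_mem _ hx)]
    · rw [Set.indicator_of_notMem hx, LinearEquiv.coe_coe, Set.indicator_of_notMem]
      rwa [L.injective.mem_set_image]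
  simp_rw [h2] at h
  rw [h, smul_eq_mul, mul_inv_cancel_left₀ (abs_pos.mpr hdet).ne']

/-- The singular weight |ξ|⁻² is harmless in every dimension, because ‖L ξ‖⁴ is of order |ξ|⁴. -/
theorem integrable_weight_mul_spectral (a b : ℝ) (f : 𝓢(𝔼, ℝ)) (L : 𝔼 →ₗ[ℝ] 𝔼) :
    Integrable fun ξ : 𝔼 => (a + b * (‖ξ‖ ^ 2)⁻¹) * ‖f.spectralTransform ξ‖ ^ 2 * ‖L ξ‖ ^ 4 := by
  obtain ⟨M, hM0, hM⟩ := L.toContinuousLinearMap.bound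
  have h4 := (f.integrable_norm_pow_mul_spectral 4).const_mul (|a| * M ^ 4)
  have h2 := (f.integrable_norm_pow_mul_spectral 2).const_mul (|b| * M ^ 4)
  have hLc : Continuous L := L.continuous_of_finiteDimensional
  refine (h4.add h2).mono' ?_ (ae_of_all _ fun ξ => ?_)
  · refine Measurable.aestronglyMeasurable ?_
    have h1 : Measurable fun ξ : 𝔼 => ‖f.spectralTransform ξ‖ :=
      (f.spectralTransform.continuous.norm).measurable
    have h3 : Measurable fun ξ : 𝔼 => ‖L ξ‖ := hLc.norm.measurable
    fun_prop
  · have hL : ‖L ξ‖ ^ 4 ≤ M ^ 4 * ‖ξ‖ ^ 4 := by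
      rw [← mul_pow]
      exact pow_le_pow_left₀ (norm_nonneg _) (hM ξ) 4
    have h5 : |a + b * (‖ξ‖ ^ 2)⁻¹| * ‖ξ‖ ^ 4 ≤ |a| * ‖ξ‖ ^ 4 + |b| * ‖ξ‖ ^ 2 := by
      rcases eq_or_ne ξ 0 with rfl | hξ
      · simp
      · have hpos : 0 < ‖ξ‖ := norm_pos_iff.mpr hξ
        calc |a + b * (‖ξ‖ ^ 2)⁻¹| * ‖ξ‖ ^ 4
            ≤ (|a| + |b| * (‖ξ‖ ^ 2)⁻¹) * ‖ξ‖ ^ 4 := by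
              gcongr
              refine (abs_add_le _ _).trans_eq ?_
              rw [abs_mul, abs_of_nonneg (by positivity : 0 ≤ (‖ξ‖ ^ 2)⁻¹)]
          _ = _ := by field_simp
    rw [norm_mul, norm_mul, Real.norm_eq_abs, norm_pow, norm_pow, norm_norm, norm_norm,
      Pi.add_apply]
    calc |a + b * (‖ξ‖ ^ 2)⁻¹| * ‖f.spectralTransform ξ‖ ^ 2 * ‖L ξ‖ ^ 4
        ≤ |a + b * (‖ξ‖ ^ 2)⁻¹| * ‖f.spectralTransform ξ‖ ^ 2 * (M ^ 4 * ‖ξ‖ ^ 4) := by gcongr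
      _ = (|a + b * (‖ξ‖ ^ 2)⁻¹| * ‖ξ‖ ^ 4) * (M ^ 4 * ‖f.spectralTransform ξ‖ ^ 2) := by ring
      _ ≤ (|a| * ‖ξ‖ ^ 4 + |b| * ‖ξ‖ ^ 2) * (M ^ 4 * ‖f.spectralTransform ξ‖ ^ 2) := by gcongr
      _ = _ := by ring

/-- This is 2|ξ|²|Lξ|² ≤ |ξ|⁴ + |Lξ|⁴ divided by 2|ξ|². It trades the quadratic form of the tension
term for a quartic one, to which the averaging principle applies, and it is sharp when |Lξ| = |ξ|.
-/
theorem sq_le_half_add {ξ : 𝔼} (L : 𝔼 →ₗ[ℝ] 𝔼) :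
    ‖L ξ‖ ^ 2 ≤ 2⁻¹ * (‖ξ‖ ^ 2)⁻¹ * ‖L ξ‖ ^ 4 + 2⁻¹ * ‖ξ‖ ^ 2 := by
  rcases eq_or_ne ξ 0 with rfl | hξ
  · simp
  · have hpos : 0 < ‖ξ‖ ^ 2 := by positivity
    have h : ‖L ξ‖ ^ 2 = 2⁻¹ * (‖ξ‖ ^ 2)⁻¹ * (2 * ‖ξ‖ ^ 2 * ‖L ξ‖ ^ 2) := by field_simp
    have h2 : 2⁻¹ * ‖ξ‖ ^ 2 = 2⁻¹ * (‖ξ‖ ^ 2)⁻¹ * (‖ξ‖ ^ 2) ^ 2 := by field_simp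
    rw [h2, ← mul_add]
    conv_lhs => rw [h]
    refine mul_le_mul_of_nonneg_left ?_ (by positivity)
    nlinarith [sq_nonneg (‖ξ‖ ^ 2 - ‖L ξ‖ ^ 2)]

theorem plateEnergy_eq_moments (τ : ℝ) (f : 𝓢(𝔼, ℝ)) :
    plateEnergy τ f = (2 * π) ^ 4 * (∫ ξ, ‖ξ‖ ^ 4 * ‖f.spectralTransform ξ‖ ^ 2) +
      τ * (2 * π) ^ 2 * ∫ ξ, ‖ξ‖ ^ 2 * ‖f.spectralTransform ξ‖ ^ 2 := by
  rw [plateEnergy_eq_spectral, ← integral_const_mul, ← integral_const_mul,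
    ← integral_add ((f.integrable_norm_pow_mul_spectral 4).const_mul _)
      ((f.integrable_norm_pow_mul_spectral 2).const_mul _)]
  refine integral_congr_ae (ae_of_all _ fun ξ => ?_)
  simp only [norm_smul, Real.norm_of_nonneg (by positivity : (0 : ℝ) ≤ 2 * π)]
  ring

theorem integral_energy_density_le {τ : ℝ} (hτ : 0 ≤ τ) (f : 𝓢(𝔼, ℝ)) (L : 𝔼 →ₗ[ℝ] 𝔼) :
    ∫ ξ, (‖(2 * π) • L ξ‖ ^ 4 + τ * ‖(2 * π) • L ξ‖ ^ 2) * ‖f.spectralTransform ξ‖ ^ 2 ≤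
      (∫ ξ, ((2 * π) ^ 4 + τ * (2 * π) ^ 2 * 2⁻¹ * (‖ξ‖ ^ 2)⁻¹) *
        ‖f.spectralTransform ξ‖ ^ 2 * ‖L ξ‖ ^ 4) +
      τ * (2 * π) ^ 2 * 2⁻¹ * ∫ ξ, ‖ξ‖ ^ 2 * ‖f.spectralTransform ξ‖ ^ 2 := by
  have hint := integrable_weight_mul_spectral ((2 * π) ^ 4) (τ * (2 * π) ^ 2 * 2⁻¹) f L
  have hint2 := (f.integrable_norm_pow_mul_spectral 2).const_mul (τ * (2 * π) ^ 2 * 2⁻¹)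
  rw [← integral_const_mul, ← integral_add hint hint2]
  refine integral_mono_of_nonneg (ae_of_all _ fun ξ => by positivity) (hint.add hint2)
    (ae_of_all _ fun ξ => ?_)
  simp only [norm_smul, Real.norm_of_nonneg (by positivity : (0 : ℝ) ≤ 2 * π)]
  have h := mul_le_mul_of_nonneg_left (sq_le_half_add (ξ := ξ) L)
    (by positivity : 0 ≤ τ * (2 * π) ^ 2 * ‖f.spectralTransform ξ‖ ^ 2)
  linarith

theorem adjoint_symm_trans (S : 𝔼 ≃ₗ[ℝ] 𝔼) (U : 𝔼 ≃ₗᵢ[ℝ] 𝔼) (ξ : 𝔼) :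
    ((U.toLinearEquiv.trans S).symm : 𝔼 →ₗ[ℝ] 𝔼).adjoint ξ =
      (S.symm : 𝔼 →ₗ[ℝ] 𝔼).adjoint (U ξ) := by
  refine ext_inner_right ℝ fun y => ?_
  rw [LinearMap.adjoint_inner_left, LinearMap.adjoint_inner_left, ← U.symm.inner_map_map (U ξ),
    U.symm_apply_apply]
  rfl

theorem AdmissibleTension.nonneg {τ : ℝ} {S : 𝔼 ≃ₗ[ℝ] 𝔼} (h : AdmissibleTension τ S) : 0 ≤ τ := by
  rcases h with rfl | ⟨-, h⟩
  exacts [le_rfl, h.le]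

/-- Averaging the transplanted test functions over the symmetries of the domain. -/
theorem AdmitsFrames.plateEigenvalueSum_image_mul_le (hd : 1 ≤ d) {Ω : Set 𝔼}
    (hΩ : AdmitsFrames 2 Ω) (ho : IsOpen Ω) (hne : Ω.Nonempty) (hb : Bornology.IsBounded Ω)
    {τ : ℝ} {S : 𝔼 ≃ₗ[ℝ] 𝔼} (hS : AdmissibleTension τ S) {n : ℕ} {f : Fin n → 𝓢(𝔼, ℝ)}
    (hf : ∀ j, f j ∈ testSchwartz Ω) (horth : IsL2Orthonormal f) :
    plateEigenvalueSum τ n (S '' Ω) * (∫ x in Ω, ‖x‖ ^ 4) ≤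
      (∫ x in Ω, ‖S.symm x‖ ^ 4) * ∑ j, plateEnergy τ (f j) := by
  set B : 𝔼 →ₗ[ℝ] 𝔼 := (S.symm : 𝔼 →ₗ[ℝ] 𝔼).adjoint with hB
  obtain ⟨c, hcI, hc1, hc⟩ := hΩ.average_le hd hb B
  have hI : ∫ x in Ω, ‖B x‖ ^ 4 = ∫ x in Ω, ‖S.symm x‖ ^ 4 :=
    hΩ.setIntegral_adjoint hd ho hne hb (S.symm : 𝔼 →ₗ[ℝ] 𝔼)
  have hτ := hS.nonneg
  set a := (2 * π) ^ 4 with ha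
  set b := τ * (2 * π) ^ 2 * 2⁻¹ with hb'
  set M4 := ∑ j, ∫ ξ, ‖ξ‖ ^ 4 * ‖(f j).spectralTransform ξ‖ ^ 2 with hM4
  set M2 := ∑ j, ∫ ξ, ‖ξ‖ ^ 2 * ‖(f j).spectralTransform ξ‖ ^ 2 with hM2
  have hM2nn : 0 ≤ M2 := Finset.sum_nonneg fun j _ => integral_nonneg fun ξ => by positivity
  have hE : ∑ j, plateEnergy τ (f j) = a * M4 + 2 * b * M2 := by
    simp_rw [plateEnergy_eq_moments, Finset.sum_add_distrib, ← Finset.mul_sum]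
    rw [hb']
    ring
  -- Spectral density of the family, weighted so that one quartic average handles the bending term
  -- (a) and half of the tension term (b) together. The other half, b M2, does not depend on S or U.
  set k : 𝔼 → ℝ := fun ξ => ∑ j, (a + b * (‖ξ‖ ^ 2)⁻¹) * ‖(f j).spectralTransform ξ‖ ^ 2 with hk
  have hkL : ∀ L : 𝔼 →ₗ[ℝ] 𝔼, Integrable (fun ξ => k ξ * ‖L ξ‖ ^ 4) ∧ ∫ ξ, k ξ * ‖L ξ‖ ^ 4 =
      ∑ j, ∫ ξ, (a + b * (‖ξ‖ ^ 2)⁻¹) * ‖(f j).spectralTransform ξ‖ ^ 2 * ‖L ξ‖ ^ 4 := by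
    intro L
    simp_rw [hk, Finset.sum_mul]
    exact ⟨integrable_finsetSum _ fun j _ => integrable_weight_mul_spectral a b (f j) L,
      integral_finsetSum _ fun j _ => integrable_weight_mul_spectral a b (f j) L⟩
  have hkmeas : AEStronglyMeasurable k := by
    refine Measurable.aestronglyMeasurable ?_
    refine Finset.measurable_sum _ fun j _ => ?_
    have h1 : Measurable fun ξ : 𝔼 => ‖(f j).spectralTransform ξ‖ :=
      ((f j).spectralTransform.continuous.norm).measurable
    fun_prop
  have hkid : ∫ ξ, k ξ * ‖ξ‖ ^ 4 = a * M4 + b * M2 := by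
    have h := (hkL LinearMap.id).2
    simp only [LinearMap.id_apply] at h
    rw [h, hM4, hM2, Finset.mul_sum, Finset.mul_sum, ← Finset.sum_add_distrib]
    refine Finset.sum_congr rfl fun j _ => ?_
    rw [← integral_const_mul, ← integral_const_mul,
      ← integral_add (((f j).integrable_norm_pow_mul_spectral 4).const_mul _)
      (((f j).integrable_norm_pow_mul_spectral 2).const_mul _)]
    refine integral_congr_ae (ae_of_all _ fun ξ => ?_)
    simp only
    rcases eq_or_ne ξ 0 with rfl | hξ
    · simp
    · have : ‖ξ‖ ≠ 0 := norm_ne_zero_iff.mpr hξ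
      field_simp
  have key : plateEigenvalueSum τ n (S '' Ω) - b * M2 ≤ c * ∫ ξ, k ξ * ‖ξ‖ ^ 4 := by
    refine hc volume k hkmeas (hkL LinearMap.id).1 _ fun U hU => ?_
    have h1 := plateEigenvalueSum_preimage_le hd τ
      (U.toLinearEquiv.trans S).symm.toContinuousLinearEquiv ho hne hb hf horth
    -- Composing with a symmetry changes the transplanted functions but not the domain.
    have himg : (U.toLinearEquiv.trans S).symm.toContinuousLinearEquiv ⁻¹' Ω = S '' Ω := by
      have hU' : U '' Ω = Ω := hU
      conv_rhs => rw [← hU', ← Set.image_comp]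
      exact ((U.toLinearEquiv.trans S).toEquiv.image_eq_preimage_symm Ω).symm
    rw [himg] at h1
    have h2 : ∑ j, ∫ ξ, (‖(2 * π) • ((U.toLinearEquiv.trans S).symm : 𝔼 →ₗ[ℝ] 𝔼).adjoint ξ‖ ^ 4 +
        τ * ‖(2 * π) • ((U.toLinearEquiv.trans S).symm : 𝔼 →ₗ[ℝ] 𝔼).adjoint ξ‖ ^ 2) *
        ‖(f j).spectralTransform ξ‖ ^ 2 ≤ (∫ ξ, k ξ * ‖B (U ξ)‖ ^ 4) + b * M2 := by
      have h3 := (hkL (B ∘ₗ (U.toLinearEquiv : 𝔼 →ₗ[ℝ] 𝔼))).2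
      simp only [LinearMap.comp_apply] at h3
      have h4 : ∫ ξ, k ξ * ‖B (U ξ)‖ ^ 4 =
          ∑ j, ∫ ξ, (a + b * (‖ξ‖ ^ 2)⁻¹) * ‖(f j).spectralTransform ξ‖ ^ 2 * ‖B (U ξ)‖ ^ 4 := h3
      rw [h4, hM2, Finset.mul_sum, ← Finset.sum_add_distrib]
      refine Finset.sum_le_sum fun j _ => ?_
      simp_rw [adjoint_symm_trans]
      exact integral_energy_density_le hτ (f j) (B ∘ₗ (U.toLinearEquiv : 𝔼 →ₗ[ℝ] 𝔼))
    have h5 := h1.trans h2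
    linarith
  rw [hkid] at key
  -- The half of the tension term that was not averaged must also be dominated: b is zero if τ = 0,
  -- and c ≥ 1 if |det S| = 1. This is where the admissibility dichotomy enters.
  have hbc : b * M2 ≤ c * (b * M2) := by
    rcases hS with rfl | ⟨hdet, -⟩
    · simp [hb']
    · refine le_mul_of_one_le_left (by positivity) (hc1 ?_)
      rw [hB, LinearMap.det_adjoint_real]
      have h6 := LinearEquiv.det_symm_mul_det S
      have h7 : |LinearMap.det (S.symm : 𝔼 →ₗ[ℝ] 𝔼)| * |LinearMap.det (S : 𝔼 →ₗ[ℝ] 𝔼)| = 1 := by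
        rw [← abs_mul, h6, abs_one]
      rwa [hdet, mul_one] at h7
  have hI0 : 0 ≤ ∫ x in Ω, ‖x‖ ^ 4 := integral_nonneg fun x => by positivity
  rw [← hI, ← hcI, hE]
  have h8 : plateEigenvalueSum τ n (S '' Ω) ≤ c * (a * M4 + 2 * b * M2) := by linarith
  calc _ ≤ (c * (a * M4 + 2 * b * M2)) * ∫ x in Ω, ‖x‖ ^ 4 := by gcongr
    _ = _ := by ring

end LinearImages

/-! ### Maximality among linear images -/

section Maximality

open scoped SchwartzMap InnerProductSpace Real

variable {d : ℕ}

local notation "𝔼" => EuclideanSpace ℝ (Fin d)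

theorem isOpen_image_linearEquiv (L : 𝔼 ≃ₗ[ℝ] 𝔼) {Ω : Set 𝔼} (ho : IsOpen Ω) : IsOpen (L '' Ω) :=
  L.toContinuousLinearEquiv.toHomeomorph.isOpenMap Ω ho

theorem isBounded_image_linearEquiv (L : 𝔼 ≃ₗ[ℝ] 𝔼) {Ω : Set 𝔼} (hb : Bornology.IsBounded Ω) :
    Bornology.IsBounded (L '' Ω) :=
  L.toContinuousLinearEquiv.lipschitz.isBounded_image hb

theorem fourthMoment_zero_image (L : 𝔼 ≃ₗ[ℝ] 𝔼) {Ω : Set 𝔼} (ho : IsOpen Ω) :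
    fourthMoment 0 (L '' Ω) = |LinearMap.det (L : 𝔼 →ₗ[ℝ] 𝔼)| * ∫ x in Ω, ‖L x‖ ^ 4 := by
  rw [fourthMoment, setIntegral_image_linearEquiv L ho]
  simp_rw [sub_zero]

theorem abs_det_symm (L : 𝔼 ≃ₗ[ℝ] 𝔼) : |LinearMap.det (L.symm : 𝔼 →ₗ[ℝ] 𝔼)| =
    |LinearMap.det (L : 𝔼 →ₗ[ℝ] 𝔼)|⁻¹ := by
  rw [LinearEquiv.det_coe_symm, abs_inv]

theorem abs_det_linearEquiv_pos (L : 𝔼 ≃ₗ[ℝ] 𝔼) : 0 < |LinearMap.det (L : 𝔼 →ₗ[ℝ] 𝔼)| :=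
  abs_pos.mpr (LinearEquiv.isUnit_det' L).ne_zero

/-- The volume powers are chosen so that all determinants cancel, leaving the ratio of the
eigenvalue sum to ∫_Ω ‖T⁻¹x‖⁴ as the only dependence on T. -/
theorem plateProduct_eq (τ : ℝ) (n : ℕ) {Ω : Set 𝔼} (ho : IsOpen Ω) (T : 𝔼 ≃ₗ[ℝ] 𝔼) :
    plateProduct τ n Ω T = plateEigenvalueSum τ n (T '' Ω) / (∫ x in Ω, ‖T.symm x‖ ^ 4) *
      (volume.real Ω ^ ((4 : ℝ) / d) * volume.real Ω ^ (1 + (4 : ℝ) / d)) := by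
  rw [plateProduct, volume_real_image_linearEquiv, volume_real_image_linearEquiv,
    fourthMoment_zero_image T.symm ho, abs_det_symm]
  have hD := abs_det_linearEquiv_pos T
  set D := |LinearMap.det (T : 𝔼 →ₗ[ℝ] 𝔼)|
  have h1 : D ^ ((4 : ℝ) / d) * D⁻¹ ^ (1 + (4 : ℝ) / d) = D⁻¹ := by
    rw [Real.inv_rpow hD.le, Real.rpow_add hD, Real.rpow_one]
    have := (Real.rpow_pos_of_pos hD ((4 : ℝ) / d)).ne'
    field_simp
  rw [Real.mul_rpow hD.le measureReal_nonneg, Real.mul_rpow (by positivity) measureReal_nonneg]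
  calc _ = plateEigenvalueSum τ n (T '' Ω) *
      (volume.real Ω ^ ((4 : ℝ) / d) * volume.real Ω ^ (1 + (4 : ℝ) / d)) *
      ((D ^ ((4 : ℝ) / d) * D⁻¹ ^ (1 + (4 : ℝ) / d)) / (D⁻¹ * ∫ x in Ω, ‖T.symm x‖ ^ 4)) := by ring
    _ = _ := by
      rw [h1, div_mul_eq_div_div, div_self (by positivity)]
      ring

theorem exists_pos_of_isMultipleOfOrthogonal (hd : 1 ≤ d) {T : 𝔼 ≃ₗ[ℝ] 𝔼}
    (hT : IsMultipleOfOrthogonal T) : ∃ c : ℝ, 0 < c ∧ (∀ x, ‖T x‖ = c * ‖x‖) ∧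
      ∀ x, ‖(T : 𝔼 →ₗ[ℝ] 𝔼).adjoint x‖ = c * ‖x‖ := by
  have : Nonempty (Fin d) := ⟨⟨0, hd⟩⟩
  obtain ⟨c, U, hU⟩ := hT
  have hc : c ≠ 0 := by
    rintro rfl
    obtain ⟨x, hx⟩ := exists_ne (0 : 𝔼)
    apply hx
    apply T.injective
    rw [hU, zero_smul, map_zero]
  refine ⟨|c|, abs_pos.mpr hc, fun x => ?_, fun x => ?_⟩
  · rw [hU, norm_smul, U.norm_map, Real.norm_eq_abs]
  · have h : (T : 𝔼 →ₗ[ℝ] 𝔼).adjoint x = c • U.symm x := by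
      refine ext_inner_right ℝ fun y => ?_
      rw [LinearMap.adjoint_inner_left, LinearEquiv.coe_coe, hU, inner_smul_left, inner_smul_right,
        ← U.symm.inner_map_map x, U.symm_apply_apply]
      rfl
    rw [h, norm_smul, U.symm.norm_map, Real.norm_eq_abs]

/-- The eigenvalue sum scales under similarities. -/
theorem plateEigenvalueSum_le_of_isMultipleOfOrthogonal (hd : 1 ≤ d) {Ω : Set 𝔼}
    (ho : IsOpen Ω) (hne : Ω.Nonempty) (hb : Bornology.IsBounded Ω) {τ : ℝ} {T : 𝔼 ≃ₗ[ℝ] 𝔼}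
    (hT : AdmissibleTension τ T) {c : ℝ} (hc : 0 < c) (hTn : ∀ x, ‖T x‖ = c * ‖x‖)
    (hTa : ∀ x, ‖(T : 𝔼 →ₗ[ℝ] 𝔼).adjoint x‖ = c * ‖x‖) (n : ℕ) :
    plateEigenvalueSum τ n Ω ≤ c ^ 4 * plateEigenvalueSum τ n (T '' Ω) := by
  -- Bending scales by c⁴ and tension by c²; these agree because τ > 0 comes with |det T| = 1, and
  -- comparing volumes of balls then gives c = 1.
  have hcτ : τ * c ^ 2 = τ * c ^ 4 := by
    rcases hT with rfl | ⟨hdet, -⟩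
    · simp
    · have hc1 : c = 1 := by
        have h1 := volume_real_image_linearEquiv T (Metric.ball 0 1)
        have himg : T '' Metric.ball 0 1 = Metric.ball 0 c := by
          ext y
          obtain ⟨x, rfl⟩ := T.surjective y
          rw [T.injective.mem_set_image, mem_ball_zero_iff, mem_ball_zero_iff, hTn]
          exact (mul_lt_iff_lt_one_right hc).symm
        rw [himg, hdet, one_mul, Measure.real, Measure.real,
          Measure.addHaar_ball_of_pos _ _ hc, ENNReal.toReal_mul,
          ENNReal.toReal_ofReal (by positivity)] at h1
        have hv : (volume (Metric.ball (0 : 𝔼) 1)).toReal ≠ 0 :=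
          (ENNReal.toReal_pos (Metric.measure_ball_pos _ _ one_pos).ne'
            measure_ball_lt_top.ne).ne'
        have h2 : c ^ Module.finrank ℝ 𝔼 = 1 := by simpa [hv] using h1
        refine (pow_eq_one_iff_of_nonneg hc.le ?_).mp h2
        simp
        omega
      rw [hc1]; simp
  rw [← div_le_iff₀' (by positivity)]
  refine le_plateEigenvalueSum hd τ (isOpen_image_linearEquiv T ho) (hne.image _)
    (isBounded_image_linearEquiv T hb) fun f hf horth => ?_
  have h1 := plateEigenvalueSum_preimage_le hd τ T.toContinuousLinearEquiv
    (isOpen_image_linearEquiv T ho) (hne.image _) (isBounded_image_linearEquiv T hb) hf horth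
  have himg : T.toContinuousLinearEquiv ⁻¹' (T '' Ω) = Ω := T.injective.preimage_image Ω
  rw [himg] at h1
  rw [div_le_iff₀' (by positivity), Finset.mul_sum]
  refine h1.trans_eq (Finset.sum_congr rfl fun j _ => ?_)
  rw [plateEnergy_eq_spectral, ← integral_const_mul]
  refine integral_congr_ae (ae_of_all _ fun ξ => ?_)
  have h2 : ‖(T.toContinuousLinearEquiv.toLinearEquiv : 𝔼 →ₗ[ℝ] 𝔼).adjoint ξ‖ = c * ‖ξ‖ := hTa ξ
  simp only [norm_smul, h2, Real.norm_of_nonneg (by positivity : (0 : ℝ) ≤ 2 * π)]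
  linear_combination ((2 * π) ^ 2 * ‖ξ‖ ^ 2 * ‖(f j).spectralTransform ξ‖ ^ 2) * hcτ

/-- A similarity maximizes the eigenvalue sum, relative to the fourth moment of the inverse. -/
theorem plateProduct_le (hd : 1 ≤ d) {Ω : Set 𝔼} (hΩ : IsBoundedDomain Ω)
    (hfr : AdmitsFrames 2 Ω) (n : ℕ) {τ : ℝ} {S T : 𝔼 ≃ₗ[ℝ] 𝔼} (hS : AdmissibleTension τ S)
    (hT : AdmissibleTension τ T) (hTo : IsMultipleOfOrthogonal T) :
    plateProduct τ n Ω S ≤ plateProduct τ n Ω T := by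
  obtain ⟨ho, hconn, hb⟩ := hΩ
  have hne := hconn.nonempty
  obtain ⟨c, hc, hTn, hTa⟩ := exists_pos_of_isMultipleOfOrthogonal hd hTo
  rw [plateProduct_eq τ n ho, plateProduct_eq τ n ho]
  refine mul_le_mul_of_nonneg_right ?_ (by positivity)
  have hI1 : 0 < ∫ x in Ω, ‖x‖ ^ 4 :=
    setIntegral_norm_pow_pos hd ho hne hb (L := LinearMap.id) Function.injective_id
  have hIS : 0 < ∫ x in Ω, ‖S.symm x‖ ^ 4 :=
    setIntegral_norm_pow_pos hd ho hne hb (L := (S.symm : 𝔼 →ₗ[ℝ] 𝔼)) S.symm.injective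
  have hIT : ∫ x in Ω, ‖T.symm x‖ ^ 4 = (c ^ 4)⁻¹ * ∫ x in Ω, ‖x‖ ^ 4 := by
    rw [← integral_const_mul]
    refine integral_congr_ae (ae_of_all _ fun x => ?_)
    have h := hTn (T.symm x)
    rw [T.apply_symm_apply] at h
    simp only
    rw [h]
    field_simp
  have h1 : plateEigenvalueSum τ n (S '' Ω) * (∫ x in Ω, ‖x‖ ^ 4) / (∫ x in Ω, ‖S.symm x‖ ^ 4) ≤
      plateEigenvalueSum τ n Ω := by
    refine le_plateEigenvalueSum hd τ ho hne hb fun f hf horth => ?_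
    rw [div_le_iff₀' hIS]
    exact hfr.plateEigenvalueSum_image_mul_le hd ho hne hb hS hf horth
  have h2 := plateEigenvalueSum_le_of_isMultipleOfOrthogonal hd ho hne hb hT hc hTn hTa n
  rw [hIT, div_le_div_iff₀ hIS (by positivity)]
  rw [div_le_iff₀ hIS] at h1
  calc plateEigenvalueSum τ n (S '' Ω) * ((c ^ 4)⁻¹ * ∫ x in Ω, ‖x‖ ^ 4)
      = (c ^ 4)⁻¹ * (plateEigenvalueSum τ n (S '' Ω) * ∫ x in Ω, ‖x‖ ^ 4) := by ring
    _ ≤ (c ^ 4)⁻¹ * ((c ^ 4 * plateEigenvalueSum τ n (T '' Ω)) *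
        ∫ x in Ω, ‖S.symm x‖ ^ 4) := by
      exact mul_le_mul_of_nonneg_left (h1.trans (mul_le_mul_of_nonneg_right h2 hIS.le))
        (by positivity)
    _ = _ := by field_simp

end Maximality

/-! ### The plane: trading the inverse for the transpose -/

section Plane

open scoped InnerProductSpace

local notation "𝔼²" => EuclideanSpace ℝ (Fin 2)

/-- The quarter turn of the plane. -/
noncomputable def quarterTurn :
    EuclideanSpace ℝ (Fin 2) →ₗ[ℝ] EuclideanSpace ℝ (Fin 2) where
  toFun x := !₂[-x 1, x 0]
  map_add' x y := by ext i; fin_cases i <;> simp [add_comm]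
  map_smul' c x := by ext i; fin_cases i <;> simp

theorem norm_quarterTurn (x : 𝔼²) : ‖quarterTurn x‖ = ‖x‖ := by
  simp [EuclideanSpace.norm_eq, quarterTurn, Fin.sum_univ_two, add_comm]

theorem norm_quarterTurn_adjoint (x : 𝔼²) : ‖quarterTurn.adjoint x‖ = ‖x‖ := by
  have h : quarterTurn.adjoint x = -quarterTurn x := by
    refine ext_inner_right ℝ fun y => ?_
    rw [LinearMap.adjoint_inner_left]
    simp [quarterTurn, PiLp.inner_apply, Fin.sum_univ_two]
  rw [h, norm_neg, norm_quarterTurn]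

/-- The inverse of a planar linear map, up to the determinant and a rotation, is the rotated
adjoint. -/
theorem quarterTurn_symm_apply (T : 𝔼² ≃ₗ[ℝ] 𝔼²) (x : 𝔼²) :
    LinearMap.det (T : 𝔼² →ₗ[ℝ] 𝔼²) • quarterTurn (T.symm x) =
      (T : 𝔼² →ₗ[ℝ] 𝔼²).adjoint (quarterTurn x) := by
  obtain ⟨y, rfl⟩ := T.surjective x
  rw [T.symm_apply_apply]
  set e := EuclideanSpace.basisFun (Fin 2) ℝ with he
  have hx : ∀ y : 𝔼², T y = y 0 • T (e 0) + y 1 • T (e 1) := by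
    intro y
    rw [← T.map_smul, ← T.map_smul, ← T.map_add]
    congr 1
    ext i; fin_cases i <;> simp [he]
  have hdet : LinearMap.det (T : 𝔼² →ₗ[ℝ] 𝔼²) =
      T (e 0) 0 * T (e 1) 1 - T (e 1) 0 * T (e 0) 1 := by
    rw [← LinearMap.det_toMatrix e.toBasis, Matrix.det_fin_two]
    simp [LinearMap.toMatrix_apply, he]
  refine ext_inner_right ℝ fun z => ?_
  rw [LinearMap.adjoint_inner_left, LinearEquiv.coe_coe, hx y, hx z, hdet]
  simp [quarterTurn, PiLp.inner_apply, Fin.sum_univ_two]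
  ring

/-- In the plane, the fourth moments of the images under a linear map and under its inverse agree,
up to the determinant. -/
theorem AdmitsFrames.setIntegral_symm {Ω : Set 𝔼²} (h : AdmitsFrames 2 Ω) (ho : IsOpen Ω)
    (hne : Ω.Nonempty) (hb : Bornology.IsBounded Ω) (T : 𝔼² ≃ₗ[ℝ] 𝔼²) :
    LinearMap.det (T : 𝔼² →ₗ[ℝ] 𝔼²) ^ 4 * ∫ x in Ω, ‖T.symm x‖ ^ 4 = ∫ x in Ω, ‖T x‖ ^ 4 := by
  rw [← integral_const_mul]
  have h1 : ∀ x, LinearMap.det (T : 𝔼² →ₗ[ℝ] 𝔼²) ^ 4 * ‖T.symm x‖ ^ 4 =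
      ‖((T : 𝔼² →ₗ[ℝ] 𝔼²).adjoint ∘ₗ quarterTurn) x‖ ^ 4 := by
    intro x
    rw [LinearMap.comp_apply, ← quarterTurn_symm_apply, norm_smul, norm_quarterTurn, mul_pow,
      Real.norm_eq_abs, Even.pow_abs (by decide)]
  simp_rw [h1]
  -- Transposing T* J, with J the quarter turn, gives J* T, and J* preserves norms.
  rw [← h.setIntegral_adjoint (by norm_num) ho hne hb]
  refine integral_congr_ae (ae_of_all _ fun x => ?_)
  simp only [LinearMap.adjoint_comp, LinearMap.adjoint_adjoint, LinearMap.comp_apply,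
    norm_quarterTurn_adjoint, LinearEquiv.coe_coe]

/-- With d = 2 the exponents are 2 and 3; the five powers of the determinant from the areas cancel
one from the Jacobian and four from the inverse-to-transpose exchange. -/
theorem plateProduct_eq_planarPlateProduct {Ω : Set 𝔼²} (hΩ : IsBoundedDomain Ω)
    (hfr : AdmitsFrames 2 Ω) (n : ℕ) (τ : ℝ) (T : 𝔼² ≃ₗ[ℝ] 𝔼²) :
    plateProduct τ n Ω T = planarPlateProduct τ n 0 (T '' Ω) := by
  obtain ⟨ho, hconn, hb⟩ := hΩ
  have hne := hconn.nonempty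
  have h4 := hfr.setIntegral_symm ho hne hb T
  have hdet : LinearMap.det (T : 𝔼² →ₗ[ℝ] 𝔼²) ^ 4 = |LinearMap.det (T : 𝔼² →ₗ[ℝ] 𝔼²)| ^ 4 :=
    (Even.pow_abs (by decide) _).symm
  have hIT : 0 < ∫ x in Ω, ‖T.symm x‖ ^ 4 :=
    setIntegral_norm_pow_pos (by norm_num) ho hne hb (L := (T.symm : 𝔼² →ₗ[ℝ] 𝔼²)) T.symm.injective
  rw [plateProduct_eq τ n ho, planarPlateProduct, volume_real_image_linearEquiv,
    fourthMoment_zero_image T ho, ← h4, hdet]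
  have hD := abs_det_linearEquiv_pos T
  set D := |LinearMap.det (T : 𝔼² →ₗ[ℝ] 𝔼²)|
  have e1 : (4 : ℝ) / ((2 : ℕ) : ℝ) = ((2 : ℕ) : ℝ) := by norm_num
  have e2 : (1 : ℝ) + ((2 : ℕ) : ℝ) = ((3 : ℕ) : ℝ) := by norm_num
  rw [e1, e2, Real.rpow_natCast, Real.rpow_natCast]
  field_simp

theorem planarPlateProduct_le {Ω : Set 𝔼²} (hΩ : IsBoundedDomain Ω) (hfr : AdmitsFrames 2 Ω)
    (n : ℕ) {τ : ℝ} {S T : 𝔼² ≃ₗ[ℝ] 𝔼²} (hS : AdmissibleTension τ S) (hT : AdmissibleTension τ T)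
    (hTo : IsMultipleOfOrthogonal T) :
    planarPlateProduct τ n 0 (S '' Ω) ≤ planarPlateProduct τ n 0 (T '' Ω) := by
  rw [← plateProduct_eq_planarPlateProduct hΩ hfr, ← plateProduct_eq_planarPlateProduct hΩ hfr]
  exact plateProduct_le (by norm_num) hΩ hfr n hS hT hTo

end Plane

/-! ### Triangles and ellipses -/

section Translations

theorem planarPlateProduct_image_add (τ : ℝ) (n : ℕ) (c : EuclideanSpace ℝ (Fin 2))
    {Ω : Set (EuclideanSpace ℝ (Fin 2))} (ho : IsOpen Ω) (hne : Ω.Nonempty)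
    (hb : Bornology.IsBounded Ω) :
    planarPlateProduct τ n c ((fun x => c + x) '' Ω) = planarPlateProduct τ n 0 Ω := by
  have h1 : fourthMoment c ((fun x => c + x) '' Ω) = fourthMoment 0 Ω := by
    have h := (measurePreserving_add_left (volume : Measure (EuclideanSpace ℝ (Fin 2)))
      c).setIntegral_image_emb (Homeomorph.addLeft c).measurableEmbedding
      (fun x => ‖x - c‖ ^ 4) Ω
    rw [fourthMoment, fourthMoment, h]
    simp
  have h2 : volume.real ((fun x => c + x) '' Ω) = volume.real Ω := by
    rw [Measure.real, Measure.real, Set.image_add_left, measure_preimage_add]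
  rw [planarPlateProduct, planarPlateProduct, h1, h2,
    plateEigenvalueSum_image_add (by norm_num) τ c ho hne hb]

end Translations

/-! ### Threefold symmetry implies 2-frames -/

section PlanarFrames

open scoped InnerProductSpace

local notation "𝔼" => EuclideanSpace ℝ (Fin 2)

theorem MvPolynomial.IsHomogeneous.exists_eval_eq_quartic {P : MvPolynomial (Fin 2) ℝ}
    (hP : P.IsHomogeneous 4) : ∃ a b c e f : ℝ, ∀ x : Fin 2 → ℝ, P.eval x =
      a * x 0 ^ 4 + b * (x 0 ^ 3 * x 1) + c * (x 0 ^ 2 * x 1 ^ 2) + e * (x 0 * x 1 ^ 3) +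
        f * x 1 ^ 4 := by
  set g : ℕ → (Fin 2 →₀ ℕ) := fun k => Finsupp.single 0 k + Finsupp.single 1 (4 - k) with hg
  have hg0 : ∀ k, g k 0 = k := fun k => by simp [hg]
  have hg1 : ∀ k, g k 1 = 4 - k := fun k => by simp [hg]
  have hsub : P.support ⊆ (Finset.range 5).image g := by
    intro m hm
    have h := hP (MvPolynomial.mem_support_iff.mp hm)
    have h' : m 0 + m 1 = 4 := by
      rw [Finsupp.weight_apply, Finsupp.sum_fintype _ _ (by simp)] at h
      simpa [Fin.sum_univ_two] using h
    refine Finset.mem_image.mpr ⟨m 0, Finset.mem_range.mpr (by omega), ?_⟩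
    ext i
    fin_cases i
    · exact hg0 _
    · simpa [hg1] using (by omega : 4 - m 0 = m 1)
  refine ⟨P.coeff (g 4), P.coeff (g 3), P.coeff (g 2), P.coeff (g 1), P.coeff (g 0), fun x => ?_⟩
  rw [MvPolynomial.eval_eq', Finset.sum_subset hsub fun m _ hm => by
    rw [MvPolynomial.notMem_support_iff.mp hm, zero_mul]]
  rw [Finset.sum_image fun k _ l _ hkl => by
    have := congrArg (fun m => m 0) hkl
    simpa [hg0] using this]
  simp only [Finset.sum_range_succ, Finset.sum_range_zero, Fin.prod_univ_two, hg0, hg1]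
  norm_num
  ring

/-- A planar set with a threefold rotational symmetry admits `2`-frames. -/
theorem admitsFrames_two_of_threefold {Ω : Set 𝔼} {U : 𝔼 ≃ₗᵢ[ℝ] 𝔼}
    (hU : U ∈ linearSymmetries Ω) (h3 : ∀ x, U (U x) + U x + x = 0) : AdmitsFrames 2 Ω := by
  intro P hP hinv
  obtain ⟨a, b, c, e, f, hev⟩ := MvPolynomial.IsHomogeneous.exists_eval_eq_quartic hP
  set e₀ : 𝔼 := EuclideanSpace.basisFun (Fin 2) ℝ 0 with he0
  set e₁ : 𝔼 := EuclideanSpace.basisFun (Fin 2) ℝ 1 with he1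
  -- U² + U + 1 = 0 together with isometry makes U a rotation by a third of a turn; its direction,
  -- the sign of s below, stays undetermined.
  have hhalf : ∀ x : 𝔼, ‖x‖ = 1 → ⟪U x, x⟫_ℝ = -1 / 2 := by
    intro x hx
    have h1 : ⟪U x, U (U x)⟫_ℝ = ⟪x, U x⟫_ℝ := U.inner_map_map _ _
    have h2 : U (U x) = -(U x) - x := by
      have h := h3 x
      rw [add_assoc] at h
      rw [eq_neg_of_add_eq_zero_left h]
      abel
    rw [h2, inner_sub_right, inner_neg_right, U.inner_map_map, real_inner_self_eq_norm_sq, hx,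
      real_inner_comm (U x) x] at h1
    linarith
  have h00 : U e₀ 0 = -1 / 2 := by
    have := hhalf e₀ (by simp [he0])
    simpa [he0, PiLp.inner_apply, Fin.sum_univ_two] using this
  have h11 : U e₁ 1 = -1 / 2 := by
    have := hhalf e₁ (by simp [he1])
    simpa [he1, PiLp.inner_apply, Fin.sum_univ_two] using this
  have hn0 : U e₀ 0 ^ 2 + U e₀ 1 ^ 2 = 1 := by
    have h : ‖U e₀‖ ^ 2 = 1 := by rw [U.norm_map]; simp [he0]
    rw [EuclideanSpace.real_norm_sq_eq, Fin.sum_univ_two] at h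
    exact h
  have horth : U e₀ 0 * U e₁ 0 + U e₀ 1 * U e₁ 1 = 0 := by
    have h : ⟪U e₀, U e₁⟫_ℝ = 0 := by
      rw [U.inner_map_map]; simp [he0, he1, PiLp.inner_apply]
    rw [PiLp.inner_apply, Fin.sum_univ_two] at h
    simpa [mul_comm] using h
  set s := U e₀ 1 with hs
  have hs2 : s ^ 2 = 3 / 4 := by rw [h00] at hn0; linarith
  have h10 : U e₁ 0 = -s := by rw [h00, h11] at horth; linarith
  have hUU : ∀ x : 𝔼, ∀ i, U (U x) i = - U x i - x i := by
    intro x i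
    have h := congrArg (fun y : 𝔼 => y i) (h3 x)
    simp only [PiLp.add_apply, PiLp.zero_apply] at h
    linarith
  have hUUm := trans_mem_linearSymmetries hU hU
  -- U and U² send each basis vector to a pair of mirror images differing by the sign of s. The sum
  -- and difference of the two equations isolate the even and odd coefficients.
  have q1 := hinv U hU e₀
  have q2 := hinv U hU e₁
  have q3 := hinv _ hUUm e₀
  have q4 := hinv _ hUUm e₁
  simp only [hev, LinearIsometryEquiv.trans_apply, hUU, h00, h11, h10, ← hs] at q1 q2 q3 q4
  have z00 : e₀ 0 = 1 := by simp [he0]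
  have z01 : e₀ 1 = 0 := by simp [he0]
  have z10 : e₁ 0 = 0 := by simp [he1]
  have z11 : e₁ 1 = 1 := by simp [he1]
  simp only [z00, z01, z10, z11] at q1 q2 q3 q4
  have hs3 : s ^ 3 = 3 / 4 * s := by rw [pow_succ, hs2]
  have hs4 : s ^ 4 = 9 / 16 := by rw [show s ^ 4 = (s ^ 2) ^ 2 by ring, hs2]; norm_num
  have hs0 : s ≠ 0 := by rintro h; rw [h] at hs2; norm_num at hs2
  have r1 : 3 * c + 9 * f = 15 * a := by
    ring_nf at q1 q3
    rw [hs2, hs3, hs4] at q1 q3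
    linarith
  have r2 : b + 3 * e = 0 := by
    ring_nf at q1 q3
    rw [hs2, hs3, hs4] at q1 q3
    have : s * (b + 3 * e) = 0 := by linarith
    exact (mul_eq_zero.mp this).resolve_left hs0
  have r3 : 9 * a + 3 * c = 15 * f := by
    ring_nf at q2 q4
    rw [hs2, hs3, hs4] at q2 q4
    linarith
  have r4 : 3 * b + e = 0 := by
    ring_nf at q2 q4
    rw [hs2, hs3, hs4] at q2 q4
    have : s * (3 * b + e) = 0 := by linarith
    exact (mul_eq_zero.mp this).resolve_left hs0
  refine ⟨a, fun x => ?_⟩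
  have hb : b = 0 := by linarith
  have he : e = 0 := by linarith
  have hf : f = a := by linarith
  have hc : c = 2 * a := by linarith
  have hx : ‖x‖ ^ (2 * 2) = (x 0 ^ 2 + x 1 ^ 2) ^ 2 := by
    rw [pow_mul, EuclideanSpace.real_norm_sq_eq, Fin.sum_univ_two]
  rw [hev, hx, hb, he, hf, hc]
  ring

end PlanarFrames

/-! ### Disks and their affine images -/

section Ellipses

local notation "𝔼" => EuclideanSpace ℝ (Fin 2)

theorem exists_threefold_rotation : ∃ U : 𝔼 ≃ₗᵢ[ℝ] 𝔼, ∀ x, U (U x) + U x + x = 0 := by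
  have h3 : √3 * √3 = 3 := Real.mul_self_sqrt (by norm_num)
  set L : 𝔼 →ₗ[ℝ] 𝔼 :=
    { toFun := fun x => !₂[-(1 / 2) * x 0 - √3 / 2 * x 1, √3 / 2 * x 0 - 1 / 2 * x 1]
      map_add' := fun x y => by ext i; fin_cases i <;> simp <;> ring
      map_smul' := fun c x => by ext i; fin_cases i <;> simp <;> ring } with hL
  have hLn : ∀ x, ‖L x‖ = ‖x‖ := by
    intro x
    rw [EuclideanSpace.norm_eq, EuclideanSpace.norm_eq]
    congr 1
    simp only [hL, LinearMap.coe_mk, AddHom.coe_mk, Fin.sum_univ_two, Real.norm_eq_abs, sq_abs]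
    simp only [Matrix.cons_val_zero, Matrix.cons_val_one]
    linear_combination (x 0 ^ 2 + x 1 ^ 2) / 4 * h3
  refine ⟨LinearIsometry.toLinearIsometryEquiv ⟨L, hLn⟩ rfl, fun x => ?_⟩
  change L (L x) + L x + x = 0
  ext i
  fin_cases i
  · simp [hL]
    linear_combination -(x 0) / 4 * h3
  · simp [hL]
    linear_combination -(x 1) / 4 * h3

theorem admitsFrames_ball (r : ℝ) : AdmitsFrames 2 (Metric.ball (0 : 𝔼) r) := by
  obtain ⟨U, hU⟩ := exists_threefold_rotation
  refine admitsFrames_two_of_threefold (U := U) ?_ hU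
  change U '' _ = _
  rw [LinearIsometryEquiv.image_ball, map_zero]

theorem isBoundedDomain_of_convex {Ω : Set 𝔼} (ho : IsOpen Ω) (hne : Ω.Nonempty)
    (hc : Convex ℝ Ω) (hb : Bornology.IsBounded Ω) : IsBoundedDomain Ω :=
  ⟨ho, (hc.isPathConnected hne).isConnected, hb⟩

/-- A domain with `2`-frames has the largest product among its linear images, up to
translations. -/
theorem planarPlateProduct_image_add_le {Ω : Set 𝔼} (hΩ : IsBoundedDomain Ω)
    (hfr : AdmitsFrames 2 Ω) (n : ℕ) {τ : ℝ} (S : 𝔼 ≃ₗ[ℝ] 𝔼) (a c : 𝔼)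
    (hτ : τ = 0 ∨ (volume.real ((fun x => a + x) '' (S '' Ω)) =
      volume.real ((fun x => c + x) '' Ω) ∧ 0 < τ)) :
    planarPlateProduct τ n a ((fun x => a + x) '' (S '' Ω)) ≤
      planarPlateProduct τ n c ((fun x => c + x) '' Ω) := by
  have hne := hΩ.2.1.nonempty
  have hvol : ∀ (b : 𝔼) (s : Set 𝔼), volume.real ((fun x => b + x) '' s) = volume.real s := by
    intro b s
    rw [Measure.real, Measure.real, Set.image_add_left, measure_preimage_add]
  rw [planarPlateProduct_image_add τ n a (isOpen_image_linearEquiv S hΩ.1) (hne.image _)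
    (isBounded_image_linearEquiv S hΩ.2.2), planarPlateProduct_image_add τ n c hΩ.1 hne hΩ.2.2]
  have hS : AdmissibleTension τ S := by
    rcases hτ with h | ⟨h, hτ⟩
    · exact Or.inl h
    · refine Or.inr ⟨?_, hτ⟩
      rw [hvol, hvol, volume_real_image_linearEquiv] at h
      have hpos : 0 < volume.real Ω :=
        ENNReal.toReal_pos (hΩ.1.measure_pos volume hne).ne' hΩ.2.2.measure_lt_top.ne
      exact mul_right_cancel₀ hpos.ne' (h.trans (one_mul _).symm)
  have hid : AdmissibleTension τ (LinearEquiv.refl ℝ 𝔼) := by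
    rcases hτ with h | ⟨-, hτ⟩
    · exact Or.inl h
    · exact Or.inr ⟨by simp, hτ⟩
  have h := planarPlateProduct_le hΩ hfr n hS hid
    ⟨1, LinearIsometryEquiv.refl ℝ 𝔼, fun x => by simp⟩
  have himg : LinearEquiv.refl ℝ 𝔼 '' Ω = Ω := Set.image_id Ω
  rwa [himg] at h

theorem planarPlateProduct_ellipse_le (n : ℕ) {τ : ℝ} (a c : 𝔼) (T : 𝔼 ≃ₗ[ℝ] 𝔼) {r : ℝ}
    (hr : 0 < r)
    (hτ : τ = 0 ∨ (volume.real (ellipse a T) = volume.real (Metric.ball c r) ∧ 0 < τ)) :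
    planarPlateProduct τ n a (ellipse a T) ≤ planarPlateProduct τ n c (Metric.ball c r) := by
  -- Rescaling by 1/r presents the ellipse as a linear image of the disk of radius r, the domain it
  -- is compared with.
  set S : 𝔼 ≃ₗ[ℝ] 𝔼 := (LinearEquiv.smulOfNeZero ℝ 𝔼 r hr.ne').symm.trans T with hS
  have h1 : ellipse a T = (fun x => a + x) '' (S '' Metric.ball 0 r) := by
    have h2 : Metric.ball (0 : 𝔼) r = (LinearEquiv.smulOfNeZero ℝ 𝔼 r hr.ne') '' Metric.ball 0 1 := by
      have h3 : (LinearEquiv.smulOfNeZero ℝ 𝔼 r hr.ne' : 𝔼 → 𝔼) = fun x => r • x := rfl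
      rw [h3, Set.image_smul, smul_ball hr.ne', smul_zero, mul_one, Real.norm_of_nonneg hr.le]
    rw [h2, ← Set.image_comp, ← Set.image_comp, ellipse]
    refine Set.image_congr fun x _ => ?_
    exact congrArg (fun y => a + T y)
      ((LinearEquiv.smulOfNeZero ℝ 𝔼 r hr.ne').symm_apply_apply x).symm
  have h2 : Metric.ball c r = (fun x => c + x) '' Metric.ball 0 r := by
    simp
  rw [h1, h2] at hτ ⊢
  exact planarPlateProduct_image_add_le (isBoundedDomain_of_convex Metric.isOpen_ball
    (Metric.nonempty_ball.mpr hr) (convex_ball _ _) Metric.isBounded_ball)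
    (admitsFrames_ball r) n S a c hτ

end Ellipses

/-! ### Equilateral triangles and their affine images -/

section Triangles

open scoped InnerProductSpace

local notation "𝔼" => EuclideanSpace ℝ (Fin 2)

/-- The triangle `x > -1/3`, `y > -1/3`, `x + y < 1/3` with centroid at the origin. -/
def modelTriangle : Set (EuclideanSpace ℝ (Fin 2)) :=
  {x | -(1 / 3) < x 0 ∧ -(1 / 3) < x 1 ∧ x 0 + x 1 < 1 / 3}

theorem isBoundedDomain_modelTriangle : IsBoundedDomain modelTriangle := by
  refine isBoundedDomain_of_convex ?_ ⟨0, by norm_num [modelTriangle]⟩ ?_ ?_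
  · have h0 : Continuous fun x : 𝔼 => x 0 := by fun_prop
    have h1 : Continuous fun x : 𝔼 => x 1 := by fun_prop
    exact (isOpen_lt continuous_const h0).inter
      ((isOpen_lt continuous_const h1).inter (isOpen_lt (h0.add h1) continuous_const))
  · rintro x ⟨hx1, hx2, hx3⟩ y ⟨hy1, hy2, hy3⟩ a b ha hb hab
    refine ⟨?_, ?_, ?_⟩
    all_goals
      simp only [PiLp.add_apply, PiLp.smul_apply, smul_eq_mul]
      rcases ha.eq_or_lt with rfl | ha
      · obtain rfl : b = 1 := by linarith
        linarith
      · nlinarith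
  · refine (Metric.isBounded_ball (x := (0 : 𝔼)) (r := 2)).subset ?_
    rintro x ⟨h1, h2, h3⟩
    rw [mem_ball_zero_iff]
    refine lt_of_pow_lt_pow_left₀ 2 (by norm_num) ?_
    rw [EuclideanSpace.real_norm_sq_eq, Fin.sum_univ_two]
    nlinarith

/-- The linear map sending the standard basis to the edges of a triangle at its first vertex. -/
theorem exists_edgeEquiv (t : Affine.Triangle ℝ 𝔼) : ∃ A : 𝔼 ≃ₗ[ℝ] 𝔼, ∀ x : 𝔼,
    A x = x 0 • (t.points 1 - t.points 0) + x 1 • (t.points 2 - t.points 0) := by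
  set L : 𝔼 →ₗ[ℝ] 𝔼 :=
    { toFun := fun x => x 0 • (t.points 1 - t.points 0) + x 1 • (t.points 2 - t.points 0)
      map_add' := fun x y => by simp only [PiLp.add_apply]; module
      map_smul' := fun c x => by simp only [PiLp.smul_apply, smul_eq_mul, RingHom.id_apply]; module }
    with hL
  have hinj : Function.Injective L := by
    rw [injective_iff_map_eq_zero]
    intro x hx
    -- A relation between the edges at the first vertex is a relation between the vertices whose
    -- weights sum to zero.
    have h := affineIndependent_iff.mp t.independent Finset.univ ![-x 0 - x 1, x 0, x 1]
      (by rw [Fin.sum_univ_three]; simp only [Matrix.cons_val]; ring) (by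
        refine Eq.trans ?_ hx
        rw [Fin.sum_univ_three]
        simp only [Matrix.cons_val, hL, LinearMap.coe_mk, AddHom.coe_mk]
        module)
    ext i
    fin_cases i
    · exact h 1 (Finset.mem_univ _)
    · exact h 2 (Finset.mem_univ _)
  exact ⟨LinearEquiv.ofInjectiveEndo L hinj, fun x => rfl⟩

theorem triangle_centroid_eq (t : Affine.Triangle ℝ 𝔼) :
    t.centroid = (1 / 3 : ℝ) • (t.points 0 + t.points 1 + t.points 2) := by
  rw [Affine.Simplex.centroid_eq_affineCombination,
    Finset.affineCombination_eq_linear_combination _ _ _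
      (Finset.sum_centroidWeights_eq_one_of_card_ne_zero ℝ _ (by simp))]
  rw [Fin.sum_univ_three]
  simp only [Finset.centroidWeights_apply, Finset.card_univ, Fintype.card_fin]
  norm_num

/-- The model coordinates are the barycentric weights of the second and third vertices minus 1/3, so
the centroid sits at the origin. -/
theorem triangle_interior_eq (t : Affine.Triangle ℝ 𝔼) {A : 𝔼 ≃ₗ[ℝ] 𝔼}
    (hA : ∀ x : 𝔼, A x = x 0 • (t.points 1 - t.points 0) + x 1 • (t.points 2 - t.points 0)) :
    t.interior = (fun x => t.centroid + x) '' (A '' modelTriangle) := by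
  rw [triangle_centroid_eq]
  ext p
  constructor
  · rintro ⟨w, hw1, hw, rfl⟩
    rw [Fin.sum_univ_three] at hw1
    refine ⟨_, ⟨!₂[w 1 - 1 / 3, w 2 - 1 / 3], ⟨?_, ?_, ?_⟩, rfl⟩, ?_⟩
    · simpa using (hw 1).1
    · simpa using (hw 2).1
    · have := (hw 0).1
      simp only [Matrix.cons_val_zero, Matrix.cons_val_one]
      linarith
    · rw [Finset.affineCombination_eq_linear_combination _ _ _ (by rw [Fin.sum_univ_three, hw1])]
      rw [Fin.sum_univ_three]
      simp only [hA, Matrix.cons_val_zero, Matrix.cons_val_one]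
      have h0 : w 0 = 1 - w 1 - w 2 := by linarith
      rw [h0]
      module
  · rintro ⟨_, ⟨x, ⟨h1, h2, h3⟩, rfl⟩, rfl⟩
    have hsum : ∑ i, ![1 / 3 - x 0 - x 1, x 0 + 1 / 3, x 1 + 1 / 3] i = (1 : ℝ) := by
      simp only [Fin.sum_univ_three, Matrix.cons_val]
      ring
    refine ⟨![1 / 3 - x 0 - x 1, x 0 + 1 / 3, x 1 + 1 / 3], hsum, fun i => ?_, ?_⟩
    · fin_cases i <;> simp only [Set.mem_Ioo] <;> constructor <;>
        simp <;> linarith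
    · rw [Finset.affineCombination_eq_linear_combination _ _ _ hsum]
      rw [Fin.sum_univ_three]
      simp only [hA, Matrix.cons_val]
      module

/-- An equilateral triangle is invariant under a threefold rotation about its centroid. -/
theorem admitsFrames_of_equilateral {t : Affine.Triangle ℝ 𝔼} (ht : t.Equilateral)
    {A : 𝔼 ≃ₗ[ℝ] 𝔼}
    (hA : ∀ x : 𝔼, A x = x 0 • (t.points 1 - t.points 0) + x 1 • (t.points 2 - t.points 0)) :
    AdmitsFrames 2 (A '' modelTriangle) := by
  -- P permutes the three barycentric weights cyclically. For an equilateral triangle, ‖A x‖² is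
  -- proportional to x₀² + x₀x₁ + x₁², which P preserves, so its conjugate by A is an isometry.
  set P : 𝔼 →ₗ[ℝ] 𝔼 :=
    { toFun := fun x => !₂[-x 0 - x 1, x 0]
      map_add' := fun x y => by ext i; fin_cases i <;> simp <;> ring
      map_smul' := fun c x => by ext i; fin_cases i <;> simp <;> ring } with hP
  have hP0 : ∀ x, P x 0 = -x 0 - x 1 := fun x => rfl
  have hP1 : ∀ x, P x 1 = x 0 := fun x => rfl
  set v := t.points 1 - t.points 0 with hv
  set w := t.points 2 - t.points 0 with hw
  have hvw : ‖v‖ = ‖w‖ ∧ ‖v - w‖ = ‖w‖ := by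
    obtain ⟨r, hr⟩ := ht
    have e1 := hr 1 0 (by decide)
    have e2 := hr 2 0 (by decide)
    have e3 := hr 1 2 (by decide)
    rw [dist_eq_norm] at e1 e2 e3
    refine ⟨by rw [hv, hw, e1, e2], ?_⟩
    rw [hv, hw, sub_sub_sub_cancel_right, e3, e2]
  have hin : ⟪v, w⟫_ℝ = ‖w‖ ^ 2 / 2 := by
    have h := norm_sub_sq_real v w
    rw [hvw.2, hvw.1] at h
    linarith
  have hnorm : ∀ x : 𝔼, ‖A x‖ ^ 2 = ‖w‖ ^ 2 * (x 0 ^ 2 + x 0 * x 1 + x 1 ^ 2) := by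
    intro x
    rw [hA, norm_add_sq_real, norm_smul, norm_smul, mul_pow, mul_pow, Real.norm_eq_abs,
      Real.norm_eq_abs, sq_abs, sq_abs, inner_smul_left, inner_smul_right, hin, hvw.1]
    simp only [conj_trivial]
    ring
  have hiso : ∀ x, ‖(A.toLinearMap ∘ₗ P ∘ₗ A.symm.toLinearMap) x‖ = ‖x‖ := by
    intro x
    obtain ⟨y, rfl⟩ := A.surjective x
    have h : (A.toLinearMap ∘ₗ P ∘ₗ A.symm.toLinearMap) (A y) = A (P y) := by simp
    rw [h]
    refine (sq_eq_sq₀ (norm_nonneg _) (norm_nonneg _)).mp ?_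
    rw [hnorm, hnorm, hP0, hP1]
    ring
  set U : 𝔼 ≃ₗᵢ[ℝ] 𝔼 := LinearIsometry.toLinearIsometryEquiv
    ⟨A.toLinearMap ∘ₗ P ∘ₗ A.symm.toLinearMap, hiso⟩ rfl with hU
  have hUA : ∀ y, U (A y) = A (P y) := fun y => by
    change A (P (A.symm (A y))) = _
    rw [A.symm_apply_apply]
  have hPPP : ∀ x, P (P x) + P x + x = 0 := by
    intro x
    ext i
    fin_cases i
    · simp [hP]
    · simp [hP]
      ring
  refine admitsFrames_two_of_threefold (U := U) ?_ fun x => ?_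
  · have hsub : ∀ x ∈ modelTriangle, P x ∈ modelTriangle := by
      rintro x ⟨h1, h2, h3⟩
      refine ⟨?_, ?_, ?_⟩
      · rw [hP0]; linarith
      · rwa [hP1]
      · rw [hP0, hP1]; linarith
    change U '' (A '' modelTriangle) = A '' modelTriangle
    apply Set.Subset.antisymm
    · rintro _ ⟨_, ⟨x, hx, rfl⟩, rfl⟩
      exact ⟨P x, hsub x hx, (hUA x).symm⟩
    · rintro _ ⟨x, hx, rfl⟩
      -- P³ = 1, so P² provides the preimage.
      refine ⟨A (P (P x)), ⟨_, hsub _ (hsub x hx), rfl⟩, ?_⟩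
      rw [hUA]
      congr 1
      have h1 := hPPP x
      have h2 := hPPP (P x)
      have h3 : P (P (P x)) - x = 0 := by
        rw [← sub_zero (0 : 𝔼)]
        nth_rewrite 1 [← h2]
        rw [← h1]
        module
      exact sub_eq_zero.mp h3
  · obtain ⟨y, rfl⟩ := A.surjective x
    rw [hUA, hUA, ← map_add, ← map_add, hPPP, map_zero]

/-- Both triangles are affine images of the model, so with centroids at the origin s is the image of
t under B A⁻¹. -/
theorem planarPlateProduct_triangle_le (n : ℕ) {τ : ℝ} {s t : Affine.Triangle ℝ 𝔼}
    (ht : t.Equilateral)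
    (hτ : τ = 0 ∨ (volume.real s.interior = volume.real t.interior ∧ 0 < τ)) :
    planarPlateProduct τ n s.centroid s.interior ≤
      planarPlateProduct τ n t.centroid t.interior := by
  obtain ⟨A, hA⟩ := exists_edgeEquiv t
  obtain ⟨B, hB⟩ := exists_edgeEquiv s
  have himg : B '' modelTriangle = (A.symm.trans B) '' (A '' modelTriangle) := by
    rw [← Set.image_comp]
    refine Set.image_congr fun x _ => ?_
    simp
  rw [triangle_interior_eq t hA, triangle_interior_eq s hB, himg] at hτ ⊢
  obtain ⟨ho, hc, hb⟩ := isBoundedDomain_modelTriangle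
  exact planarPlateProduct_image_add_le ⟨isOpen_image_linearEquiv A ho,
    hc.image _ A.toContinuousLinearEquiv.continuous.continuousOn,
    isBounded_image_linearEquiv A hb⟩ (admitsFrames_of_equilateral ht hA) n _ _ _ hτ

end Triangles

theorem mainTheorem7 :
    -- every dimension
    (∀ (d : ℕ), 1 ≤ d → ∀ Ω : Set (EuclideanSpace ℝ (Fin d)),
      IsBoundedDomain Ω → AdmitsFrames 2 Ω →
      ∀ (n : ℕ) (τ : ℝ) (S T : EuclideanSpace ℝ (Fin d) ≃ₗ[ℝ] EuclideanSpace ℝ (Fin d)),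
        AdmissibleTension τ S → AdmissibleTension τ T → IsMultipleOfOrthogonal T →
        plateProduct τ n Ω S ≤ plateProduct τ n Ω T) ∧
    -- the plane
    (∀ Ω : Set (EuclideanSpace ℝ (Fin 2)), IsBoundedDomain Ω → AdmitsFrames 2 Ω →
      ∀ (n : ℕ) (τ : ℝ),
        (∀ T : EuclideanSpace ℝ (Fin 2) ≃ₗ[ℝ] EuclideanSpace ℝ (Fin 2),
          plateProduct τ n Ω T = planarPlateProduct τ n 0 (T '' Ω)) ∧
        (∀ S T : EuclideanSpace ℝ (Fin 2) ≃ₗ[ℝ] EuclideanSpace ℝ (Fin 2),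
          AdmissibleTension τ S → AdmissibleTension τ T → IsMultipleOfOrthogonal T →
          planarPlateProduct τ n 0 (S '' Ω) ≤ planarPlateProduct τ n 0 (T '' Ω))) ∧
    -- triangles
    (∀ (n : ℕ) (τ : ℝ) (s t : Affine.Triangle ℝ (EuclideanSpace ℝ (Fin 2))),
      t.Equilateral →
      (τ = 0 ∨ (volume.real s.interior = volume.real t.interior ∧ 0 < τ)) →
      planarPlateProduct τ n s.centroid s.interior ≤
        planarPlateProduct τ n t.centroid t.interior) ∧
    -- ellipses
    (∀ (n : ℕ) (τ : ℝ) (a c : EuclideanSpace ℝ (Fin 2))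
      (T : EuclideanSpace ℝ (Fin 2) ≃ₗ[ℝ] EuclideanSpace ℝ (Fin 2)) (r : ℝ), 0 < r →
      (τ = 0 ∨ (volume.real (ellipse a T) = volume.real (Metric.ball c r) ∧ 0 < τ)) →
      planarPlateProduct τ n a (ellipse a T) ≤ planarPlateProduct τ n c (Metric.ball c r)) :=
  ⟨fun _ hd _ hΩ hfr n _ _ _ hS hT hTo => plateProduct_le hd hΩ hfr n hS hT hTo,
    fun _ hΩ hfr n τ => ⟨plateProduct_eq_planarPlateProduct hΩ hfr n τ,
      fun _ _ hS hT hTo => planarPlateProduct_le hΩ hfr n hS hT hTo⟩,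
    fun n _ _ _ ht hτ => planarPlateProduct_triangle_le n ht hτ,
    fun n _ a c T _ hr hτ => planarPlateProduct_ellipse_le n a c T hr hτ⟩
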